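/- Let $n\ge 2$, $l\ge 0$, and work over $\mathbb{C}(q,z)$ with $q,z$ indeterminates. Write $[u]=\frac{q^u-q^{-u}}{q-q^{-1}}$, $(a;p)_m=\prod_{k=1}^m(1-ap^{k-1})$, and ${}_2\phi_1\bigl({a,b\atop c};q,x\bigr)=\sum_{m\ge0}\frac{(a;q)_m(b;q)_m}{(q;q)_m(c;q)_m}x^m$. Let $U_q=U_q(A^{(1)}_{n-1})$ be the Drinfeld–Jimbo algebra (without derivation) with generators $e_i,f_i,k_i^{\pm1}$, $i\in\mathbb{Z}_n$, and let $\mathcal{B}_q\subset U_q$ be the subalgebra generated by $$b_i=-e_i+q^2k_if_i+\tfrac{q}{1-q}k_i\qquad(i\in\mathbb{Z}_n).$$ Let $B_l=\{\alpha=(\alpha_1,\dots,\alpha_n)\in\mathbb{Z}_{\ge0}^n : \alpha_1+\dots+\alpha_n=l\}$, with indices read in $\mathbb{Z}_n$, let $\mathbf e_j$ be the $j$-th unit array, and let $V_{l,x}$ and $V^*_{l,x}$ be the $U_q$-modules with bases $(v_\alpha)_{\alpha\in B_l}$, $(v^*_\alpha)_{\alpha\in B_l}$ and actions $$e_jv_\alpha=x^{\delta_{j,0}}[\alpha_{j+1}]v_{\alpha+\mathbf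 e_j-\mathbf e_{j+1}},\quad f_jv_\alpha=x^{-\delta_{j,0}}[\alpha_j]v_{\alpha-\mathbf e_j+\mathbf e_{j+1}},\quad k_jv_\alpha=q^{\alpha_j-\alpha_{j+1}}v_\alpha,$$ $$e_jv^*_\alpha=-x^{\delta_{j,0}}[\alpha_{j+1}+1]q^{-\alpha_j+\alpha_{j+1}+2}v^*_{\alpha-\mathbf e_j+\mathbf e_{j+1}},\quad f_jv^*_\alpha=-x^{-\delta_{j,0}}[\alpha_j+1]q^{\alpha_j-\alpha_{j+1}}v^*_{\alpha+\mathbf e_j-\mathbf e_{j+1}},\quad k_jv^*_\alpha=q^{-\alpha_j+\alpha_{j+1}}v^*_\alpha,$$ where vectors indexed outside $B_l$ are $0$. Let $\mathcal{A}_q$ be the $q$-boson algebra with generators $\mathbf a^{\pm},\mathbf k$ and relations $\mathbf k\mathbf a^{\pm}=q^{\pm1}\mathbf a^{\pm}\mathbf k$, $\mathbf a^+\mathbf a^-=1-\mathbf k$, $\mathbf a^-\mathbf a^+=1-q\mathbf k$, acting on the Fock space with basis $|m\rangle$ ($m\ge0$) by $\mathbf a^+|m\rangle=|m+1\rangle$,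 $\mathbf a^-|m\rangle=(1-q^m)|m-1\rangle$, $\mathbf k|m\rangle=q^m|m\rangle$; let $\mathbf h|m\rangle=m|m\rangle$ and $\langle m|m'\rangle=(q;q)_m\delta_{m,m'}$. The trace is $\mathrm{Tr}(w^{\mathbf h}X)=\sum_{m\ge0}w^m\frac{\langle m|X|m\rangle}{(q;q)_m}$ when this converges (below: in $\mathbb{C}(q,z)$, as a power series in $z^{-1}$). For $i,j\ge0$ put $$G^j_i=(-q;q)_{i+j}\;{}_2\phi_1\Bigl({q^{-j},-q^{-j}\atop -q^{-i-j}};q,q\mathbf k\Bigr)(\mathbf a^-)^{i-j}\ (i\ge j),\qquad G^j_i=(-q;q)_{i+j}\,(\mathbf a^+)^{j-i}\;{}_2\phi_1\Bigl({q^{-i},-q^{-i}\atop -q^{-i-j}};q,q\mathbf k\Bigr)\ (i\le j).$$ Theorem. There is exactly one linear map $K(z):V_{l,z}\to V^*_{l,z^{-1}}$, $K(z)v_\alpha=\sum_{\gamma\in B_l}K(z)^\gamma_\alpha v^*_\gamma$, which commutes with the action of every $b\in\mathcal{B}_q$ and satisfies $K(z)^{l\mathbf e_1}_{l\mathbf e_1}=1$.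 For all $\alpha,\gamma\in B_l$ the trace below converges and $$K(z)^\gamma_\alpha=\frac{q^{\langle\gamma,\alpha\rangle}(q^{-l}z^{-1};q)_{l+1}}{(q^2;q^2)_l\,(-qz^{-1};q)_l}\,\mathrm{Tr}\Bigl((q^lz)^{-\mathbf h}\,G^{\gamma_1}_{\alpha_1}\cdots G^{\gamma_n}_{\alpha_n}\Bigr),\qquad \langle\gamma,\alpha\rangle=\sum_{1\le i<j\le n}\gamma_i\alpha_j .$$ -/

import Mathlib

open Filter

/-! Base fields `ℂ(q)` and `ℂ(q,z) = ℂ(q)(z)`. -/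

/-- The field `ℂ(q)`. -/
def Cq : Type := RatFunc ℂ

noncomputable instance : Field Cq := inferInstanceAs (Field (RatFunc ℂ))

/-- The field `ℂ(q, z)`, realised as `ℂ(q)(z)`. -/
def Cqz : Type := RatFunc Cq

noncomputable instance : Field Cqz := inferInstanceAs (Field (RatFunc Cq))

noncomputable instance : Algebra Cq Cqz := (RatFunc.C : Cq →+* RatFunc Cq).toAlgebra

/-- The indeterminate `q` in `ℂ(q)`. -/
noncomputable def qc : Cq := (RatFunc.X : RatFunc ℂ)

/-- The indeterminate `q` in `ℂ(q, z)`. -/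
noncomputable def qz : Cqz := algebraMap Cq Cqz qc

/-- The indeterminate `z`, as a unit of `ℂ(q, z)`. -/
noncomputable def zz : Cqzˣ :=
  Units.mk0 (RatFunc.X : RatFunc Cq) (RatFunc.X_ne_zero : (RatFunc.X : RatFunc Cq) ≠ 0)

/-- `[u] = (q^u - q^{-u}) / (q - q^{-1})`. -/
noncomputable def qInt {F : Type*} [Field F] (q : F) (u : ℤ) : F :=
  (q ^ u - q ^ (-u)) / (q - q⁻¹)

/-- The `q`-factorial `[m]! = ∏_{j=1}^m [j]`. -/
noncomputable def qFact {F : Type*} [Field F] (q : F) (m : ℕ) : F :=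
  ∏ j ∈ Finset.range m, qInt q (j + 1)

/-- `(a; p)_m = ∏_{k=1}^m (1 - a p^{k-1})`. -/
noncomputable def qPoch {F : Type*} [Field F] (a p : F) (m : ℕ) : F :=
  ∏ k ∈ Finset.range m, (1 - a * p ^ k)

/-! The quantum affine algebra `U_q(A^{(1)}_{n-1})` by generators and relations. -/

/-- Names of the generators `e_i, f_i, k_i, k_i^{-1}`, `i ∈ ℤ_n`. -/
inductive UqGen (n : ℕ) : Type
  | e (i : ZMod n)
  | f (i : ZMod n)
  | k (i : ZMod n)
  | kinv (i : ZMod n)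

/-- The Cartan matrix `a_{ij} = 2δ_{i,j} - δ_{i,j+1} - δ_{i,j-1}`, indices in `ℤ_n`. -/
def cartan {n : ℕ} (i j : ZMod n) : ℤ :=
  2 * (if i = j then 1 else 0) - (if i = j + 1 then 1 else 0) - (if i = j - 1 then 1 else 0)

/-- The free generator with the given name. -/
noncomputable def freeGen {n : ℕ} (g : UqGen n) : FreeAlgebra Cq (UqGen n) := FreeAlgebra.ι Cq g

/-- The divided power `a^{(ν)} = a^ν / [ν]!`. -/
noncomputable def divPow {n : ℕ} (a : FreeAlgebra Cq (UqGen n)) (ν : ℕ) :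
    FreeAlgebra Cq (UqGen n) := (qFact qc ν)⁻¹ • a ^ ν

/-- The `q`-Serre expression `∑_{ν=0}^{m} (-1)^ν a^{(m-ν)} b a^{(ν)}`. -/
noncomputable def serre {n : ℕ} (m : ℕ) (a b : FreeAlgebra Cq (UqGen n)) :
    FreeAlgebra Cq (UqGen n) :=
  ∑ ν ∈ Finset.range (m + 1), (-1 : Cq) ^ ν • (divPow a (m - ν) * b * divPow a ν)

/-- The defining relations of the Drinfeld-Jimbo algebra. -/
inductive UqRel (n : ℕ) : FreeAlgebra Cq (UqGen n) → FreeAlgebra Cq (UqGen n) → Prop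
  | k_kinv (i : ZMod n) : UqRel n (freeGen (.k i) * freeGen (.kinv i)) 1
  | kinv_k (i : ZMod n) : UqRel n (freeGen (.kinv i) * freeGen (.k i)) 1
  | k_k (i j : ZMod n) :
      UqRel n (freeGen (.k i) * freeGen (.k j)) (freeGen (.k j) * freeGen (.k i))
  | k_e (i j : ZMod n) :
      UqRel n (freeGen (.k i) * freeGen (.e j) * freeGen (.kinv i))
        (qc ^ cartan i j • freeGen (.e j))
  | k_f (i j : ZMod n) :
      UqRel n (freeGen (.k i) * freeGen (.f j) * freeGen (.kinv i))
        (qc ^ (-cartan i j) • freeGen (.f j))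
  | e_f (i j : ZMod n) :
      UqRel n (freeGen (.e i) * freeGen (.f j) - freeGen (.f j) * freeGen (.e i))
        (if i = j then (qc - qc⁻¹)⁻¹ • (freeGen (.k i) - freeGen (.kinv i)) else 0)
  | serre_e (i j : ZMod n) (h : i ≠ j) :
      UqRel n (serre (1 - cartan i j).toNat (freeGen (.e i)) (freeGen (.e j))) 0
  | serre_f (i j : ZMod n) (h : i ≠ j) :
      UqRel n (serre (1 - cartan i j).toNat (freeGen (.f i)) (freeGen (.f j))) 0

/-- `U_q = U_q(A^{(1)}_{n-1})` over `ℂ(q)`. -/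
abbrev Uq (n : ℕ) : Type := RingQuot (UqRel n)

/-- The generators of `U_q`. -/
noncomputable def Uq.gen {n : ℕ} (g : UqGen n) : Uq n :=
  RingQuot.mkAlgHom Cq (UqRel n) (freeGen g)

/-- `b_i = -e_i + q² k_i f_i + q/(1-q) k_i`. -/
noncomputable def Uq.b {n : ℕ} (i : ZMod n) : Uq n :=
  -Uq.gen (.e i) + qc ^ 2 • (Uq.gen (.k i) * Uq.gen (.f i)) + (qc / (1 - qc)) • Uq.gen (.k i)

/-- The coideal subalgebra `B_q` generated by the `b_i`. -/
noncomputable def coidealBq (n : ℕ) : Subalgebra Cq (Uq n) :=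
  Algebra.adjoin Cq (Set.range Uq.b)

/-! The modules `V_{l,x}` and `V*_{l,x}`. -/

/-- Integer arrays indexed by `ℤ_n`; the `n`-th component is the one at `0`. -/
abbrev Arr (n : ℕ) : Type := ZMod n → ℤ

/-- The unit array `𝐞_j`. -/
def unitArr {n : ℕ} (j : ZMod n) : Arr n := Pi.single j 1

/-- Membership in `B_l`: nonnegative entries with sum `l`. -/
def InB {n : ℕ} [NeZero n] (l : ℕ) (α : Arr n) : Prop := (∀ i, 0 ≤ α i) ∧ ∑ i, α i = l

/-- The set `B_l`. -/
abbrev BSet (n : ℕ) [NeZero n] (l : ℕ) : Type := {α : Arr n // InB l α}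

/-- The array `l 𝐞_1 ∈ B_l`. -/
def lOne (n : ℕ) [NeZero n] (l : ℕ) : BSet n l :=
  ⟨Pi.single 1 (l : ℤ), by
    constructor
    · intro i
      rw [Pi.single_apply]
      split_ifs <;> simp
    · simp⟩

/-- The space `⨁_{α ∈ B_l} ℂ(q,z) v_α`. -/
abbrev VSpace (n : ℕ) [NeZero n] (l : ℕ) : Type := BSet n l →₀ Cqz

/-- The space `⨁_{α ∈ B_l} ℂ(q,z) v*_α`. -/
abbrev VDual (n : ℕ) [NeZero n] (l : ℕ) : Type := BSet n l →₀ Cqz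

open Classical in
/-- The basis vector attached to `β` (`v_β` in `VSpace`, `v*_β` in `VDual`), read as `0` when
`β ∉ B_l`. -/
noncomputable def bvec {n : ℕ} [NeZero n] (l : ℕ) (β : Arr n) : BSet n l →₀ Cqz :=
  if h : InB l β then Finsupp.single ⟨β, h⟩ 1 else 0

/-- The factor `x^{δ_{j,0}}`. -/
noncomputable def spec {n : ℕ} (x : Cqzˣ) (j : ZMod n) : Cqz := if j = 0 then (x : Cqz) else 1

/-- The action of the generators on `V_{l,x}`. -/
noncomputable def actV {n : ℕ} [NeZero n] (l : ℕ) (x : Cqzˣ) :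
    UqGen n → Module.End Cqz (VSpace n l)
  | .e j => Finsupp.linearCombination Cqz fun α : BSet n l =>
      (spec x j * qInt qz (α.1 (j + 1))) • bvec l (α.1 + unitArr j - unitArr (j + 1))
  | .f j => Finsupp.linearCombination Cqz fun α : BSet n l =>
      ((spec x j)⁻¹ * qInt qz (α.1 j)) • bvec l (α.1 - unitArr j + unitArr (j + 1))
  | .k j => Finsupp.linearCombination Cqz fun α : BSet n l =>
      qz ^ (α.1 j - α.1 (j + 1)) • bvec l α.1
  | .kinv j => Finsupp.linearCombination Cqz fun α : BSet n l =>
      qz ^ (-(α.1 j - α.1 (j + 1))) • bvec l α.1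

/-- The action of the generators on `V*_{l,x}`. -/
noncomputable def actVDual {n : ℕ} [NeZero n] (l : ℕ) (x : Cqzˣ) :
    UqGen n → Module.End Cqz (VDual n l)
  | .e j => Finsupp.linearCombination Cqz fun α : BSet n l =>
      (-(spec x j) * qInt qz (α.1 (j + 1) + 1) * qz ^ (-α.1 j + α.1 (j + 1) + 2)) •
        bvec l (α.1 - unitArr j + unitArr (j + 1))
  | .f j => Finsupp.linearCombination Cqz fun α : BSet n l =>
      (-(spec x j)⁻¹ * qInt qz (α.1 j + 1) * qz ^ (α.1 j - α.1 (j + 1))) •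
        bvec l (α.1 + unitArr j - unitArr (j + 1))
  | .k j => Finsupp.linearCombination Cqz fun α : BSet n l =>
      qz ^ (-α.1 j + α.1 (j + 1)) • bvec l α.1
  | .kinv j => Finsupp.linearCombination Cqz fun α : BSet n l =>
      qz ^ (-(-α.1 j + α.1 (j + 1))) • bvec l α.1

/-! Verification of the defining relations. Both actions are compared with operators on the space
spanned by all integer arrays, of which `V_{l,x}` is a subspace and `V*_{l,x}` a quotient. -/

lemma qc_ne_zero : qc ≠ 0 := (RatFunc.X_ne_zero : (RatFunc.X : RatFunc ℂ) ≠ 0)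

/-- `q` is not a root of unity. -/
lemma qc_pow_ne_one {m : ℕ} (hm : 0 < m) : qc ^ m ≠ 1 := by
  intro h
  have h1 : (RatFunc.X : RatFunc ℂ) ^ m = 1 := h
  have h2 : algebraMap (Polynomial ℂ) (RatFunc ℂ) (Polynomial.X ^ m) =
      algebraMap (Polynomial ℂ) (RatFunc ℂ) 1 := by
    rw [map_pow, RatFunc.algebraMap_X, map_one, h1]
  have h3 := congrArg Polynomial.natDegree (RatFunc.algebraMap_injective ℂ h2)
  simp at h3
  omega

lemma qz_ne_zero : qz ≠ 0 := by
  simpa [qz] using qc_ne_zero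

lemma qz_pow_ne_one {m : ℕ} (hm : 0 < m) : qz ^ m ≠ 1 := by
  rw [qz, ← map_pow]
  intro h
  exact qc_pow_ne_one hm ((algebraMap Cq Cqz).injective (h.trans (map_one _).symm))

/-- The weighted shift `β ↦ c(β) (β + d)`. -/
noncomputable def wshift {n : ℕ} (c : Arr n → Cqz) (d : Arr n) : Module.End Cqz (Arr n →₀ Cqz) :=
  Finsupp.linearCombination Cqz fun β => Finsupp.single (β + d) (c β)

lemma wshift_single {n : ℕ} (c : Arr n → Cqz) (d β : Arr n) (a : Cqz) :
    wshift c d (Finsupp.single β a) = Finsupp.single (β + d) (a * c β) := by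
  simp [wshift]

/-- Extension of `actV` to all integer arrays. -/
noncomputable def bigV {n : ℕ} (x : Cqzˣ) : UqGen n → Module.End Cqz (Arr n →₀ Cqz)
  | .e j => wshift (fun β => spec x j * qInt qz (β (j + 1))) (unitArr j - unitArr (j + 1))
  | .f j => wshift (fun β => (spec x j)⁻¹ * qInt qz (β j)) (-unitArr j + unitArr (j + 1))
  | .k j => wshift (fun β => qz ^ (β j - β (j + 1))) 0
  | .kinv j => wshift (fun β => qz ^ (-(β j - β (j + 1)))) 0

/-- Extension of `actVDual` to all integer arrays. -/
noncomputable def bigVDual {n : ℕ} (x : Cqzˣ) : UqGen n → Module.End Cqz (Arr n →₀ Cqz)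
  | .e j => wshift (fun β => -(spec x j) * qInt qz (β (j + 1) + 1) *
      qz ^ (-β j + β (j + 1) + 2)) (-unitArr j + unitArr (j + 1))
  | .f j => wshift (fun β => -(spec x j)⁻¹ * qInt qz (β j + 1) * qz ^ (β j - β (j + 1)))
      (unitArr j - unitArr (j + 1))
  | .k j => wshift (fun β => qz ^ (-β j + β (j + 1))) 0
  | .kinv j => wshift (fun β => qz ^ (-(-β j + β (j + 1)))) 0

lemma wshift_pow {n : ℕ} (c : Arr n → Cqz) (d β : Arr n) (a : Cqz) (ν : ℕ) :
    (wshift c d ^ ν) (Finsupp.single β a) =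
      Finsupp.single (β + ν • d) (a * ∏ k ∈ Finset.range ν, c (β + k • d)) := by
  induction ν with
  | zero => simp
  | succ ν ih =>
    rw [pow_succ', Module.End.mul_apply, ih, wshift_single, Finset.prod_range_succ, add_assoc,
      ← succ_nsmul, mul_assoc]

lemma csmul_single {n : ℕ} (c : Cq) (β : Arr n) (a : Cqz) :
    c • Finsupp.single β a = Finsupp.single β (algebraMap Cq Cqz c * a) := by
  simp [Algebra.smul_def]

/-- The scalar by which a `q`-Serre expression of weighted shifts acts. -/
noncomputable def serreScalar {n : ℕ} (m : ℕ) (c c' : Arr n → Cqz) (d d' β : Arr n) : Cqz :=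
  ∑ ν ∈ Finset.range (m + 1), (-1 : Cqz) ^ ν *
    ((qFact qz (m - ν))⁻¹ * (qFact qz ν)⁻¹ * ((∏ k ∈ Finset.range ν, c (β + k • d)) *
      c' (β + ν • d) * ∏ k ∈ Finset.range (m - ν), c (β + ν • d + d' + k • d)))

lemma map_qInt (u : ℤ) : algebraMap Cq Cqz (qInt qc u) = qInt qz u := by
  simp [qInt, qz]

lemma map_qFact (m : ℕ) : algebraMap Cq Cqz (qFact qc m) = qFact qz m := by
  simp [qFact, map_qInt]

lemma lift_serre {n : ℕ} (act : UqGen n → Module.End Cqz (Arr n →₀ Cqz)) (m : ℕ) (g g' : UqGen n)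
    (c c' : Arr n → Cqz) (d d' : Arr n) (hg : act g = wshift c d) (hg' : act g' = wshift c' d')
    (h : ∀ β, serreScalar m c c' d d' β = 0) :
    FreeAlgebra.lift Cq act (serre m (freeGen g) (freeGen g')) = 0 := by
  refine Finsupp.lhom_ext fun β a => ?_
  have key : FreeAlgebra.lift Cq act (serre m (freeGen g) (freeGen g')) (Finsupp.single β a) =
      Finsupp.single (β + m • d + d') (a * serreScalar m c c' d d' β) := by
    rw [serre, map_sum, LinearMap.sum_apply, serreScalar, Finset.mul_sum,
      Finsupp.single_finsetSum]
    refine Finset.sum_congr rfl fun ν hν => ?_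
    have hν' : ν ≤ m := by simpa [Nat.lt_succ_iff] using hν
    simp only [divPow, freeGen, map_smul, map_mul, map_pow, FreeAlgebra.lift_ι_apply, hg, hg',
      LinearMap.smul_apply, Module.End.mul_apply, wshift_pow, csmul_single, wshift_single]
    congr 1
    · have : m • d = (m - ν) • d + ν • d := by rw [← add_nsmul, Nat.sub_add_cancel hν']
      rw [this]; abel
    · simp only [map_neg, map_one, map_inv₀, map_qFact]
      ring
  rw [key, h]
  simp

lemma qz_sq_sub : qz ^ 2 - 1 ≠ 0 := sub_ne_zero.2 (qz_pow_ne_one (by norm_num))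

lemma qz_sq_add : qz ^ 2 + 1 ≠ 0 := by
  intro h
  apply qz_pow_ne_one (m := 4) (by norm_num)
  linear_combination (qz ^ 2 - 1) * h

lemma qz_four_add : qz ^ 4 + qz ^ 2 + 1 ≠ 0 := by
  intro h
  apply qz_pow_ne_one (m := 6) (by norm_num)
  linear_combination (qz ^ 2 - 1) * h

lemma qz_sub_inv : qz - qz⁻¹ ≠ 0 := by
  intro h
  apply qz_sq_sub
  have h0 := qz_ne_zero
  have h1 : qz * (qz - qz⁻¹) = qz ^ 2 - 1 := by field_simp
  rw [← h1, h, mul_zero]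

lemma qInt_one : qInt qz 1 = 1 := by
  simp [qInt, div_self qz_sub_inv]

lemma qInt_two : qInt qz 2 = (qz ^ 2 + 1) / qz := by
  have := qz_ne_zero
  have h := qz_sub_inv
  rw [qInt, div_eq_div_iff h this, zpow_neg]
  norm_cast
  field_simp
  ring

lemma qInt_three : qInt qz 3 = (qz ^ 4 + qz ^ 2 + 1) / qz ^ 2 := by
  have := qz_ne_zero
  have h := qz_sub_inv
  rw [qInt, div_eq_div_iff h (pow_ne_zero 2 this), zpow_neg]
  norm_cast
  field_simp
  ring

lemma qFact_zero : qFact qz 0 = 1 := by simp [qFact]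
lemma qFact_one : qFact qz 1 = 1 := by simp [qFact, qInt_one]
lemma qFact_two : qFact qz 2 = (qz ^ 2 + 1) / qz := by
  norm_num [qFact, Finset.prod_range_succ, qInt_one, qInt_two]
lemma qFact_three : qFact qz 3 = (qz ^ 2 + 1) / qz * ((qz ^ 4 + qz ^ 2 + 1) / qz ^ 2) := by
  norm_num [qFact, Finset.prod_range_succ, qInt_one, qInt_two, qInt_three]

/-- The scalar identity behind the `q`-Serre relations. -/
lemma serre_scalar_aux (P R : ℕ) (hP : P ≤ 1) (hR : R ≤ 1) (u v : ℤ) :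
    ∑ ν ∈ Finset.range (1 + P + R + 1), (-1 : Cqz) ^ ν *
      ((qFact qz (1 + P + R - ν))⁻¹ * (qFact qz ν)⁻¹ *
        ((∏ k ∈ Finset.range ν, qInt qz (u - k)) * qInt qz (v + R * ν) *
          ∏ k ∈ Finset.range (1 + P + R - ν), qInt qz (u - ν + P - k))) = 0 := by
  have h0 := qz_ne_zero
  have h1 := qz_sq_add
  obtain ⟨T, hT⟩ : ∃ T, T = qz ^ 4 + qz ^ 2 + 1 := ⟨_, rfl⟩
  have h2 : T ≠ 0 := hT ▸ qz_four_add
  have hI : ∀ w : ℤ, qInt qz w = (qz ^ w - (qz ^ w)⁻¹) * (qz - qz⁻¹)⁻¹ := fun w => by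
    rw [qInt, zpow_neg, div_eq_mul_inv]
  have h3 : (-1 : Cqz) ^ 3 = -1 := by norm_num
  have hu : qz ^ u ≠ 0 := zpow_ne_zero _ h0
  have hv : qz ^ v ≠ 0 := zpow_ne_zero _ h0
  interval_cases P <;> interval_cases R <;>
    simp [Finset.sum_range_succ, Finset.prod_range_succ, qFact_zero, qFact_one, qFact_two,
      qFact_three, hI, h3, zpow_add₀ h0, zpow_sub₀ h0] <;>
    generalize (qz - qz⁻¹)⁻¹ = s <;> generalize qz ^ u = U at * <;>
    generalize qz ^ v = V at * <;> generalize qz = q at * <;> norm_cast <;>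
    (try simp only [← hT]) <;> field_simp <;> (try rw [hT]) <;> ring
lemma spec_ne_zero {n : ℕ} (x : Cqzˣ) (j : ZMod n) : spec x j ≠ 0 := by
  unfold spec
  split_ifs <;> simp

/-- `a_{ij} = -(δ_{j,i+1} + δ_{i,j+1})` for `i ≠ j`. -/
lemma cartan_toNat {n : ℕ} {i j : ZMod n} (h : i ≠ j) : (1 - cartan i j).toNat =
    1 + (if j = i + 1 then 1 else 0) + (if i = j + 1 then 1 else 0) := by
  have h' : (i = j - 1) = (j = i + 1) := by
    rw [eq_sub_iff_add_eq]; exact propext eq_comm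
  simp only [cartan, h, h', if_false]
  split_ifs <;> rfl

section Rank

variable {n : ℕ} [Fact (1 < n)]

lemma serreScalar_e (x : Cqzˣ) {i j : ZMod n} (h : i ≠ j) (β : Arr n) :
    serreScalar (1 - cartan i j).toNat (fun β => spec x i * qInt qz (β (i + 1)))
      (fun β => spec x j * qInt qz (β (j + 1))) (unitArr i - unitArr (i + 1))
      (unitArr j - unitArr (j + 1)) β = 0 := by
  rw [cartan_toNat h]
  have key := serre_scalar_aux (if j = i + 1 then 1 else 0) (if i = j + 1 then 1 else 0)
    (by split_ifs <;> simp) (by split_ifs <;> simp) (β (i + 1)) (β (j + 1))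
  have e1 : (unitArr i - unitArr (i + 1) : Arr n) (i + 1) = (-1 : ℤ) := by
    simp [unitArr, Pi.single_apply]
  have e2 : (unitArr i - unitArr (i + 1) : Arr n) (j + 1) = ((if i = j + 1 then 1 else 0 : ℕ) : ℤ) := by
    simp [unitArr, Pi.single_apply, h.symm, @eq_comm _ (j + 1) i]
  have e3 : (unitArr j - unitArr (j + 1) : Arr n) (i + 1) = ((if j = i + 1 then 1 else 0 : ℕ) : ℤ) := by
    simp [unitArr, Pi.single_apply, h, @eq_comm _ j (i + 1)]
  generalize (unitArr i - unitArr (i + 1) : Arr n) = d at *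
  generalize (unitArr j - unitArr (j + 1) : Arr n) = d' at *
  generalize (if j = i + 1 then 1 else 0 : ℕ) = P at *
  generalize (if i = j + 1 then 1 else 0 : ℕ) = R at *
  rw [serreScalar]
  simp only [Pi.add_apply, Pi.smul_apply, e1, e2, e3]
  trans spec x i ^ (1 + P + R) * spec x j * 0
  · rw [← key, Finset.mul_sum]
    refine Finset.sum_congr rfl fun ν hν => ?_
    have hν' : ν ≤ 1 + P + R := by simpa [Nat.lt_succ_iff] using hν
    simp only [Finset.prod_mul_distrib, Finset.prod_const, Finset.card_range]
    rw [← Nat.sub_add_cancel hν', pow_add, Nat.add_sub_cancel]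
    simp only [nsmul_eq_mul, mul_neg, mul_one, ← sub_eq_add_neg, mul_comm (ν : ℤ)]
    ring_nf
  · simp

lemma serreScalar_f (x : Cqzˣ) {i j : ZMod n} (h : i ≠ j) (β : Arr n) :
    serreScalar (1 - cartan i j).toNat (fun β => (spec x i)⁻¹ * qInt qz (β i))
      (fun β => (spec x j)⁻¹ * qInt qz (β j)) (-unitArr i + unitArr (i + 1))
      (-unitArr j + unitArr (j + 1)) β = 0 := by
  rw [cartan_toNat h]
  have key := serre_scalar_aux (if i = j + 1 then 1 else 0) (if j = i + 1 then 1 else 0)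
    (by split_ifs <;> simp) (by split_ifs <;> simp) (β i) (β j)
  rw [add_right_comm 1] at key
  have e1 : (-unitArr i + unitArr (i + 1) : Arr n) i = (-1 : ℤ) := by
    simp [unitArr, Pi.single_apply]
  have e2 : (-unitArr i + unitArr (i + 1) : Arr n) j = ((if j = i + 1 then 1 else 0 : ℕ) : ℤ) := by
    simp [unitArr, Pi.single_apply, h.symm]
  have e3 : (-unitArr j + unitArr (j + 1) : Arr n) i = ((if i = j + 1 then 1 else 0 : ℕ) : ℤ) := by
    simp [unitArr, Pi.single_apply, h]
  generalize (-unitArr i + unitArr (i + 1) : Arr n) = d at *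
  generalize (-unitArr j + unitArr (j + 1) : Arr n) = d' at *
  generalize (if j = i + 1 then 1 else 0 : ℕ) = R at *
  generalize (if i = j + 1 then 1 else 0 : ℕ) = P at *
  rw [serreScalar]
  simp only [Pi.add_apply, Pi.smul_apply, e1, e2, e3]
  trans (spec x i)⁻¹ ^ (1 + R + P) * (spec x j)⁻¹ * 0
  · rw [← key, Finset.mul_sum]
    refine Finset.sum_congr rfl fun ν hν => ?_
    have hν' : ν ≤ 1 + R + P := by simpa [Nat.lt_succ_iff] using hν
    simp only [Finset.prod_mul_distrib, Finset.prod_const, Finset.card_range]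
    rw [← Nat.sub_add_cancel hν', pow_add, Nat.add_sub_cancel]
    simp only [nsmul_eq_mul, mul_neg, mul_one, ← sub_eq_add_neg, mul_comm (ν : ℤ)]
    ring_nf
  · simp

lemma bigV_rel (x : Cqzˣ) {a b : FreeAlgebra Cq (UqGen n)} (h : UqRel n a b) :
    FreeAlgebra.lift Cq (bigV x) a = FreeAlgebra.lift Cq (bigV x) b := by
  have h0 := qz_ne_zero
  have hp : ∀ w : ℤ, qz ^ w ≠ 0 := fun w => zpow_ne_zero _ h0
  cases h with
  | serre_e i j h =>
    rw [map_zero]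
    exact lift_serre _ _ _ _ _ _ _ _ rfl rfl (serreScalar_e x h)
  | serre_f i j h =>
    rw [map_zero]
    exact lift_serre _ _ _ _ _ _ _ _ rfl rfl (serreScalar_f x h)
  | k_kinv i =>
    refine Finsupp.lhom_ext fun β a => ?_
    simp only [freeGen, map_mul, map_one, FreeAlgebra.lift_ι_apply, Module.End.mul_apply, bigV,
      wshift_single, Module.End.one_apply, add_zero]
    rw [mul_assoc, ← zpow_add₀ h0]
    simp
  | kinv_k i =>
    refine Finsupp.lhom_ext fun β a => ?_
    simp only [freeGen, map_mul, map_one, FreeAlgebra.lift_ι_apply, Module.End.mul_apply, bigV,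
      wshift_single, Module.End.one_apply, add_zero]
    rw [mul_assoc, ← zpow_add₀ h0]
    simp
  | k_k i j =>
    refine Finsupp.lhom_ext fun β a => ?_
    simp only [freeGen, map_mul, FreeAlgebra.lift_ι_apply, Module.End.mul_apply, bigV,
      wshift_single, add_zero]
    rw [mul_right_comm]
  | k_e i j =>
    refine Finsupp.lhom_ext fun β a => ?_
    simp only [freeGen, map_mul, map_smul, FreeAlgebra.lift_ι_apply, Module.End.mul_apply, bigV,
      wshift_single, add_zero, LinearMap.smul_apply, csmul_single, map_zpow₀]
    congr 1
    have e : (β + (unitArr j - unitArr (j + 1)) : Arr n) i - (β + (unitArr j - unitArr (j + 1)) : Arr n) (i + 1) =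
        cartan i j + (β i - β (i + 1)) := by
      simp [unitArr, Pi.single_apply, cartan, eq_sub_iff_add_eq]
      split_ifs <;> ring
    rw [e, zpow_add₀ h0, zpow_neg, show algebraMap Cq Cqz qc = qz from rfl]
    have := hp (β i - β (i + 1))
    field_simp
  | k_f i j =>
    refine Finsupp.lhom_ext fun β a => ?_
    simp only [freeGen, map_mul, map_smul, FreeAlgebra.lift_ι_apply, Module.End.mul_apply, bigV,
      wshift_single, add_zero, LinearMap.smul_apply, csmul_single, map_zpow₀]
    congr 1
    have e : (β + (-unitArr j + unitArr (j + 1)) : Arr n) i -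
        (β + (-unitArr j + unitArr (j + 1)) : Arr n) (i + 1) = -cartan i j + (β i - β (i + 1)) := by
      simp [unitArr, Pi.single_apply, cartan, eq_sub_iff_add_eq]
      split_ifs <;> ring
    rw [e, zpow_add₀ h0, zpow_neg (n := β i - _), show algebraMap Cq Cqz qc = qz from rfl]
    have := hp (β i - β (i + 1))
    field_simp
  | e_f i j =>
    refine Finsupp.lhom_ext fun β a => ?_
    have hs := spec_ne_zero x i
    have p1 : β + (-unitArr j + unitArr (j + 1)) + (unitArr i - unitArr (i + 1)) =
        β + (unitArr i - unitArr (i + 1)) + (-unitArr j + unitArr (j + 1)) := by abel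
    split_ifs with hij
    · subst hij
      have p2 : β + (unitArr i - unitArr (i + 1)) + (-unitArr i + unitArr (i + 1)) = β := by abel
      simp only [freeGen, map_mul, map_sub, map_smul, FreeAlgebra.lift_ι_apply,
        Module.End.mul_apply, bigV, wshift_single, add_zero, LinearMap.smul_apply,
        LinearMap.sub_apply, csmul_single, map_inv₀, p1, p2, smul_sub, ← Finsupp.single_sub]
      congr 1
      have hu := hp (β i)
      have hv := hp (β (i + 1))
      have hd := qz_sub_inv
      have hd2 := qz_sq_sub
      simp [unitArr, qInt, zpow_add₀ h0, zpow_sub₀ h0, show algebraMap Cq Cqz qc = qz from rfl]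
      generalize qz ^ β i = U at *
      generalize qz ^ β (i + 1) = V at *
      field_simp
      ring
    · have hji : ¬ j = i := fun h => hij h.symm
      simp only [freeGen, map_mul, map_sub, map_zero, FreeAlgebra.lift_ι_apply,
        Module.End.mul_apply, bigV, wshift_single, LinearMap.sub_apply, LinearMap.zero_apply, p1,
        ← Finsupp.single_sub]
      rw [Finsupp.single_eq_zero]
      by_cases h : j = i + 1
      · subst h
        simp [unitArr, Pi.single_apply, hij, hji]
        ring
      · have h' : ¬ i + 1 = j := fun e => h e.symm
        simp [unitArr, Pi.single_apply, hij, hji, h, h']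
        ring

end Rank

lemma serre_scalar_aux' (P R : ℕ) (hP : P ≤ 1) (hR : R ≤ 1) (u v w w' : ℤ) :
    ∑ ν ∈ Finset.range (1 + P + R + 1), (-1 : Cqz) ^ ν *
      ((qFact qz (1 + P + R - ν))⁻¹ * (qFact qz ν)⁻¹ *
        ((∏ k ∈ Finset.range ν, (qz ^ (w + 2 * k) * qInt qz (u + k))) *
          (qz ^ (w' - (P + R) * ν) * qInt qz (v - R * ν)) *
          ∏ k ∈ Finset.range (1 + P + R - ν),
            (qz ^ (w + 2 * ν - (P + R) + 2 * k) * qInt qz (u + ν - P + k)))) = 0 := by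
  have h0 := qz_ne_zero
  have h1 := qz_sq_add
  obtain ⟨T, hT⟩ : ∃ T, T = qz ^ 4 + qz ^ 2 + 1 := ⟨_, rfl⟩
  have h2 : T ≠ 0 := hT ▸ qz_four_add
  have hI : ∀ w : ℤ, qInt qz w = (qz ^ w - (qz ^ w)⁻¹) * (qz - qz⁻¹)⁻¹ := fun w => by
    rw [qInt, zpow_neg, div_eq_mul_inv]
  have h3 : (-1 : Cqz) ^ 3 = -1 := by norm_num
  have hu : qz ^ u ≠ 0 := zpow_ne_zero _ h0
  have hv : qz ^ v ≠ 0 := zpow_ne_zero _ h0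
  interval_cases P <;> interval_cases R <;>
    norm_num [Finset.sum_range_succ, Finset.prod_range_succ, qFact_zero, qFact_one, qFact_two,
      qFact_three, hI, h3, zpow_add₀ h0, zpow_sub₀ h0] <;>
    generalize (qz - qz⁻¹)⁻¹ = s <;> generalize qz ^ u = U at * <;>
    generalize qz ^ v = V at * <;> generalize qz ^ w = W <;> generalize qz ^ w' = W' <;>
    generalize qz = q at * <;> norm_cast <;>
    (try simp only [← hT]) <;> field_simp <;> (try rw [hT]) <;> ring

lemma serreScalar_dual {n : ℕ} (c c' : Arr n → Cqz) (d d' β : Arr n) (A B : Cqz)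
    (u v w w' : ℤ) (P R : ℕ) (hP : P ≤ 1) (hR : R ≤ 1)
    (hc : ∀ k : ℕ, c (β + k • d) = A * (qz ^ (w + 2 * k) * qInt qz (u + k)))
    (hc' : ∀ ν : ℕ, c' (β + ν • d) = B * (qz ^ (w' - (P + R) * ν) * qInt qz (v - R * ν)))
    (hcc : ∀ ν k : ℕ, c (β + ν • d + d' + k • d) =
      A * (qz ^ (w + 2 * ν - (P + R) + 2 * k) * qInt qz (u + ν - P + k))) :
    serreScalar (1 + P + R) c c' d d' β = 0 := by
  rw [serreScalar]
  simp only [hc, hc', hcc]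
  trans A ^ (1 + P + R) * B * 0
  · rw [← serre_scalar_aux' P R hP hR u v w w', Finset.mul_sum]
    refine Finset.sum_congr rfl fun ν hν => ?_
    have hν' : ν ≤ 1 + P + R := by simpa [Nat.lt_succ_iff] using hν
    rw [Finset.prod_mul_distrib, Finset.prod_mul_distrib (f := fun _ => A), Finset.prod_const,
      Finset.prod_const, Finset.card_range, Finset.card_range]
    generalize (∏ k ∈ Finset.range ν, (qz ^ (w + 2 * k) * qInt qz (u + k))) = X
    generalize (∏ k ∈ Finset.range (1 + P + R - ν),
            (qz ^ (w + 2 * ν - (P + R) + 2 * k) * qInt qz (u + ν - P + k))) = Y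
    have : A ^ (1 + P + R) = A ^ (1 + P + R - ν) * A ^ ν := by
      rw [← pow_add, Nat.sub_add_cancel hν']
    rw [this]
    ring
  · simp

section Rank

variable {n : ℕ} [Fact (1 < n)]

lemma serreScalar_e_dual (x : Cqzˣ) {i j : ZMod n} (h : i ≠ j) (β : Arr n) :
    serreScalar (1 - cartan i j).toNat
      (fun β => -(spec x i) * qInt qz (β (i + 1) + 1) * qz ^ (-β i + β (i + 1) + 2))
      (fun β => -(spec x j) * qInt qz (β (j + 1) + 1) * qz ^ (-β j + β (j + 1) + 2))
      (-unitArr i + unitArr (i + 1)) (-unitArr j + unitArr (j + 1)) β = 0 := by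
  rw [cartan_toNat h]
  have e1 : (-unitArr i + unitArr (i + 1) : Arr n) i = -1 := by
    simp [unitArr, Pi.single_apply]
  have e2 : (-unitArr i + unitArr (i + 1) : Arr n) (i + 1) = 1 := by
    simp [unitArr, Pi.single_apply]
  have e3 : (-unitArr i + unitArr (i + 1) : Arr n) j = ((if j = i + 1 then 1 else 0 : ℕ) : ℤ) := by
    simp [unitArr, Pi.single_apply, h.symm]
  have e4 : (-unitArr i + unitArr (i + 1) : Arr n) (j + 1) =
      -((if i = j + 1 then 1 else 0 : ℕ) : ℤ) := by
    simp [unitArr, Pi.single_apply, h.symm, @eq_comm _ (j + 1) i]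
  have e5 : (-unitArr j + unitArr (j + 1) : Arr n) i = ((if i = j + 1 then 1 else 0 : ℕ) : ℤ) := by
    simp [unitArr, Pi.single_apply, h]
  have e6 : (-unitArr j + unitArr (j + 1) : Arr n) (i + 1) =
      -((if j = i + 1 then 1 else 0 : ℕ) : ℤ) := by
    simp [unitArr, Pi.single_apply, h, @eq_comm _ j (i + 1)]
  generalize (-unitArr i + unitArr (i + 1) : Arr n) = d at *
  generalize (-unitArr j + unitArr (j + 1) : Arr n) = d' at *
  refine serreScalar_dual _ _ _ _ _ (-(spec x i)) (-(spec x j)) (β (i + 1) + 1) (β (j + 1) + 1)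
    (-β i + β (i + 1) + 2) (-β j + β (j + 1) + 2) _ _ (by split_ifs <;> simp)
    (by split_ifs <;> simp) ?_ ?_ ?_
  all_goals
    intros
    simp only [Pi.add_apply, Pi.smul_apply, e1, e2, e3, e4, e5, e6]
    simp only [nsmul_eq_mul]
    rw [mul_assoc, mul_comm (qInt _ _)]
    congr 3 <;> ring

lemma serreScalar_f_dual (x : Cqzˣ) {i j : ZMod n} (h : i ≠ j) (β : Arr n) :
    serreScalar (1 - cartan i j).toNat
      (fun β => -(spec x i)⁻¹ * qInt qz (β i + 1) * qz ^ (β i - β (i + 1)))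
      (fun β => -(spec x j)⁻¹ * qInt qz (β j + 1) * qz ^ (β j - β (j + 1)))
      (unitArr i - unitArr (i + 1)) (unitArr j - unitArr (j + 1)) β = 0 := by
  rw [cartan_toNat h, add_right_comm]
  have e1 : (unitArr i - unitArr (i + 1) : Arr n) i = 1 := by
    simp [unitArr, Pi.single_apply]
  have e2 : (unitArr i - unitArr (i + 1) : Arr n) (i + 1) = -1 := by
    simp [unitArr, Pi.single_apply]
  have e3 : (unitArr i - unitArr (i + 1) : Arr n) j = -((if j = i + 1 then 1 else 0 : ℕ) : ℤ) := by
    simp [unitArr, Pi.single_apply, h.symm]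
  have e4 : (unitArr i - unitArr (i + 1) : Arr n) (j + 1) =
      ((if i = j + 1 then 1 else 0 : ℕ) : ℤ) := by
    simp [unitArr, Pi.single_apply, h.symm, @eq_comm _ (j + 1) i]
  have e5 : (unitArr j - unitArr (j + 1) : Arr n) i = -((if i = j + 1 then 1 else 0 : ℕ) : ℤ) := by
    simp [unitArr, Pi.single_apply, h]
  have e6 : (unitArr j - unitArr (j + 1) : Arr n) (i + 1) =
      ((if j = i + 1 then 1 else 0 : ℕ) : ℤ) := by
    simp [unitArr, Pi.single_apply, h, @eq_comm _ j (i + 1)]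
  generalize (unitArr i - unitArr (i + 1) : Arr n) = d at *
  generalize (unitArr j - unitArr (j + 1) : Arr n) = d' at *
  refine serreScalar_dual _ _ _ _ _ (-(spec x i)⁻¹) (-(spec x j)⁻¹) (β i + 1) (β j + 1)
    (β i - β (i + 1)) (β j - β (j + 1)) _ _ (by split_ifs <;> simp)
    (by split_ifs <;> simp) ?_ ?_ ?_
  all_goals
    intros
    simp only [Pi.add_apply, Pi.smul_apply, e1, e2, e3, e4, e5, e6]
    simp only [nsmul_eq_mul]
    rw [mul_assoc, mul_comm (qInt _ _)]
    congr 3 <;> ring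

lemma bigVDual_rel (x : Cqzˣ) {a b : FreeAlgebra Cq (UqGen n)} (h : UqRel n a b) :
    FreeAlgebra.lift Cq (bigVDual x) a = FreeAlgebra.lift Cq (bigVDual x) b := by
  have h0 := qz_ne_zero
  have hp : ∀ w : ℤ, qz ^ w ≠ 0 := fun w => zpow_ne_zero _ h0
  cases h with
  | serre_e i j h =>
    rw [map_zero]
    exact lift_serre _ _ _ _ _ _ _ _ rfl rfl (serreScalar_e_dual x h)
  | serre_f i j h =>
    rw [map_zero]
    exact lift_serre _ _ _ _ _ _ _ _ rfl rfl (serreScalar_f_dual x h)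
  | k_kinv i =>
    refine Finsupp.lhom_ext fun β a => ?_
    simp only [freeGen, map_mul, map_one, FreeAlgebra.lift_ι_apply, Module.End.mul_apply, bigVDual,
      wshift_single, Module.End.one_apply, add_zero]
    rw [mul_assoc, ← zpow_add₀ h0, neg_add_cancel, zpow_zero, mul_one]
  | kinv_k i =>
    refine Finsupp.lhom_ext fun β a => ?_
    simp only [freeGen, map_mul, map_one, FreeAlgebra.lift_ι_apply, Module.End.mul_apply, bigVDual,
      wshift_single, Module.End.one_apply, add_zero]
    rw [mul_assoc, ← zpow_add₀ h0, add_neg_cancel, zpow_zero, mul_one]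
  | k_k i j =>
    refine Finsupp.lhom_ext fun β a => ?_
    simp only [freeGen, map_mul, FreeAlgebra.lift_ι_apply, Module.End.mul_apply, bigVDual,
      wshift_single, add_zero]
    rw [mul_right_comm]
  | k_e i j =>
    refine Finsupp.lhom_ext fun β a => ?_
    simp only [freeGen, map_mul, map_smul, FreeAlgebra.lift_ι_apply, Module.End.mul_apply,
      bigVDual, wshift_single, add_zero, LinearMap.smul_apply, csmul_single, map_zpow₀]
    congr 1
    have e : -(β + (-unitArr j + unitArr (j + 1)) : Arr n) i +
        (β + (-unitArr j + unitArr (j + 1)) : Arr n) (i + 1) =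
        cartan i j + (-β i + β (i + 1)) := by
      simp [unitArr, Pi.single_apply, cartan, eq_sub_iff_add_eq]
      split_ifs <;> ring
    rw [e, zpow_add₀ h0 (cartan i j), zpow_neg qz (-β i + β (i + 1)),
      show algebraMap Cq Cqz qc = qz from rfl]
    have := hp (-β i + β (i + 1))
    field_simp
  | k_f i j =>
    refine Finsupp.lhom_ext fun β a => ?_
    simp only [freeGen, map_mul, map_smul, FreeAlgebra.lift_ι_apply, Module.End.mul_apply,
      bigVDual, wshift_single, add_zero, LinearMap.smul_apply, csmul_single, map_zpow₀]
    congr 1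
    have e : -(β + (unitArr j - unitArr (j + 1)) : Arr n) i +
        (β + (unitArr j - unitArr (j + 1)) : Arr n) (i + 1) =
        -cartan i j + (-β i + β (i + 1)) := by
      simp [unitArr, Pi.single_apply, cartan, eq_sub_iff_add_eq]
      split_ifs <;> ring
    rw [e, zpow_add₀ h0 (-cartan i j), zpow_neg qz (-β i + β (i + 1)),
      show algebraMap Cq Cqz qc = qz from rfl]
    have := hp (-β i + β (i + 1))
    field_simp
  | e_f i j =>
    refine Finsupp.lhom_ext fun β a => ?_
    have hs := spec_ne_zero x i
    have p1 : β + (unitArr j - unitArr (j + 1)) + (-unitArr i + unitArr (i + 1)) =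
        β + (-unitArr i + unitArr (i + 1)) + (unitArr j - unitArr (j + 1)) := by abel
    split_ifs with hij
    · subst hij
      have p2 : β + (-unitArr i + unitArr (i + 1)) + (unitArr i - unitArr (i + 1)) = β := by abel
      simp only [freeGen, map_mul, map_sub, map_smul, FreeAlgebra.lift_ι_apply,
        Module.End.mul_apply, bigVDual, wshift_single, add_zero, LinearMap.smul_apply,
        LinearMap.sub_apply, csmul_single, map_inv₀, p1, p2, smul_sub, ← Finsupp.single_sub]
      congr 1
      have hu := hp (β i)
      have hv := hp (β (i + 1))
      have hd := qz_sub_inv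
      have hd2 := qz_sq_sub
      simp [unitArr, qInt, zpow_add₀ h0, zpow_sub₀ h0, show algebraMap Cq Cqz qc = qz from rfl]
      norm_cast
      generalize qz ^ β i = U at *
      generalize qz ^ β (i + 1) = V at *
      field_simp
      ring
    · have hji : ¬ j = i := fun h => hij h.symm
      simp only [freeGen, map_mul, map_sub, map_zero, FreeAlgebra.lift_ι_apply,
        Module.End.mul_apply, bigVDual, wshift_single, LinearMap.sub_apply, LinearMap.zero_apply,
        p1, ← Finsupp.single_sub]
      rw [Finsupp.single_eq_zero]
      have t1 : (unitArr j - unitArr (j + 1) : Arr n) i = -(if i = j + 1 then 1 else 0) := by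
        simp [unitArr, Pi.single_apply, hij]
      have t2 : (unitArr j - unitArr (j + 1) : Arr n) (i + 1) = if j = i + 1 then 1 else 0 := by
        simp [unitArr, Pi.single_apply, hij, @eq_comm _ j (i + 1)]
      have t3 : (-unitArr i + unitArr (i + 1) : Arr n) j = if j = i + 1 then 1 else 0 := by
        simp [unitArr, Pi.single_apply, hji]
      have t4 : (-unitArr i + unitArr (i + 1) : Arr n) (j + 1) = -(if i = j + 1 then 1 else 0) := by
        simp [unitArr, Pi.single_apply, hji, @eq_comm _ (j + 1) i]
      generalize (unitArr j - unitArr (j + 1) : Arr n) = d at *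
      generalize (-unitArr i + unitArr (i + 1) : Arr n) = d' at *
      simp only [Pi.add_apply, t1, t2, t3, t4]
      have E : qInt qz (β j + 1) * qInt qz (β (i + 1) + (if j = i + 1 then 1 else 0) + 1) =
          qInt qz (β (i + 1) + 1) * qInt qz (β j + (if j = i + 1 then 1 else 0) + 1) := by
        by_cases h : j = i + 1
        · subst h
          simp
        · simp [h, mul_comm]
      generalize (if j = i + 1 then 1 else 0 : ℤ) = P at *
      generalize (if i = j + 1 then 1 else 0 : ℤ) = R at *
      have Q : qz ^ (β j - β (j + 1)) * qz ^ (-(β i + -R) + (β (i + 1) + P) + 2) =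
          qz ^ (-β i + β (i + 1) + 2) * qz ^ (β j + P - (β (j + 1) + -R)) := by
        rw [← zpow_add₀ h0, ← zpow_add₀ h0]
        congr 1
        ring
      linear_combination a * spec x i * (spec x j)⁻¹ * (qz ^ (β j - β (j + 1)) *
        qz ^ (-(β i + -R) + (β (i + 1) + P) + 2)) * E + a * spec x i * (spec x j)⁻¹ *
        (qInt qz (β (i + 1) + 1) * qInt qz (β j + P + 1)) * Q

end Rank

/-- Intertwined families of generators generate intertwined actions. -/
lemma lift_intertwine {n : ℕ} {M N : Type*} [AddCommGroup M] [AddCommGroup N] [Module Cqz M]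
    [Module Cqz N] [Module Cq M] [Module Cq N] [IsScalarTower Cq Cqz M] [IsScalarTower Cq Cqz N]
    (act : UqGen n → Module.End Cqz M)
    (act' : UqGen n → Module.End Cqz N) (φ : M →ₗ[Cqz] N)
    (h : ∀ g v, φ (act g v) = act' g (φ v)) (a : FreeAlgebra Cq (UqGen n)) (v : M) :
    φ (FreeAlgebra.lift Cq act a v) = FreeAlgebra.lift Cq act' a (φ v) := by
  induction a using FreeAlgebra.induction generalizing v with
  | grade0 r =>
    simp only [AlgHom.commutes, Module.algebraMap_end_apply]
    rw [← algebraMap_smul Cqz r v, map_smul, algebraMap_smul]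
  | grade1 g => simpa using h g v
  | mul a b ha hb => simp [ha, hb]
  | add a b ha hb => simp [ha, hb]

section Modules

variable {n : ℕ} [NeZero n]

/-- The inclusion of the span of `B_l` into the span of all arrays. -/
noncomputable def inclB (l : ℕ) : (BSet n l →₀ Cqz) →ₗ[Cqz] (Arr n →₀ Cqz) :=
  Finsupp.lmapDomain Cqz Cqz Subtype.val

/-- The projection of the span of all arrays onto the span of `B_l`. -/
noncomputable def projB (l : ℕ) : (Arr n →₀ Cqz) →ₗ[Cqz] (BSet n l →₀ Cqz) :=
  Finsupp.linearCombination Cqz (bvec l)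

lemma sum_shift (α : Arr n) (i j : ZMod n) : ∑ k, (α + unitArr i - unitArr j) k = ∑ k, α k := by
  simp [unitArr, Finset.sum_add_distrib, Finset.sum_sub_distrib]

lemma smul_inclB_bvec (l : ℕ) (c : Cqz) (α : Arr n) (hα : InB l α) (i j : ZMod n) (hij : i ≠ j)
    (h : α j = 0 → c = 0) :
    inclB l (c • bvec l (α + unitArr i - unitArr j)) =
      Finsupp.single (α + unitArr i - unitArr j) c := by
  by_cases hB : InB l (α + unitArr i - unitArr j)
  · simp [inclB, bvec, hB, Finsupp.mapDomain_single]
  · suffices α j = 0 by simp [h this]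
    by_contra hj
    refine hB ⟨fun k => ?_, by rw [sum_shift]; exact hα.2⟩
    have hk := hα.1 k
    by_cases hkj : k = j
    · subst hkj
      simp [unitArr, Pi.single_apply, hij.symm]
      omega
    · simp only [unitArr, Pi.add_apply, Pi.sub_apply, Pi.single_apply, hkj, if_false]
      split_ifs <;> omega

lemma smul_bvec (l : ℕ) (c : Cqz) (β : Arr n) (hβ : ¬ InB l β) (i j : ZMod n) (hij : i ≠ j)
    (h : β i = -1 → c = 0) : c • bvec l (β + unitArr i - unitArr j) = 0 := by
  by_cases hB : InB l (β + unitArr i - unitArr j)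
  · suffices β i = -1 by simp [h this]
    by_contra hi
    refine hβ ⟨fun k => ?_, by rw [← sum_shift β i j]; exact hB.2⟩
    have hk := hB.1 k
    simp only [unitArr, Pi.add_apply, Pi.sub_apply, Pi.single_apply] at hk
    by_cases hki : k = i
    · subst hki
      simp [hij] at hk
      omega
    · simp only [hki, if_false] at hk
      split_ifs at hk <;> omega
  · simp [bvec, hB]

lemma inclB_injective (l : ℕ) : Function.Injective (inclB (n := n) l) :=
  Finsupp.mapDomain_injective Subtype.val_injective

lemma projB_surjective (l : ℕ) : Function.Surjective (projB (n := n) l) := by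
  intro v
  refine ⟨inclB l v, ?_⟩
  induction v using Finsupp.induction_linear with
  | zero => simp
  | add v w hv hw => rw [map_add, map_add, hv, hw]
  | single α a => simp [inclB, projB, Finsupp.mapDomain_single, bvec, α.2]

variable [Fact (1 < n)]

lemma inclB_actV (l : ℕ) (x : Cqzˣ) (g : UqGen n) (v : VSpace n l) :
    inclB l (actV l x g v) = bigV x g (inclB l v) := by
  have key : inclB l ∘ₗ actV l x g = bigV x g ∘ₗ inclB l := by
    refine Finsupp.lhom_ext fun α a => ?_
    have hincl : inclB l (Finsupp.single α a) = Finsupp.single α.1 a := by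
      simp [inclB, Finsupp.mapDomain_single]
    rw [LinearMap.comp_apply, LinearMap.comp_apply, hincl]
    have hb : inclB l (bvec l α.1) = Finsupp.single α.1 1 := by
      simp [bvec, α.2, inclB, Finsupp.mapDomain_single]
    cases g with
    | e j =>
      simp only [actV, bigV, wshift_single, Finsupp.linearCombination_single, map_smul]
      rw [← map_smul, smul_inclB_bvec l _ α.1 α.2 j (j + 1) (by simp)
        (fun h => by simp [h, qInt]), Finsupp.smul_single, smul_eq_mul, add_sub_assoc]
    | f j =>
      simp only [actV, bigV, wshift_single, Finsupp.linearCombination_single, map_smul]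
      rw [sub_add_eq_add_sub, ← map_smul, smul_inclB_bvec l _ α.1 α.2 (j + 1) j (by simp)
        (fun h => by simp [h, qInt]), Finsupp.smul_single, smul_eq_mul, add_sub_assoc,
        neg_add_eq_sub]
    | k j => simp [actV, bigV, wshift_single, hb]
    | kinv j => simp [actV, bigV, wshift_single, hb]
  exact LinearMap.congr_fun key v

lemma projB_actVDual (l : ℕ) (x : Cqzˣ) (g : UqGen n) (v : Arr n →₀ Cqz) :
    projB l (bigVDual x g v) = actVDual l x g (projB l v) := by
  have key : projB l ∘ₗ bigVDual x g = actVDual l x g ∘ₗ projB l := by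
    refine Finsupp.lhom_ext fun β a => ?_
    rw [LinearMap.comp_apply, LinearMap.comp_apply]
    by_cases hβ : InB l β
    · have hb : projB l (Finsupp.single β a) = Finsupp.single ⟨β, hβ⟩ a := by
        simp [projB, bvec, hβ]
      rw [hb]
      cases g <;>
        simp only [actVDual, bigVDual, wshift_single, projB, Finsupp.linearCombination_single,
          add_zero, mul_smul, sub_add_eq_add_sub, add_sub_assoc, neg_add_eq_sub]
    · have hb : projB l (Finsupp.single β a) = 0 := by
        simp [projB, bvec, hβ]
      rw [hb, map_zero]
      cases g with
      | e j =>
        simp only [bigVDual, wshift_single, projB, Finsupp.linearCombination_single, mul_smul a]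
        rw [neg_add_eq_sub (unitArr j), ← add_sub_assoc, smul_bvec l _ β hβ (j + 1) j (by simp)
          (fun h => by simp [h, qInt]), smul_zero]
      | f j =>
        simp only [bigVDual, wshift_single, projB, Finsupp.linearCombination_single, mul_smul a]
        rw [← add_sub_assoc, smul_bvec l _ β hβ j (j + 1) (by simp)
          (fun h => by simp [h, qInt]), smul_zero]
      | k j =>
        simp only [bigVDual, wshift_single, projB, Finsupp.linearCombination_single, add_zero, bvec,
          hβ, dite_false, smul_zero]
      | kinv j =>
        simp only [bigVDual, wshift_single, projB, Finsupp.linearCombination_single, add_zero, bvec,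
          hβ, dite_false, smul_zero]
  exact LinearMap.congr_fun key v

lemma actV_rel (l : ℕ) (x : Cqzˣ) ⦃a b : FreeAlgebra Cq (UqGen n)⦄ (h : UqRel n a b) :
    FreeAlgebra.lift Cq (actV l x) a = FreeAlgebra.lift Cq (actV l x) b := by
  refine LinearMap.ext fun v => inclB_injective l ?_
  rw [lift_intertwine _ _ _ (inclB_actV l x), lift_intertwine _ _ _ (inclB_actV l x),
    bigV_rel x h]

lemma actVDual_rel (l : ℕ) (x : Cqzˣ) ⦃a b : FreeAlgebra Cq (UqGen n)⦄ (h : UqRel n a b) :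
    FreeAlgebra.lift Cq (actVDual l x) a = FreeAlgebra.lift Cq (actVDual l x) b := by
  refine LinearMap.ext fun v => ?_
  obtain ⟨w, rfl⟩ := projB_surjective l v
  rw [← lift_intertwine _ _ _ (projB_actVDual l x), ← lift_intertwine _ _ _ (projB_actVDual l x),
    bigVDual_rel x h]

/-- The representation `π_{l,x} : U_q → End V_{l,x}`. -/
noncomputable def piRep (l : ℕ) (x : Cqzˣ) : Uq n →ₐ[Cq] Module.End Cqz (VSpace n l) :=
  RingQuot.liftAlgHom Cq ⟨FreeAlgebra.lift Cq (actV l x), actV_rel l x⟩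

/-- The representation `π*_{l,x} : U_q → End V*_{l,x}`. -/
noncomputable def piRepDual (l : ℕ) (x : Cqzˣ) : Uq n →ₐ[Cq] Module.End Cqz (VDual n l) :=
  RingQuot.liftAlgHom Cq ⟨FreeAlgebra.lift Cq (actVDual l x), actVDual_rel l x⟩

/-- The matrix element `K^γ_α`, i.e. the coefficient of `v*_γ` in `K v_α`. -/
noncomputable def matElt {l : ℕ} (K : VSpace n l →ₗ[Cqz] VDual n l) (γ α : BSet n l) : Cqz :=
  K (Finsupp.single α 1) γ

/-- `K : V_{l,z} → V*_{l,z^{-1}}` intertwines `B_q`, with `K^{l e_1}_{l e_1} = 1`. -/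
def IsKMatrix {l : ℕ} (K : VSpace n l →ₗ[Cqz] VDual n l) : Prop :=
  (∀ b ∈ coidealBq n, K ∘ₗ piRep l zz b = piRepDual l zz⁻¹ b ∘ₗ K) ∧
    matElt K (lOne n l) (lOne n l) = 1

end Modules

/-! The `q`-boson algebra, its Fock space, and the trace. -/

/-- Names of the generators `𝐚⁺, 𝐚⁻, 𝐤`. -/
inductive BosonGen : Type
  | ap
  | am
  | k

/-- The defining relations of the `q`-boson algebra. -/
inductive BosonRel : FreeAlgebra Cq BosonGen → FreeAlgebra Cq BosonGen → Prop
  | k_ap : BosonRel (FreeAlgebra.ι Cq .k * FreeAlgebra.ι Cq .ap)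
      (qc • (FreeAlgebra.ι Cq .ap * FreeAlgebra.ι Cq .k))
  | k_am : BosonRel (FreeAlgebra.ι Cq .k * FreeAlgebra.ι Cq .am)
      (qc⁻¹ • (FreeAlgebra.ι Cq .am * FreeAlgebra.ι Cq .k))
  | ap_am : BosonRel (FreeAlgebra.ι Cq .ap * FreeAlgebra.ι Cq .am) (1 - FreeAlgebra.ι Cq .k)
  | am_ap : BosonRel (FreeAlgebra.ι Cq .am * FreeAlgebra.ι Cq .ap)
      (1 - qc • FreeAlgebra.ι Cq .k)

/-- The `q`-boson algebra `A_q`. -/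
abbrev QBoson : Type := RingQuot BosonRel

/-- The generators of `A_q`. -/
noncomputable def QBoson.gen (g : BosonGen) : QBoson :=
  RingQuot.mkAlgHom Cq BosonRel (FreeAlgebra.ι Cq g)

/-- The Fock space `F_q = ⨁_{m ≥ 0} ℂ(q) |m⟩`. -/
abbrev Fock : Type := ℕ →₀ Cq

/-- The ket `|m⟩`. -/
noncomputable def ket (m : ℕ) : Fock := Finsupp.single m 1

/-- `𝐚⁺|m⟩ = |m+1⟩`, `𝐚⁻|m⟩ = (1-q^m)|m-1⟩`, `𝐤|m⟩ = q^m|m⟩`; the coefficient of `𝐚⁻|0⟩` is `0`. -/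
noncomputable def fockAct : BosonGen → Module.End Cq Fock
  | .ap => Finsupp.linearCombination Cq fun m => ket (m + 1)
  | .am => Finsupp.linearCombination Cq fun m => (1 - qc ^ m) • ket (m - 1)
  | .k => Finsupp.linearCombination Cq fun m => qc ^ m • ket m

lemma fockAct_rel ⦃a b : FreeAlgebra Cq BosonGen⦄ (h : BosonRel a b) :
    FreeAlgebra.lift Cq fockAct a = FreeAlgebra.lift Cq fockAct b := by
  have h0 := qc_ne_zero
  cases h <;> refine Finsupp.lhom_ext' fun m => LinearMap.ext_ring ?_ <;>
    simp only [map_mul, map_smul, map_sub, map_one, FreeAlgebra.lift_ι_apply, fockAct,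
      LinearMap.comp_apply, Finsupp.lsingle_apply, Module.End.mul_apply, Module.End.one_apply,
      LinearMap.smul_apply, LinearMap.sub_apply, Finsupp.linearCombination_single, one_smul, ket,
      Finsupp.smul_single, smul_eq_mul, mul_one, ← Finsupp.single_sub]
  case k_ap => rw [pow_succ']
  case k_am =>
    rcases m with _ | m
    · simp
    · simp only [Nat.add_sub_cancel]
      congr 1
      field_simp
      ring
  case ap_am =>
    rcases m with _ | m
    · simp
    · simp
  case am_ap =>
    simp only [Nat.add_sub_cancel, pow_succ']

/-- The Fock representation of `A_q`. -/
noncomputable def fockRep : QBoson →ₐ[Cq] Module.End Cq Fock :=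
  RingQuot.liftAlgHom Cq ⟨FreeAlgebra.lift Cq fockAct, fockAct_rel⟩

/-- `⟨m| v`, for the pairing `⟨m|m'⟩ = (q;q)_m δ_{m,m'}`. -/
noncomputable def bra (m : ℕ) (v : Fock) : Cq := qPoch qc qc m * v m

/-- The place `z = ∞` of `ℂ(q)(z)`: `|f| = exp (deg f)` for `f ≠ 0`. -/
noncomputable def absInfty : Cqz → WithZero (Multiplicative ℤ) :=
  open scoped Classical in (RatFunc.inftyValuation Cq : RatFunc Cq → WithZero (Multiplicative ℤ))

/-- `Tr(w^𝐡 X)` converges to `t`: the series `∑_{m ≥ 0} w^m ⟨m|X|m⟩ / (q;q)_m` in `ℂ(q,z)` has sum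
`t` for the absolute value at `z = ∞`, i.e. as a power series in `z⁻¹`. -/
def HasTrace (w : Cqz) (X : QBoson) (t : Cqz) : Prop :=
  ∀ ε, 0 < ε → ∀ᶠ N : ℕ in atTop, absInfty (∑ m ∈ Finset.range N,
    w ^ m * algebraMap Cq Cqz (bra m (fockRep X (ket m)) / qPoch qc qc m) - t) < ε

/-! The matrix product operators. -/

/-- The `m`-th coefficient of the series `₂φ₁(a, b; c; q, ·)`. -/
noncomputable def phiCoeff (a b c : Cq) (m : ℕ) : Cq :=
  qPoch a qc m * qPoch b qc m / (qPoch qc qc m * qPoch c qc m)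

/-- The terminating series `₂φ₁(q^{-t}, -q^{-t}; -q^{-s}; q, q𝐤)`; its terms with `m > t` vanish. -/
noncomputable def phiOp (t s : ℕ) : QBoson :=
  ∑ᶠ m : ℕ, phiCoeff (qc ^ (-(t : ℤ))) (-qc ^ (-(t : ℤ))) (-qc ^ (-(s : ℤ))) m •
    (qc • QBoson.gen .k) ^ m

/-- The coefficients vanish beyond `t`, so that the sum above is finite. -/
lemma phiCoeff_eq_zero {t m : ℕ} (h : t < m) (b c : Cq) :
    phiCoeff (qc ^ (-(t : ℤ))) b c m = 0 := by
  have : qPoch (qc ^ (-(t : ℤ))) qc m = 0 :=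
    Finset.prod_eq_zero (Finset.mem_range.2 h) (by simp [qc_ne_zero])
  rw [phiCoeff, this, zero_mul, zero_div]

/-- The element `G^j_i ∈ A_q`. -/
noncomputable def gOp (j i : ℕ) : QBoson :=
  if j ≤ i then
    qPoch (-qc) qc (i + j) • (phiOp j (i + j) * QBoson.gen .am ^ (i - j))
  else
    qPoch (-qc) qc (i + j) • (QBoson.gen .ap ^ (j - i) * phiOp i (i + j))

/-- The ordered product `G^{γ_1}_{α_1} ⋯ G^{γ_n}_{α_n}`. -/
noncomputable def gProd {n : ℕ} (γ α : Arr n) : QBoson :=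
  ((List.range n).map fun p : ℕ =>
    gOp (γ ((p + 1 : ℕ) : ZMod n)).toNat (α ((p + 1 : ℕ) : ZMod n)).toNat).prod

/-- `⟨γ, α⟩ = ∑_{1 ≤ i < j ≤ n} γ_i α_j`. -/
def angle {n : ℕ} (γ α : Arr n) : ℤ :=
  ∑ j ∈ Finset.Icc 1 n, ∑ i ∈ Finset.Ico 1 j, γ (i : ZMod n) * α (j : ZMod n)

/-- The scalar `q^{⟨γ,α⟩} (q^{-l} z^{-1}; q)_{l+1} / ((q²;q²)_l (-q z^{-1}; q)_l)`. -/
noncomputable def prefactor {n : ℕ} (l : ℕ) (γ α : Arr n) : Cqz :=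
  qz ^ angle γ α * qPoch (qz ^ (-(l : ℤ)) * (zz : Cqz)⁻¹) qz (l + 1) /
    (qPoch (qz ^ 2) (qz ^ 2) l * qPoch (-qz * (zz : Cqz)⁻¹) qz l)

/-! Write `q^m = x` for the eigenvalue of `𝐤` on `|m⟩`. Each `G^j_i` maps `|m⟩` to a multiple of
`|m + j - i⟩`, and the multiple is a polynomial `gFun q i j x` in `x` (`fockRep_gOp`). A diagonal
matrix element of `G^{γ_1}_{α_1} ⋯ G^{γ_n}_{α_n}` is therefore a polynomial in `x` (`chainPoly`),
and its trace is obtained from `x ^ k ↦ 1 / (1 - w q ^ k)`, `w = (q ^ l z)⁻¹` (`qTrace`,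
`hasTrace_qTrace`).

*Existence.* In coordinates, commuting with all `b_j` is a system of linear equations for the
matrix elements (`IntertwiningEq`, `forall_coidealBq_iff`), the one for `b_j` involving only
neighbouring values of the entries `j` and `j + 1` of the two arrays. It holds for the trace
formula because of a relation between products of two adjacent operators (`ExchangeRel`,
`exchangeRel_gFun`), which comes from three-term recurrences for the polynomials `hFun`, the
normalized `gFun` (`hFun_exchange`). For `j = 0` the two sites are the last and the first one,
and the trace is first rotated (`qTrace_shift`): this is where the powers of `z` and the
condition `∑ α_i = ∑ γ_i = l` enter. The normalization `K^{l𝐞_1}_{l𝐞_1} = 1` is the partial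
fraction expansion of `(-q^{l+1} w; q)_l / (w; q)_{l+1}` (`sum_gNorm_mul_hCoeff_mul_prod`),
proved by interpolation.

*Uniqueness.* Clear denominators in a nonzero solution of the system and keep the coefficients of
the highest power of `z`. They satisfy a degenerate system over `ℂ(q)`, in which the equation for
`b_0` has only two terms left (`TopSystem`, `exists_topSystem`). Starting from the entry at
`(l𝐞_1, l𝐞_1)`, this system determines first the column of `l𝐞_1` and then all columns
(`TopSystem.eq_zero`), so a solution of the original system with vanishing entry at `(l𝐞_1,
l𝐞_1)` is zero. -/

/-! ### Generic parameters and the coefficients of the matrix elements -/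

section Scalars

variable {F : Type*} [Field F]

/-- The genericity of the deformation parameter: `q` is nonzero, not a root of unity, and the
characteristic is not `2` (so that `1 + q ^ n` never vanishes). -/
structure IsGenericParam (q : F) : Prop where
  ne_zero : q ≠ 0
  zpow_ne_one : ∀ n : ℤ, n ≠ 0 → q ^ n ≠ 1
  two_ne_zero : (2 : F) ≠ 0

lemma IsGenericParam.one_add_zpow_ne_zero {q : F} (hq : IsGenericParam q) (n : ℤ) :
    1 + q ^ n ≠ 0 := by
  intro h
  rcases eq_or_ne n 0 with rfl | hn
  · exact hq.two_ne_zero (by simpa [one_add_one_eq_two] using h)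
  · apply hq.zpow_ne_one (n + n) (by omega)
    rw [zpow_add₀ hq.ne_zero]
    linear_combination (q ^ n - 1) * h

lemma IsGenericParam.inv {q : F} (hq : IsGenericParam q) : IsGenericParam q⁻¹ where
  ne_zero := inv_ne_zero hq.ne_zero
  zpow_ne_one n hn := by
    rw [inv_zpow, ← zpow_neg]
    exact hq.zpow_ne_one _ (by omega)
  two_ne_zero := hq.two_ne_zero

lemma IsGenericParam.sq {q : F} (hq : IsGenericParam q) : IsGenericParam (q ^ 2) where
  ne_zero := pow_ne_zero 2 hq.ne_zero
  zpow_ne_one n hn := by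
    rw [← zpow_natCast, ← zpow_mul]
    exact hq.zpow_ne_one _ (by simpa using hn)
  two_ne_zero := hq.two_ne_zero

/-- `1 / (p; p)_n`, extended by `0` to negative `n`. -/
noncomputable def invPoch (p : F) (n : ℤ) : F :=
  if n < 0 then 0 else (qPoch p p n.toNat)⁻¹

lemma invPoch_of_neg (p : F) {n : ℤ} (hn : n < 0) : invPoch p n = 0 := if_pos hn

lemma invPoch_sub_one {p : F} (hp : IsGenericParam p) (n : ℤ) :
    invPoch p (n - 1) = (1 - p ^ n) * invPoch p n := by
  rcases lt_trichotomy n 0 with hn | rfl | hn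
  · rw [invPoch_of_neg p hn, invPoch_of_neg p (by omega), mul_zero]
  · simp [invPoch]
  · obtain ⟨m, rfl⟩ : ∃ m : ℕ, n = m + 1 := ⟨(n - 1).toNat, by omega⟩
    have h1 : (1 : F) - p * p ^ m ≠ 0 := by
      rw [sub_ne_zero, ← pow_succ']
      exact_mod_cast (hp.zpow_ne_one (m + 1) (by omega)).symm
    rw [invPoch, invPoch, if_neg (by omega), if_neg (by omega)]
    have e1 : ((m : ℤ) + 1 - 1).toNat = m := by omega
    have e2 : ((m : ℤ) + 1).toNat = m + 1 := by omega
    have e3 : p ^ ((m : ℤ) + 1) = p * p ^ m := by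
      rw [zpow_add_one₀ hp.ne_zero, zpow_natCast, mul_comm]
    rw [e1, e2, e3, qPoch, qPoch, Finset.prod_range_succ, mul_inv, mul_left_comm,
      mul_inv_cancel₀ h1, mul_one]

/-- `(-q; q)_n`, extended to negative `n` so that `(-q; q)_n = (1 + q ^ n) (-q; q)_{n-1}` holds for
all integers. -/
noncomputable def negPoch (q : F) (n : ℤ) : F :=
  if 0 ≤ n then qPoch (-q) q n.toNat
  else (∏ k ∈ Finset.range (-n).toNat, (1 + q ^ (-(k : ℤ))))⁻¹

lemma negPoch_eq {q : F} (hq : IsGenericParam q) (n : ℤ) :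
    negPoch q n = (1 + q ^ n) * negPoch q (n - 1) := by
  rcases lt_or_ge 0 n with hn | hn
  · obtain ⟨m, rfl⟩ : ∃ m : ℕ, n = m + 1 := ⟨(n - 1).toNat, by omega⟩
    rw [negPoch, negPoch, if_pos (by omega), if_pos (by omega)]
    have e1 : ((m : ℤ) + 1 - 1).toNat = m := by omega
    have e2 : ((m : ℤ) + 1).toNat = m + 1 := by omega
    have e3 : q ^ ((m : ℤ) + 1) = q * q ^ m := by
      rw [zpow_add_one₀ hq.ne_zero, zpow_natCast, mul_comm]
    rw [e1, e2, e3, qPoch, qPoch, Finset.prod_range_succ]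
    ring
  · obtain ⟨m, rfl⟩ : ∃ m : ℕ, n = -m := ⟨(-n).toNat, by omega⟩
    have h := hq.one_add_zpow_ne_zero (-(m : ℤ))
    have e : negPoch q (-(m : ℤ) - 1) =
        (∏ k ∈ Finset.range (m + 1), (1 + q ^ (-(k : ℤ))))⁻¹ := by
      rw [negPoch, if_neg (by omega)]
      congr 3
      omega
    rw [e, Finset.prod_range_succ, mul_inv, mul_left_comm, mul_inv_cancel₀ h, mul_one]
    rcases Nat.eq_zero_or_pos m with rfl | hm
    · simp [negPoch, qPoch]
    · rw [negPoch, if_neg (by omega)]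
      congr 3
      omega

/-- The coefficient of `x ^ r` in `hFun q i j x`. -/
noncomputable def hCoeff (q : F) (i j r : ℤ) : F :=
  q ^ (r * (j - i)) * invPoch q⁻¹ r * invPoch (q ^ 2) (i - r) * invPoch (q ^ 2) j *
    negPoch q (i + j - r)

/-- The matrix element of `G^j_i / ((q²;q²)_i (q²;q²)_j)` between `|m⟩` and `|m + j - i⟩`, as a
polynomial function of `x = q ^ m`; it vanishes unless `i, j ≥ 0`. -/
noncomputable def hFun (q : F) (i j : ℤ) (x : F) : F :=
  ∑ r ∈ Finset.range (i.toNat + 1), hCoeff q i j r * x ^ r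

lemma hCoeff_of_neg (q : F) {i j r : ℤ} (h : r < 0 ∨ i < r ∨ j < 0) : hCoeff q i j r = 0 := by
  rcases h with h | h | h
  · simp [hCoeff, invPoch_of_neg _ h]
  · simp [hCoeff, invPoch_of_neg _ (show i - r < 0 by omega)]
  · simp [hCoeff, invPoch_of_neg _ h]

lemma hFun_of_neg (q : F) {i j : ℤ} (h : i < 0 ∨ j < 0) (x : F) : hFun q i j x = 0 :=
  Finset.sum_eq_zero fun r _ => by rw [hCoeff_of_neg q (by omega), zero_mul]

lemma hFun_mul_eq (q : F) (i j : ℤ) (s x : F) {M : ℕ} (hM : i < M) :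
    hFun q i j (s * x) =
      ∑ r ∈ Finset.range M, hCoeff q i j (r : ℤ) * s ^ (r : ℤ) * x ^ r := by
  have h1 : hFun q i j (s * x) =
      ∑ r ∈ Finset.range (i.toNat + 1), hCoeff q i j (r : ℤ) * s ^ (r : ℤ) * x ^ r := by
    simp [hFun, mul_pow, mul_assoc]
  rcases lt_or_ge i 0 with hi | hi
  · rw [hFun_of_neg q (Or.inl hi)]
    exact (Finset.sum_eq_zero fun r _ => by
      rw [hCoeff_of_neg q (by omega), zero_mul, zero_mul]).symm
  · rw [h1]
    refine Finset.sum_subset (Finset.range_subset_range.2 (by omega)) fun r _ hr => ?_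
    rw [Finset.mem_range] at hr
    rw [hCoeff_of_neg q (by omega), zero_mul, zero_mul]

lemma sum_range_shift (f : ℤ → F) (x : F) (M : ℕ) (h0 : f (-1) = 0) (hM : f (M - 1) = 0) :
    x * ∑ r ∈ Finset.range M, f (r : ℤ) * x ^ r =
      ∑ r ∈ Finset.range M, f ((r : ℤ) - 1) * x ^ r := by
  rcases M with _ | M
  · simp
  · rw [Finset.sum_range_succ, Finset.sum_range_succ']
    have : f (M : ℤ) = 0 := by simpa using hM
    simp only [Nat.cast_zero, zero_sub, h0, this, zero_mul, add_zero, Finset.mul_sum,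
      Nat.cast_add, Nat.cast_one, add_sub_cancel_right]
    exact Finset.sum_congr rfl fun r _ => by ring

lemma mul_hFun_mul_eq (q : F) (i j : ℤ) (s x : F) {M : ℕ} (hM : i + 1 < M) :
    x * hFun q i j (s * x) =
      ∑ r ∈ Finset.range M, hCoeff q i j ((r : ℤ) - 1) * s ^ ((r : ℤ) - 1) * x ^ r := by
  rw [hFun_mul_eq q i j s x (M := M) (by omega)]
  exact sum_range_shift (fun r => hCoeff q i j r * s ^ r) x M
    (by simp [hCoeff_of_neg q (show (-1 : ℤ) < 0 ∨ i < -1 ∨ j < 0 by omega)])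
    (by simp [hCoeff_of_neg q (show (M : ℤ) - 1 < 0 ∨ i < (M : ℤ) - 1 ∨ j < 0 by omega)])

lemma sq_mul_hFun_mul_eq (q : F) (i j : ℤ) (s x : F) {M : ℕ} (hM : i + 2 < M) :
    x ^ 2 * hFun q i j (s * x) =
      ∑ r ∈ Finset.range M, hCoeff q i j ((r : ℤ) - 2) * s ^ ((r : ℤ) - 2) * x ^ r := by
  rw [pow_two, mul_assoc, mul_hFun_mul_eq q i j s x (M := M) (by omega)]
  rw [sum_range_shift (fun r => hCoeff q i j (r - 1) * s ^ (r - 1)) x M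
    (by rw [hCoeff_of_neg q (by omega), zero_mul])
    (by rw [hCoeff_of_neg q (by omega), zero_mul])]
  refine Finset.sum_congr rfl fun r _ => ?_
  rw [sub_sub, one_add_one_eq_two]

/-- The neighbouring coefficients that enter the recurrences below are rational multiples of a
common one. -/
lemma hCoeff_neighbours {q : F} (hq : IsGenericParam q) (i j r : ℤ) :
    ∃ K U V R : F, U = q ^ i ∧ V = q ^ j ∧ R = q ^ r ∧ U ≠ 0 ∧ V ≠ 0 ∧ R ≠ 0 ∧
      hCoeff q (i + 1) j r = K * (R⁻¹ * (1 - q ^ 2 * V ^ 2) * (1 + q * (U * V / R)) *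
        (1 + U * V / R)) ∧
      hCoeff q i j r = K * ((1 - q ^ 2 * (U / R) ^ 2) * (1 - q ^ 2 * V ^ 2) * (1 + U * V / R)) ∧
      hCoeff q i j (r - 1) = K * (U / V * (1 - R⁻¹) * (1 - q ^ 2 * V ^ 2) *
        (1 + q * (U * V / R)) * (1 + U * V / R)) ∧
      hCoeff q (i - 1) j r = K * (R * (1 - (U / R) ^ 2) * (1 - q ^ 2 * (U / R) ^ 2) *
        (1 - q ^ 2 * V ^ 2)) ∧
      hCoeff q (i - 1) j (r - 1) = K * (R * U / (V * q) * (1 - R⁻¹) *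
        (1 - q ^ 2 * (U / R) ^ 2) * (1 - q ^ 2 * V ^ 2) * (1 + U * V / R)) ∧
      hCoeff q (i - 1) j (r - 2) = K * (R * U ^ 2 / (V ^ 2 * q ^ 2) * (1 - q * R⁻¹) * (1 - R⁻¹) *
        (1 - q ^ 2 * V ^ 2) * (1 + q * (U * V / R)) * (1 + U * V / R)) ∧
      hCoeff q i (j - 1) r = K * (R⁻¹ * (1 - q ^ 2 * (U / R) ^ 2) * (1 - V ^ 2) *
        (1 - q ^ 2 * V ^ 2)) ∧
      hCoeff q i (j - 1) (r - 1) = K * (q * U / (R * V) * (1 - R⁻¹) * (1 - V ^ 2) *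
        (1 - q ^ 2 * V ^ 2) * (1 + U * V / R)) ∧
      hCoeff q i (j + 1) r = K * (R * (1 - q ^ 2 * (U / R) ^ 2) * (1 + q * (U * V / R)) *
        (1 + U * V / R)) := by
  have h0 := hq.ne_zero
  have hw1 : invPoch q⁻¹ (r - 1) = (1 - (q ^ r)⁻¹) * invPoch q⁻¹ r := by
    rw [invPoch_sub_one hq.inv, inv_zpow]
  have hw2 : invPoch q⁻¹ (r - 2) = (1 - q * (q ^ r)⁻¹) * ((1 - (q ^ r)⁻¹) * invPoch q⁻¹ r) := by
    rw [show r - 2 = r - 1 - 1 by ring, invPoch_sub_one hq.inv, hw1, inv_zpow, zpow_sub_one₀ h0]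
    simp [mul_comm]
  have hA0 : invPoch (q ^ 2) (i - r) =
      (1 - q ^ 2 * (q ^ i / q ^ r) ^ 2) * invPoch (q ^ 2) (i + 1 - r) := by
    rw [show i - r = i + 1 - r - 1 by ring, invPoch_sub_one hq.sq, zpow_sub₀ (pow_ne_zero 2 h0),
      zpow_add_one₀ (pow_ne_zero 2 h0), ← zpow_natCast q 2, zpow_comm, zpow_comm q _ r, div_pow]
    norm_cast
    ring
  have hA1 : invPoch (q ^ 2) (i - 1 - r) = (1 - (q ^ i / q ^ r) ^ 2) *
      ((1 - q ^ 2 * (q ^ i / q ^ r) ^ 2) * invPoch (q ^ 2) (i + 1 - r)) := by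
    rw [show i - 1 - r = i - r - 1 by ring, invPoch_sub_one hq.sq, hA0,
      zpow_sub₀ (pow_ne_zero 2 h0), ← zpow_natCast q 2, zpow_comm, zpow_comm q _ r, div_pow]
    norm_cast
  have hB0 : invPoch (q ^ 2) j = (1 - q ^ 2 * (q ^ j) ^ 2) * invPoch (q ^ 2) (j + 1) := by
    conv_lhs => rw [show j = j + 1 - 1 by ring]
    rw [invPoch_sub_one hq.sq, zpow_add_one₀ (pow_ne_zero 2 h0), ← zpow_natCast q 2, zpow_comm]
    norm_cast
    rw [mul_comm (q ^ 2)]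
  have hB1 : invPoch (q ^ 2) (j - 1) =
      (1 - (q ^ j) ^ 2) * ((1 - q ^ 2 * (q ^ j) ^ 2) * invPoch (q ^ 2) (j + 1)) := by
    rw [invPoch_sub_one hq.sq, hB0, ← zpow_natCast q 2, zpow_comm]
    norm_cast
  have hP0 : negPoch q (i + j - r) = (1 + q ^ i * q ^ j / q ^ r) * negPoch q (i + j - r - 1) := by
    rw [negPoch_eq hq, zpow_sub₀ h0, zpow_add₀ h0]
  have hP1 : negPoch q (i + j - r + 1) = (1 + q * (q ^ i * q ^ j / q ^ r)) *
      ((1 + q ^ i * q ^ j / q ^ r) * negPoch q (i + j - r - 1)) := by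
    rw [negPoch_eq hq, add_sub_cancel_right, hP0, zpow_add_one₀ h0, zpow_sub₀ h0, zpow_add₀ h0,
      mul_comm q]
  have hU := zpow_ne_zero i h0
  have hV := zpow_ne_zero j h0
  have hR := zpow_ne_zero r h0
  refine ⟨q ^ (r * (j - i)) * invPoch q⁻¹ r * invPoch (q ^ 2) (i + 1 - r) *
    invPoch (q ^ 2) (j + 1) * negPoch q (i + j - r - 1), q ^ i, q ^ j, q ^ r, rfl, rfl, rfl, hU, hV,
    hR, ?_, ?_, ?_, ?_, ?_, ?_, ?_, ?_, ?_⟩ <;> rw [hCoeff]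
  · rw [show i + 1 + j - r = i + j - r + 1 by ring, hP1, hB0,
      show r * (j - (i + 1)) = r * (j - i) - r by ring, zpow_sub₀ h0]
    ring
  · rw [hP0, hB0, hA0]
    ring
  · rw [show i + j - (r - 1) = i + j - r + 1 by ring, show i - (r - 1) = i + 1 - r by ring,
      hP1, hB0, hw1, show (r - 1) * (j - i) = r * (j - i) + i - j by ring, zpow_sub₀ h0,
      zpow_add₀ h0]
    ring
  · rw [show i - 1 + j - r = i + j - r - 1 by ring, hB0, hA1,
      show r * (j - (i - 1)) = r * (j - i) + r by ring, zpow_add₀ h0]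
    ring
  · rw [show i - 1 + j - (r - 1) = i + j - r by ring, show i - 1 - (r - 1) = i - r by ring,
      hP0, hB0, hA0, hw1, show (r - 1) * (j - (i - 1)) = r * (j - i) + r + i - j - 1 by ring,
      zpow_sub_one₀ h0, zpow_sub₀ h0, zpow_add₀ h0, zpow_add₀ h0]
    ring
  · rw [show i - 1 + j - (r - 2) = i + j - r + 1 by ring, show i - 1 - (r - 2) = i + 1 - r by ring,
      hP1, hB0, hw2,
      show (r - 2) * (j - (i - 1)) = r * (j - i) + r + i + i - j - j - 1 - 1 by ring,
      zpow_sub_one₀ h0, zpow_sub_one₀ h0, zpow_sub₀ h0, zpow_sub₀ h0, zpow_add₀ h0, zpow_add₀ h0,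
      zpow_add₀ h0]
    ring
  · rw [show i + (j - 1) - r = i + j - r - 1 by ring, hB1, hA0,
      show r * (j - 1 - i) = r * (j - i) - r by ring, zpow_sub₀ h0]
    ring
  · rw [show i + (j - 1) - (r - 1) = i + j - r by ring, show i - (r - 1) = i + 1 - r by ring,
      hP0, hB1, hw1, show (r - 1) * (j - 1 - i) = r * (j - i) - r + i - j + 1 by ring,
      zpow_add_one₀ h0, zpow_sub₀ h0, zpow_add₀ h0, zpow_sub₀ h0]
    ring
  · rw [show i + (j + 1) - r = i + j - r + 1 by ring, hP1, hA0,
      show r * (j + 1 - i) = r * (j - i) + r by ring, zpow_add₀ h0]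
    ring

end Scalars

/-! ### Recurrences and the two-site identity for `hFun` -/

section Recurrences

variable {F : Type*} [Field F]

/-- A three-term recurrence lowering one index at a time, with the argument shifted: boson operators
are written on the right. -/
lemma hFun_rec_right {q : F} (hq : IsGenericParam q) (i j : ℤ) (x : F) :
    (1 - q ^ (i + j)) * hFun q i j x =
      (q ^ j) ^ 2 * (1 - x) * hFun q (i - 1) j (q⁻¹ * x) + hFun q i (j - 1) (q * x) := by
  have h0 := hq.ne_zero
  rw [← one_mul x, show (q ^ j) ^ 2 * (1 - 1 * x) * hFun q (i - 1) j (q⁻¹ * (1 * x)) =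
      (q ^ j) ^ 2 * (hFun q (i - 1) j (q⁻¹ * x) - x * hFun q (i - 1) j (q⁻¹ * x)) by
        rw [one_mul]; ring, show q * (1 * x) = q * x by ring,
    mul_hFun_mul_eq (M := i.toNat + 2) q (i - 1) j q⁻¹ x (by omega),
    hFun_mul_eq (M := i.toNat + 2) q i j 1 x (by omega),
    hFun_mul_eq (M := i.toNat + 2) q (i - 1) j q⁻¹ x (by omega),
    hFun_mul_eq (M := i.toNat + 2) q i (j - 1) q x (by omega), ← Finset.sum_sub_distrib,
    Finset.mul_sum, Finset.mul_sum, ← Finset.sum_add_distrib]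
  refine Finset.sum_congr rfl fun r _ => ?_
  obtain ⟨K, U, V, R, hU, hV, hR, hU0, hV0, hR0, -, h1, -, h2, h3, -, h4, -, -⟩ :=
    hCoeff_neighbours hq i j r
  rw [h1, h2, h3, h4, zpow_add₀ h0, inv_zpow, inv_zpow, zpow_sub_one₀ h0, one_zpow, ← hU, ← hV,
    ← hR]
  generalize x ^ r = y
  field_simp
  ring

/-- The companion of `hFun_rec_right` with boson operators written on the left, so that the
argument stays fixed. -/
lemma hFun_rec_left {q : F} (hq : IsGenericParam q) (i j : ℤ) (x : F) :
    (1 - q ^ (i + j)) * hFun q i j x =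
      (1 - q * q ^ j / q ^ i * x) * hFun q (i - 1) j x + (q ^ i) ^ 2 * hFun q i (j - 1) x := by
  have h0 := hq.ne_zero
  rw [← one_mul x, show (1 - q * q ^ j / q ^ i * (1 * x)) * hFun q (i - 1) j (1 * x) =
      hFun q (i - 1) j (1 * x) - q * q ^ j / q ^ i * (x * hFun q (i - 1) j (1 * x)) by
        rw [one_mul]; ring,
    mul_hFun_mul_eq (M := i.toNat + 2) q (i - 1) j 1 x (by omega),
    hFun_mul_eq (M := i.toNat + 2) q i j 1 x (by omega),
    hFun_mul_eq (M := i.toNat + 2) q (i - 1) j 1 x (by omega),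
    hFun_mul_eq (M := i.toNat + 2) q i (j - 1) 1 x (by omega),
    Finset.mul_sum, Finset.mul_sum, Finset.mul_sum, ← Finset.sum_sub_distrib,
    ← Finset.sum_add_distrib]
  refine Finset.sum_congr rfl fun r _ => ?_
  obtain ⟨K, U, V, R, hU, hV, hR, hU0, hV0, hR0, -, h1, -, h2, h3, -, h4, -, -⟩ :=
    hCoeff_neighbours hq i j r
  rw [h1, h2, h3, h4, zpow_add₀ h0, one_zpow, one_zpow, ← hU, ← hV]
  generalize x ^ r = y
  field_simp
  ring

/-- The `q²`-difference of `hFun` in its lower index, written with boson operators on the right. -/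
lemma hFun_lower_right {q : F} (hq : IsGenericParam q) (i j : ℤ) (x : F) :
    (1 - (q * q ^ i) ^ 2) * hFun q (i + 1) j x =
      (1 + q) * (1 - x) * hFun q i j (q⁻¹ * x) -
        q * (q ^ j) ^ 2 * (1 - x) * (1 - q⁻¹ * x) * hFun q (i - 1) j ((q ^ 2)⁻¹ * x) +
        (1 - (1 + q) * (1 - x)) * hFun q i (j - 1) x := by
  have h0 := hq.ne_zero
  have e0 : hFun q (i + 1) j x = hFun q (i + 1) j (1 * x) := by rw [one_mul]
  have e1 : (1 + q) * (1 - x) * hFun q i j (q⁻¹ * x) =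
      (1 + q) * (hFun q i j (q⁻¹ * x) - x * hFun q i j (q⁻¹ * x)) := by ring
  have e2 : q * (q ^ j) ^ 2 * (1 - x) * (1 - q⁻¹ * x) * hFun q (i - 1) j ((q ^ 2)⁻¹ * x) =
      q * (q ^ j) ^ 2 * (hFun q (i - 1) j ((q ^ 2)⁻¹ * x) -
        (1 + q⁻¹) * (x * hFun q (i - 1) j ((q ^ 2)⁻¹ * x)) +
        q⁻¹ * (x ^ 2 * hFun q (i - 1) j ((q ^ 2)⁻¹ * x))) := by ring
  have e3 : (1 - (1 + q) * (1 - x)) * hFun q i (j - 1) x =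
      -q * hFun q i (j - 1) (1 * x) + (1 + q) * (x * hFun q i (j - 1) (1 * x)) := by
    rw [one_mul]; ring
  rw [e0, e1, e2, e3,
    sq_mul_hFun_mul_eq (M := i.toNat + 3) q (i - 1) j (q ^ 2)⁻¹ x (by omega),
    mul_hFun_mul_eq (M := i.toNat + 3) q i j q⁻¹ x (by omega),
    mul_hFun_mul_eq (M := i.toNat + 3) q (i - 1) j (q ^ 2)⁻¹ x (by omega),
    mul_hFun_mul_eq (M := i.toNat + 3) q i (j - 1) 1 x (by omega),
    hFun_mul_eq (M := i.toNat + 3) q (i + 1) j 1 x (by omega),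
    hFun_mul_eq (M := i.toNat + 3) q i j q⁻¹ x (by omega),
    hFun_mul_eq (M := i.toNat + 3) q (i - 1) j (q ^ 2)⁻¹ x (by omega),
    hFun_mul_eq (M := i.toNat + 3) q i (j - 1) 1 x (by omega)]
  simp only [Finset.mul_sum, ← Finset.sum_sub_distrib, ← Finset.sum_add_distrib]
  refine Finset.sum_congr rfl fun r _ => ?_
  obtain ⟨K, U, V, R, hU, hV, hR, hU0, hV0, hR0, h1, h2, h3, h4, h5, h6, h7, h8, -⟩ :=
    hCoeff_neighbours hq i j r
  have s1 : ((q ^ 2)⁻¹ : F) ^ (r : ℤ) = (R ^ 2)⁻¹ := by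
    rw [hR, inv_zpow, ← zpow_natCast q 2, zpow_comm]; norm_cast
  have s2 : ((q ^ 2)⁻¹ : F) ^ ((r : ℤ) - 1) = (R ^ 2)⁻¹ * q ^ 2 := by
    rw [zpow_sub_one₀ (inv_ne_zero (pow_ne_zero 2 h0)), s1, inv_inv]
  have s3 : ((q ^ 2)⁻¹ : F) ^ ((r : ℤ) - 2) = (R ^ 2)⁻¹ * q ^ 4 := by
    rw [show (r : ℤ) - 2 = r - 1 - 1 by ring, zpow_sub_one₀ (inv_ne_zero (pow_ne_zero 2 h0)), s2,
      inv_inv]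
    ring
  rw [h1, h2, h3, h4, h5, h6, h7, h8, s1, s2, s3, inv_zpow, inv_zpow, zpow_sub_one₀ h0, one_zpow,
    one_zpow, ← hU, ← hV, ← hR]
  generalize x ^ r = y
  clear h1 h2 h3 h4 h5 h6 h7 h8 s1 s2 s3 e0 e1 e2 e3
  field_simp
  ring

/-- The `q²`-difference of `hFun` in its upper index, written with boson operators on the right. -/
lemma hFun_upper_right {q : F} (hq : IsGenericParam q) (i j : ℤ) (x : F) :
    (1 - (q * q ^ j) ^ 2) * hFun q i (j + 1) x =
      (1 + q) * hFun q i j (q * x) - q * (q ^ j) ^ 2 * hFun q (i - 1) j x -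
        q * hFun q i (j - 1) (q ^ 2 * x) := by
  have h0 := hq.ne_zero
  have e0 : hFun q i (j + 1) x = hFun q i (j + 1) (1 * x) := by rw [one_mul]
  have e1 : hFun q (i - 1) j x = hFun q (i - 1) j (1 * x) := by rw [one_mul]
  rw [e0, e1,
    hFun_mul_eq (M := i.toNat + 3) q i (j + 1) 1 x (by omega),
    hFun_mul_eq (M := i.toNat + 3) q i j q x (by omega),
    hFun_mul_eq (M := i.toNat + 3) q (i - 1) j 1 x (by omega),
    hFun_mul_eq (M := i.toNat + 3) q i (j - 1) (q ^ 2) x (by omega)]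
  simp only [Finset.mul_sum, ← Finset.sum_sub_distrib]
  refine Finset.sum_congr rfl fun r _ => ?_
  obtain ⟨K, U, V, R, hU, hV, hR, hU0, hV0, hR0, -, h2, -, h4, -, -, h7, -, h9⟩ :=
    hCoeff_neighbours hq i j r
  have s1 : (q ^ 2 : F) ^ (r : ℤ) = R ^ 2 := by
    rw [hR, ← zpow_natCast q 2, zpow_comm]; norm_cast
  rw [h2, h4, h7, h9, s1, one_zpow, ← hV, ← hR]
  generalize x ^ r = y
  clear h2 h4 h7 h9 s1 e0 e1
  field_simp
  ring

/-- The `q²`-difference of `hFun` in its lower index, written with boson operators on the left. -/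
lemma hFun_lower_left {q : F} (hq : IsGenericParam q) (i j : ℤ) (x : F) :
    (1 - (q * q ^ i) ^ 2) * hFun q (i + 1) j x =
      (1 + q) * (1 - q ^ j / q ^ i * x) * hFun q i j x -
        q * (1 - q * q ^ j / q ^ i * x) * (1 - q ^ j / q ^ i * x) * hFun q (i - 1) j x -
        q * (q ^ i) ^ 2 * hFun q i (j - 1) x := by
  have h0 := hq.ne_zero
  have e1 : (1 + q) * (1 - q ^ j / q ^ i * (1 * x)) * hFun q i j (1 * x) =
      (1 + q) * (hFun q i j (1 * x) - q ^ j / q ^ i * (x * hFun q i j (1 * x))) := by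
    rw [one_mul]; ring
  have e2 : q * (1 - q * q ^ j / q ^ i * (1 * x)) * (1 - q ^ j / q ^ i * (1 * x)) *
        hFun q (i - 1) j (1 * x) =
      q * (hFun q (i - 1) j (1 * x) -
        (1 + q) * (q ^ j / q ^ i) * (x * hFun q (i - 1) j (1 * x)) +
        q * (q ^ j / q ^ i) ^ 2 * (x ^ 2 * hFun q (i - 1) j (1 * x))) := by
    rw [one_mul]; ring
  rw [← one_mul x, e1, e2,
    sq_mul_hFun_mul_eq (M := i.toNat + 3) q (i - 1) j 1 x (by omega),
    mul_hFun_mul_eq (M := i.toNat + 3) q i j 1 x (by omega),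
    mul_hFun_mul_eq (M := i.toNat + 3) q (i - 1) j 1 x (by omega),
    hFun_mul_eq (M := i.toNat + 3) q (i + 1) j 1 x (by omega),
    hFun_mul_eq (M := i.toNat + 3) q i j 1 x (by omega),
    hFun_mul_eq (M := i.toNat + 3) q (i - 1) j 1 x (by omega),
    hFun_mul_eq (M := i.toNat + 3) q i (j - 1) 1 x (by omega)]
  simp only [Finset.mul_sum, ← Finset.sum_sub_distrib, ← Finset.sum_add_distrib]
  refine Finset.sum_congr rfl fun r _ => ?_
  obtain ⟨K, U, V, R, hU, hV, hR, hU0, hV0, hR0, h1, h2, h3, h4, h5, h6, h7, -, -⟩ :=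
    hCoeff_neighbours hq i j r
  rw [h1, h2, h3, h4, h5, h6, h7, one_zpow, one_zpow, one_zpow, ← hU, ← hV]
  generalize x ^ r = y
  clear h1 h2 h3 h4 h5 h6 h7 e1 e2
  field_simp
  ring

/-- The `q²`-difference of `hFun` in its upper index, written with boson operators on the left. -/
lemma hFun_upper_left {q : F} (hq : IsGenericParam q) (i j : ℤ) (x : F) :
    (1 - (q * q ^ j) ^ 2) * hFun q i (j + 1) x =
      (1 + q) * hFun q i j x +
        (1 - (1 + q) * (1 - q * q ^ j / q ^ i * x)) * hFun q (i - 1) j x -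
        q * (q ^ i) ^ 2 * hFun q i (j - 1) x := by
  have h0 := hq.ne_zero
  have e2 : (1 - (1 + q) * (1 - q * q ^ j / q ^ i * (1 * x))) * hFun q (i - 1) j (1 * x) =
      -q * hFun q (i - 1) j (1 * x) +
        (1 + q) * (q * q ^ j / q ^ i) * (x * hFun q (i - 1) j (1 * x)) := by
    rw [one_mul]; ring
  rw [← one_mul x, e2,
    mul_hFun_mul_eq (M := i.toNat + 3) q (i - 1) j 1 x (by omega),
    hFun_mul_eq (M := i.toNat + 3) q i (j + 1) 1 x (by omega),
    hFun_mul_eq (M := i.toNat + 3) q i j 1 x (by omega),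
    hFun_mul_eq (M := i.toNat + 3) q (i - 1) j 1 x (by omega),
    hFun_mul_eq (M := i.toNat + 3) q i (j - 1) 1 x (by omega)]
  simp only [Finset.mul_sum, ← Finset.sum_sub_distrib, ← Finset.sum_add_distrib]
  refine Finset.sum_congr rfl fun r _ => ?_
  obtain ⟨K, U, V, R, hU, hV, hR, hU0, hV0, hR0, -, h2, -, h4, h5, -, h7, -, h9⟩ :=
    hCoeff_neighbours hq i j r
  rw [h2, h4, h5, h7, h9, one_zpow, one_zpow, ← hU, ← hV]
  generalize x ^ r = y
  clear h2 h4 h5 h7 h9 e2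
  field_simp
  ring

/-- The exchange relation for two neighbouring factors: the lower and upper `q²`-differences of the
first factor, paired with those of the second. The first factor is evaluated at the state produced
by the second one. -/
lemma hFun_exchange {q : F} (hq : IsGenericParam q) (i₁ j₁ i₂ j₂ : ℤ) (x y : F)
    (hy : y = q ^ j₂ / q ^ i₂ * x) :
    (1 - (q * q ^ i₁) ^ 2) * hFun q (i₁ + 1) j₁ (q * y) * hFun q (i₂ - 1) j₂ x +
      (q ^ i₂) ^ 2 * ((1 - (q * q ^ j₁) ^ 2) * hFun q i₁ (j₁ + 1) (q⁻¹ * y)) *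
        hFun q i₂ (j₂ - 1) x -
      (q ^ j₁) ^ 2 * hFun q (i₁ - 1) j₁ (q⁻¹ * y) *
        ((1 - (q * q ^ i₂) ^ 2) * hFun q (i₂ + 1) j₂ x) -
      hFun q i₁ (j₁ - 1) (q * y) * ((1 - (q * q ^ j₂) ^ 2) * hFun q i₂ (j₂ + 1) x) =
    (1 + q) * (q ^ (i₁ + j₁) - q ^ (i₂ + j₂)) * (hFun q i₁ j₁ y * hFun q i₂ j₂ x) := by
  have h0 := hq.ne_zero
  have hL := hFun_rec_left hq i₂ j₂ x
  have hR := hFun_rec_right hq i₁ j₁ y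
  have n1 : q⁻¹ * (q * y) = y := by field_simp
  have n2 : (q ^ 2)⁻¹ * (q * y) = q⁻¹ * y := by field_simp
  have n3 : q * (q⁻¹ * y) = y := by field_simp
  have n4 : q ^ 2 * (q⁻¹ * y) = q * y := by field_simp
  have n5 : q * q ^ j₂ / q ^ i₂ * x = q * y := by rw [hy]; ring
  rw [hFun_lower_right hq, hFun_upper_right hq, hFun_lower_left hq, hFun_upper_left hq,
    n1, n2, n3, n4, n5, ← hy]
  rw [n5] at hL
  -- In the differences just inserted all terms but those of `hL` and `hR` cancel.
  linear_combination (1 + q) * hFun q i₂ j₂ x * hR - (1 + q) * hFun q i₁ j₁ y * hL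

end Recurrences

/-! ### Matrix elements of `G^j_i` in the Fock space -/

section FockAction

variable {F : Type*} [Field F]

/-- Exchanging the two indices of `hFun` transposes the operator it represents: the matrix element
in the direction of annihilation differs from that in the direction of creation by the norm ratio
of the two states. -/
lemma hFun_transpose {q : F} (hq : IsGenericParam q) (j d : ℕ) (x : F) :
    hFun q (j + d) j x =
      hFun q j (j + d) ((q ^ d)⁻¹ * x) * ∏ t ∈ Finset.range d, (1 - (q ^ t)⁻¹ * x) := by
  have h0 := hq.ne_zero
  induction j generalizing d x with
  | zero =>
    induction d generalizing x with
    | zero => simp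
    | succ d ih =>
      have hN : (1 : F) - q ^ ((0 : ℤ) + (d + 1)) ≠ 0 :=
        sub_ne_zero.2 (hq.zpow_ne_one _ (by omega)).symm
      apply mul_left_cancel₀ hN
      have e1 := hFun_rec_right hq (d + 1) 0 x
      have e2 := hFun_rec_left hq 0 (d + 1) ((q ^ (d + 1))⁻¹ * x)
      have e3 := ih (q⁻¹ * x)
      simp only [hFun_of_neg q (show (0 : ℤ) - 1 < 0 ∨ _ from Or.inl (by omega)),
        hFun_of_neg q (show _ ∨ (0 : ℤ) - 1 < 0 from Or.inr (by omega)),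
        add_sub_cancel_right, zpow_zero] at e1 e2
      simp only [Nat.cast_zero, zero_add, Nat.cast_add, Nat.cast_one, add_zero] at e1 e2 e3 ⊢
      have e4 : ∏ t ∈ Finset.range (d + 1), (1 - (q ^ t)⁻¹ * x) =
          (1 - x) * ∏ t ∈ Finset.range d, (1 - (q ^ t)⁻¹ * (q⁻¹ * x)) := by
        rw [Finset.prod_range_succ', mul_comm]
        congr 1
        · simp
        · refine Finset.prod_congr rfl fun t _ => ?_
          rw [pow_succ, mul_inv]; ring
      have e5 : (q ^ d)⁻¹ * (q⁻¹ * x) = (q ^ (d + 1))⁻¹ * x := by rw [pow_succ, mul_inv]; ring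
      rw [e5] at e3
      rw [e1, e3, e4]
      linear_combination (-(1 - x) * ∏ t ∈ Finset.range d, (1 - (q ^ t)⁻¹ * (q⁻¹ * x))) * e2
  | succ j ihj =>
    induction d generalizing x with
    | zero => simp
    | succ d ih =>
      have hN : (1 : F) - q ^ ((j + 1 : ℤ) + (j + 1 + (d + 1))) ≠ 0 :=
        sub_ne_zero.2 (hq.zpow_ne_one _ (by omega)).symm
      have e1 := hFun_rec_right hq (j + 1 + (d + 1)) (j + 1) x
      have e2 := hFun_rec_left hq (j + 1) (j + 1 + (d + 1)) ((q ^ (d + 1))⁻¹ * x)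
      have e3 := ih (q⁻¹ * x)
      have e3' := ihj (d + 2) (q * x)
      push_cast at e1 e2 e3 e3' ⊢
      apply mul_left_cancel₀ hN
      rw [show (j + 1 + (d + 1) - 1 : ℤ) = j + 1 + d by ring, add_sub_cancel_right] at e1 e2
      rw [show (j + (d + 2) : ℤ) = j + 1 + (d + 1) by ring] at e3'
      have e4 : ∏ t ∈ Finset.range (d + 1), (1 - (q ^ t)⁻¹ * x) =
          (1 - x) * ∏ t ∈ Finset.range d, (1 - (q ^ t)⁻¹ * (q⁻¹ * x)) := by
        rw [Finset.prod_range_succ', mul_comm]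
        congr 1
        · simp
        · refine Finset.prod_congr rfl fun t _ => ?_
          rw [pow_succ, mul_inv]; ring
      have e4' : ∏ t ∈ Finset.range (d + 2), (1 - (q ^ t)⁻¹ * (q * x)) =
          (1 - q * x) * ∏ t ∈ Finset.range (d + 1), (1 - (q ^ t)⁻¹ * x) := by
        rw [Finset.prod_range_succ', mul_comm]
        congr 1
        · simp
        · refine Finset.prod_congr rfl fun t _ => ?_
          rw [pow_succ, mul_inv]
          field_simp
      have e5 : (q ^ d)⁻¹ * (q⁻¹ * x) = (q ^ (d + 1))⁻¹ * x := by rw [pow_succ, mul_inv]; ring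
      have e5' : (q ^ (d + 2))⁻¹ * (q * x) = (q ^ (d + 1))⁻¹ * x := by
        rw [pow_succ _ (d + 1), mul_inv]; field_simp
      have e6 : q * q ^ (j + 1 + (d + 1) : ℤ) / q ^ (j + 1 : ℤ) * ((q ^ (d + 1))⁻¹ * x) =
          q * x := by
        have h1 : q ^ (j + 1 : ℤ) ≠ 0 := zpow_ne_zero _ h0
        have h2 : q ^ (d + 1) ≠ 0 := pow_ne_zero _ h0
        rw [zpow_add₀ h0 (j + 1 : ℤ) (d + 1 : ℤ), show q ^ (d + 1 : ℤ) = q ^ (d + 1) by norm_cast]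
        field_simp
      rw [e5] at e3
      rw [e5', e4'] at e3'
      rw [e6] at e2
      rw [add_comm (j + 1 + (d + 1) : ℤ) (j + 1)] at e1
      rw [e1, e3, e3', e4]
      linear_combination (-(1 - x) * ∏ t ∈ Finset.range d, (1 - (q ^ t)⁻¹ * (q⁻¹ * x))) * e2

/-- `(q²; q²)_i (q²; q²)_j`. -/
noncomputable def gNorm (q : F) (i j : ℤ) : F :=
  qPoch (q ^ 2) (q ^ 2) i.toNat * qPoch (q ^ 2) (q ^ 2) j.toNat

/-- The matrix element of `G^j_i` between `|m⟩` and `|m + j - i⟩` as a function of `x = q ^ m`. -/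
noncomputable def gFun (q : F) (i j : ℤ) (x : F) : F := gNorm q i j * hFun q i j x

lemma qPoch_ne_zero {p : F} (hp : IsGenericParam p) (n : ℕ) : qPoch p p n ≠ 0 := by
  refine Finset.prod_ne_zero_iff.2 fun k _ => ?_
  rw [sub_ne_zero, ← pow_succ']
  exact_mod_cast (hp.zpow_ne_one (k + 1) (by omega)).symm

lemma qPoch_mul_invPoch {p : F} (hp : IsGenericParam p) (n : ℕ) :
    qPoch p p n * invPoch p n = 1 := by
  rw [invPoch, if_neg (by omega), Int.toNat_natCast, mul_inv_cancel₀ (qPoch_ne_zero hp n)]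

lemma qPoch_succ (a p : F) (n : ℕ) : qPoch a p (n + 1) = qPoch a p n * (1 - a * p ^ n) :=
  Finset.prod_range_succ _ _

lemma hCoeff_succ {q : F} (hq : IsGenericParam q) (i j r : ℤ) :
    hCoeff q i j (r + 1) * ((1 - (q ^ (r + 1))⁻¹) * (1 + q ^ (i + j - r))) =
      q ^ (j - i) * (1 - (q ^ 2) ^ (i - r)) * hCoeff q i j r := by
  have h0 := hq.ne_zero
  have hw := invPoch_sub_one hq.inv (r + 1)
  have hA := invPoch_sub_one hq.sq (i - r)
  have hP := negPoch_eq hq (i + j - r)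
  rw [add_sub_cancel_right, inv_zpow] at hw
  rw [hCoeff, hCoeff, hw, show i - (r + 1) = i - r - 1 by ring, hA,
    show i + j - (r + 1) = i + j - r - 1 by ring, hP,
    show (r + 1) * (j - i) = r * (j - i) + (j - i) by ring, zpow_add₀ h0]
  ring

end FockAction

lemma isGenericParam_qc : IsGenericParam qc where
  ne_zero := qc_ne_zero
  zpow_ne_one n hn h := by
    rcases Int.natAbs_eq n with e | e
    · rw [e, zpow_natCast] at h
      exact qc_pow_ne_one (by omega) h
    · rw [e, zpow_neg, inv_eq_one, zpow_natCast] at h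
      exact qc_pow_ne_one (by omega) h
  two_ne_zero := (two_ne_zero : (2 : RatFunc ℂ) ≠ 0)

/-- The coefficients of the creation form of `G^j_i`. -/
lemma qPoch_mul_phiCoeff (i j r : ℕ) :
    qPoch (-qc) qc (i + j) * (phiCoeff (qc ^ (-(i : ℤ))) (-qc ^ (-(i : ℤ)))
      (-qc ^ (-((i + j : ℕ) : ℤ))) r * qc ^ r) = gNorm qc i j * hCoeff qc i j r := by
  have hq := isGenericParam_qc
  have h0 := hq.ne_zero
  unfold phiCoeff
  generalize qc = q at *
  induction r with
  | zero =>
    have h1 := qPoch_mul_invPoch hq.sq i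
    have h2 := qPoch_mul_invPoch hq.sq j
    have h3 : negPoch q ((i : ℤ) + j - 0) = qPoch (-q) q (i + j) := by
      rw [negPoch, if_pos (by omega)]
      congr 1
    have h4 : invPoch q⁻¹ 0 = 1 := by simp [invPoch, qPoch]
    simp only [hCoeff, gNorm, Int.toNat_natCast, Nat.cast_zero, h4, sub_zero] at *
    simp only [qPoch, Finset.range_zero, Finset.prod_empty, zero_mul, zpow_zero] at *
    rw [h3]
    linear_combination (-(∏ k ∈ Finset.range (i + j), (1 - -q * q ^ k)) *
      (∏ k ∈ Finset.range j, (1 - q ^ 2 * (q ^ 2) ^ k)) * invPoch (q ^ 2) j) * h1 -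
      (∏ k ∈ Finset.range (i + j), (1 - -q * q ^ k)) * h2
  | succ r ih =>
    have hs := hCoeff_succ hq i j r
    have hU : q ^ (i : ℤ) ≠ 0 := zpow_ne_zero _ h0
    have hV : q ^ (j : ℤ) ≠ 0 := zpow_ne_zero _ h0
    have hR : q ^ r ≠ 0 := pow_ne_zero _ h0
    have d1 : 1 - q * q ^ r ≠ 0 := by
      rw [sub_ne_zero, ← pow_succ']
      exact_mod_cast (hq.zpow_ne_one (r + 1) (by omega)).symm
    have d2 : 1 + q ^ (i : ℤ) * q ^ (j : ℤ) / q ^ r ≠ 0 := by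
      have := hq.one_add_zpow_ne_zero (i + j - r)
      rwa [zpow_sub₀ h0, zpow_add₀ h0, zpow_natCast q r] at this
    have e1 : q ^ ((r : ℤ) + 1) = q * q ^ r := by
      rw [zpow_add_one₀ h0, zpow_natCast, mul_comm]
    have e2 : q ^ ((i : ℤ) + j - r) = q ^ (i : ℤ) * q ^ (j : ℤ) / q ^ r := by
      rw [zpow_sub₀ h0, zpow_add₀ h0, zpow_natCast q r]
    have e3 : (q ^ 2) ^ ((i : ℤ) - r) = (q ^ (i : ℤ) / q ^ r) ^ 2 := by
      rw [← zpow_natCast q 2, zpow_comm, zpow_sub₀ h0, zpow_natCast q r]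
      norm_cast
    have e4 : q ^ (-((i + j : ℕ) : ℤ)) = (q ^ (i : ℤ) * q ^ (j : ℤ))⁻¹ := by
      rw [zpow_neg, Nat.cast_add, zpow_add₀ h0]
    have d3 : 1 - (q * q ^ r)⁻¹ ≠ 0 := by
      rw [sub_ne_zero, ne_comm, ne_eq, inv_eq_one]
      exact (sub_ne_zero.1 d1).symm
    rw [e1, e2, e3, zpow_sub₀ h0] at hs
    have key : (1 - (q ^ (i : ℤ))⁻¹ * q ^ r) * (1 - -(q ^ (i : ℤ))⁻¹ * q ^ r) * q *
        ((1 - (q * q ^ r)⁻¹) * (1 + q ^ (i : ℤ) * q ^ (j : ℤ) / q ^ r)) =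
        q ^ (j : ℤ) / q ^ (i : ℤ) * (1 - (q ^ (i : ℤ) / q ^ r) ^ 2) *
        ((1 - q * q ^ r) * (1 - -(q ^ (i : ℤ) * q ^ (j : ℤ))⁻¹ * q ^ r)) := by
      clear hs ih d1 d2 d3 e1 e2 e3 e4
      generalize q ^ (i : ℤ) = U at *
      generalize q ^ (j : ℤ) = V at *
      generalize q ^ r = R at *
      field_simp
      ring
    have d4 : 1 - -(q ^ (i : ℤ) * q ^ (j : ℤ))⁻¹ * q ^ r ≠ 0 := by
      intro h
      apply d2
      have : 1 + q ^ (i : ℤ) * q ^ (j : ℤ) / q ^ r = q ^ (i : ℤ) * q ^ (j : ℤ) / q ^ r *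
          (1 - -(q ^ (i : ℤ) * q ^ (j : ℤ))⁻¹ * q ^ r) := by field_simp; ring
      rw [this, h, mul_zero]
    apply mul_right_cancel₀ (mul_ne_zero d3 d2)
    rw [Nat.cast_succ r, mul_assoc (gNorm _ _ _), hs, mul_left_comm (gNorm _ _ _), ← ih,
      zpow_neg, e4]
    simp only [qPoch_succ]
    have key' := congrArg (fun t => t * ((1 - q * q ^ r) *
      (1 - -(q ^ (i : ℤ) * q ^ (j : ℤ))⁻¹ * q ^ r))⁻¹) key
    simp only [mul_inv_cancel_right₀ (mul_ne_zero d1 d4)] at key'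
    rw [pow_succ q r, ← key']
    simp only [div_eq_mul_inv, mul_inv]
    ring

lemma fockRep_gen (g : BosonGen) : fockRep (QBoson.gen g) = fockAct g := by
  simp [fockRep, QBoson.gen]

lemma fockRep_phiOp (t s m : ℕ) :
    fockRep (phiOp t s) (ket m) = (∑ r ∈ Finset.range (t + 1), phiCoeff (qc ^ (-(t : ℤ)))
      (-qc ^ (-(t : ℤ))) (-qc ^ (-(s : ℤ))) r * qc ^ r * (qc ^ m) ^ r) • ket m := by
  have hk : ∀ r : ℕ, (fockAct .k ^ r) (ket m) = (qc ^ m) ^ r • ket m := fun r => by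
    induction r with
    | zero => simp
    | succ r ih =>
      rw [pow_succ', Module.End.mul_apply, ih, map_smul]
      simp [fockAct, ket, pow_succ]
  rw [phiOp, finsum_eq_sum_of_support_subset (s := Finset.range (t + 1)), map_sum,
    LinearMap.sum_apply, Finset.sum_smul]
  · refine Finset.sum_congr rfl fun r _ => ?_
    rw [smul_pow, map_smul, map_smul, map_pow, fockRep_gen, LinearMap.smul_apply,
      LinearMap.smul_apply, hk, smul_smul, smul_smul, mul_assoc]
  · intro r hr
    by_contra h
    apply hr
    beta_reduce
    rw [phiCoeff_eq_zero (by simpa using h), zero_smul]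

lemma fockAct_ap_pow (d m : ℕ) : (fockAct .ap ^ d) (ket m) = ket (m + d) := by
  induction d with
  | zero => simp
  | succ d ih =>
    rw [pow_succ', Module.End.mul_apply, ih]
    simp [fockAct, ket, add_assoc]

lemma fockAct_am_pow (d m : ℕ) : (fockAct .am ^ d) (ket m) =
    (∏ t ∈ Finset.range d, (1 - (qc ^ t)⁻¹ * qc ^ m)) • ket (m - d) := by
  induction d with
  | zero => simp
  | succ d ih =>
    rw [pow_succ', Module.End.mul_apply, ih, map_smul, Finset.prod_range_succ, mul_smul]
    have h : fockAct .am (ket (m - d)) = (1 - qc ^ (m - d)) • ket (m - d - 1) := by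
      simp [fockAct, ket]
    rw [h, Nat.sub_sub]
    rcases le_or_gt d m with hd | hd
    · rw [pow_sub₀ _ qc_ne_zero hd, mul_comm (qc ^ m)]
    · have : ∏ t ∈ Finset.range d, (1 - (qc ^ t)⁻¹ * qc ^ m) = 0 :=
        Finset.prod_eq_zero (Finset.mem_range.2 hd)
          (by rw [inv_mul_cancel₀ (pow_ne_zero _ qc_ne_zero), sub_self])
      rw [this, zero_smul, zero_smul]

lemma qPoch_mul_sum_phiCoeff (i j : ℕ) (x : Cq) :
    qPoch (-qc) qc (i + j) * (∑ r ∈ Finset.range (i + 1), phiCoeff (qc ^ (-(i : ℤ)))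
      (-qc ^ (-(i : ℤ))) (-qc ^ (-((i + j : ℕ) : ℤ))) r * qc ^ r * x ^ r) = gFun qc i j x := by
  rw [gFun, hFun, Int.toNat_natCast, Finset.mul_sum, Finset.mul_sum]
  refine Finset.sum_congr rfl fun r _ => ?_
  rw [← mul_assoc, qPoch_mul_phiCoeff, mul_assoc]

/-- `G^j_i` acts on `|m⟩` by the scalar `gFun qc i j (qc ^ m)`. The truncated subtraction is
harmless, since the scalar vanishes when `m + j < i`. -/
lemma fockRep_gOp (i j m : ℕ) :
    fockRep (gOp j i) (ket m) = gFun qc i j (qc ^ m) • ket (m + j - i) := by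
  unfold gOp
  split_ifs with h
  · obtain ⟨d, rfl⟩ := Nat.exists_eq_add_of_le h
    rw [map_smul, LinearMap.smul_apply, map_mul, map_pow, Module.End.mul_apply, fockRep_gen,
      Nat.add_sub_cancel_left, fockAct_am_pow, map_smul, fockRep_phiOp, smul_smul, smul_smul,
      show m + j - (j + d) = m - d by omega]
    rcases le_or_gt d m with hd | hd
    · congr 1
      rw [mul_right_comm, add_comm (j + d) j, qPoch_mul_sum_phiCoeff, gFun, gFun,
        pow_sub₀ _ qc_ne_zero hd, Nat.cast_add, hFun_transpose isGenericParam_qc j d (qc ^ m),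
        mul_comm (qc ^ m), gNorm, gNorm]
      ring
    · have : ∏ t ∈ Finset.range d, (1 - (qc ^ t)⁻¹ * qc ^ m) = 0 :=
        Finset.prod_eq_zero (Finset.mem_range.2 hd)
          (by rw [inv_mul_cancel₀ (pow_ne_zero _ qc_ne_zero), sub_self])
      rw [this, mul_zero, zero_mul, zero_smul, gFun, Nat.cast_add,
        hFun_transpose isGenericParam_qc j d (qc ^ m), this, mul_zero, mul_zero, zero_smul]
  · rw [map_smul, LinearMap.smul_apply, map_mul, map_pow, Module.End.mul_apply, fockRep_gen,
      fockRep_phiOp, map_smul, fockAct_ap_pow, smul_smul, qPoch_mul_sum_phiCoeff,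
      show m + (j - i) = m + j - i by omega]

lemma gFun_of_neg {F : Type*} [Field F] (q : F) {i j : ℤ} (h : i < 0 ∨ j < 0) (x : F) :
    gFun q i j x = 0 := by
  rw [gFun, hFun_of_neg q h, mul_zero]

/-- The scalar of `G^j_i` on `|m⟩` vanishes when the target state has negative occupation. -/
lemma gFun_eq_zero {F : Type*} [Field F] {q : F} (hq : IsGenericParam q) {i j m : ℤ} (hm : 0 ≤ m)
    (h : m + j - i < 0) : gFun q i j (q ^ m) = 0 := by
  rcases lt_or_ge j 0 with hj | hj
  · exact gFun_of_neg q (Or.inr hj) _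
  · lift j to ℕ using hj
    lift m to ℕ using hm
    obtain ⟨d, hd⟩ : ∃ d : ℕ, i = j + d := ⟨(i - j).toNat, by omega⟩
    have : ∏ t ∈ Finset.range d, (1 - (q ^ t)⁻¹ * q ^ m) = 0 :=
      Finset.prod_eq_zero (Finset.mem_range.2 (show m < d by omega))
        (by rw [inv_mul_cancel₀ (pow_ne_zero _ hq.ne_zero), sub_self])
    rw [hd, gFun, zpow_natCast, hFun_transpose hq j d (q ^ m), this, mul_zero, mul_zero]

/-! ### The exchange relation for adjacent sites -/

section Exchange

variable {F : Type*} [Field F]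

/-- The five-term relation which expresses, for a pair of neighbouring sites with lower indices
`i₁, i₂` and upper indices `j₁, j₂`, that a family `T` of matrix elements intertwines a generator
`b_j`. -/
def ExchangeRel {M : Type*} [AddCommGroup M] [Module F M] (q : F) (T : ℤ → ℤ → ℤ → ℤ → M)
    (i₁ j₁ i₂ j₂ : ℤ) : Prop :=
  -((qInt q i₂ * q ^ (-j₁)) • T (i₁ + 1) j₁ (i₂ - 1) j₂) +
      (qInt q i₁ * q ^ (i₁ - i₂ + j₁)) • T (i₁ - 1) j₁ (i₂ + 1) j₂ +
      (q / (1 - q) * q ^ (i₁ - i₂)) • T i₁ j₁ i₂ j₂ =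
    (qInt q j₂ * q ^ (-j₁ + j₂ + i₂)) • T i₁ (j₁ + 1) i₂ (j₂ - 1) -
      (qInt q j₁ * q ^ (-i₂)) • T i₁ (j₁ - 1) i₂ (j₂ + 1) +
      (q / (1 - q) * q ^ (j₂ - j₁)) • T i₁ j₁ i₂ j₂

lemma ExchangeRel.congr {M : Type*} [AddCommGroup M] [Module F M] {q : F}
    {T T' : ℤ → ℤ → ℤ → ℤ → M} {i₁ j₁ i₂ j₂ : ℤ} (h : ExchangeRel q T i₁ j₁ i₂ j₂)
    (hT : ∀ i₁' j₁' i₂' j₂', j₁' + j₂' - i₁' - i₂' = j₁ + j₂ - i₁ - i₂ →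
      T' i₁' j₁' i₂' j₂' = T i₁' j₁' i₂' j₂') : ExchangeRel q T' i₁ j₁ i₂ j₂ := by
  unfold ExchangeRel at *
  rw [hT _ _ _ _ rfl, hT (i₁ + 1) j₁ (i₂ - 1) j₂ (by ring), hT (i₁ - 1) j₁ (i₂ + 1) j₂ (by ring),
    hT i₁ (j₁ + 1) i₂ (j₂ - 1) (by ring), hT i₁ (j₁ - 1) i₂ (j₂ + 1) (by ring), h]

lemma gFun_add_one_left (q : F) {i : ℤ} (hi : 0 ≤ i) (j : ℤ) (x : F) :
    gFun q (i + 1) j x = gNorm q i j * ((1 - (q * q ^ i) ^ 2) * hFun q (i + 1) j x) := by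
  lift i to ℕ using hi
  rw [gFun, gNorm, gNorm, show ((i : ℤ) + 1).toNat = i + 1 by omega, qPoch_succ, Int.toNat_natCast,
    zpow_natCast]
  ring

lemma gFun_add_one_right (q : F) (i : ℤ) {j : ℤ} (hj : 0 ≤ j) (x : F) :
    gFun q i (j + 1) x = gNorm q i j * ((1 - (q * q ^ j) ^ 2) * hFun q i (j + 1) x) := by
  lift j to ℕ using hj
  rw [gFun, gNorm, gNorm, show ((j : ℤ) + 1).toNat = j + 1 by omega, qPoch_succ, Int.toNat_natCast,
    zpow_natCast]
  ring

lemma gFun_sub_one_left (q : F) {i : ℤ} (hi : 0 ≤ i) (j : ℤ) (x : F) :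
    (1 - (q ^ i) ^ 2) * gFun q (i - 1) j x = gNorm q i j * hFun q (i - 1) j x := by
  lift i to ℕ using hi
  rcases i with _ | i
  · rw [gFun_of_neg q (by simp), hFun_of_neg q (by simp)]
    simp
  · rw [gFun, gNorm, gNorm, show ((i + 1 : ℕ) - 1 : ℤ).toNat = i by omega, Int.toNat_natCast,
      qPoch_succ, zpow_natCast]
    ring

lemma gFun_sub_one_right (q : F) (i : ℤ) {j : ℤ} (hj : 0 ≤ j) (x : F) :
    (1 - (q ^ j) ^ 2) * gFun q i (j - 1) x = gNorm q i j * hFun q i (j - 1) x := by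
  lift j to ℕ using hj
  rcases j with _ | j
  · rw [gFun_of_neg q (by simp), hFun_of_neg q (by simp)]
    simp
  · rw [gFun, gNorm, gNorm, show ((j + 1 : ℕ) - 1 : ℤ).toNat = j by omega, Int.toNat_natCast,
      qPoch_succ, zpow_natCast]
    ring

/-- Products of two neighbouring matrix elements satisfy the exchange relation. -/
lemma exchangeRel_gFun {q : F} (hq : IsGenericParam q) {i₁ j₁ i₂ j₂ : ℤ} (hi₁ : 0 ≤ i₁)
    (hj₁ : 0 ≤ j₁) (hi₂ : 0 ≤ i₂) (hj₂ : 0 ≤ j₂) (x R : F) :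
    ExchangeRel q (fun i₁ j₁ i₂ j₂ => gFun q i₁ j₁ (q ^ (j₂ - i₂) * x) * gFun q i₂ j₂ x * R)
      i₁ j₁ i₂ j₂ := by
  have h0 := hq.ne_zero
  have h := hFun_exchange hq i₁ j₁ i₂ j₂ x (q ^ (j₂ - i₂) * x) (by rw [zpow_sub₀ h0])
  have a1 : q ^ (j₂ - (i₂ - 1)) * x = q * (q ^ (j₂ - i₂) * x) := by
    rw [show j₂ - (i₂ - 1) = j₂ - i₂ + 1 by ring, zpow_add_one₀ h0]; ring
  have a2 : q ^ (j₂ - (i₂ + 1)) * x = q⁻¹ * (q ^ (j₂ - i₂) * x) := by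
    rw [show j₂ - (i₂ + 1) = j₂ - i₂ - 1 by ring, zpow_sub_one₀ h0]; ring
  have a3 : q ^ (j₂ - 1 - i₂) * x = q⁻¹ * (q ^ (j₂ - i₂) * x) := by
    rw [show j₂ - 1 - i₂ = j₂ - i₂ - 1 by ring, zpow_sub_one₀ h0]; ring
  have a4 : q ^ (j₂ + 1 - i₂) * x = q * (q ^ (j₂ - i₂) * x) := by
    rw [show j₂ + 1 - i₂ = j₂ - i₂ + 1 by ring, zpow_add_one₀ h0]; ring
  unfold ExchangeRel
  simp only [a1, a2, a3, a4, smul_eq_mul]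
  generalize q ^ (j₂ - i₂) * x = y at *
  have b1 := gFun_sub_one_left q hi₂ j₂ x
  have b2 := gFun_sub_one_right q i₂ hj₂ x
  have b3 := gFun_sub_one_left q hi₁ j₁ (q⁻¹ * y)
  have b4 := gFun_sub_one_right q i₁ hj₁ (q * y)
  rw [gFun_add_one_left q hi₁, gFun_add_one_left q hi₂, gFun_add_one_right q _ hj₁,
    gFun_add_one_right q _ hj₂,
    show gFun q i₁ j₁ y = gNorm q i₁ j₁ * hFun q i₁ j₁ y from rfl,
    show gFun q i₂ j₂ x = gNorm q i₂ j₂ * hFun q i₂ j₂ x from rfl]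
  have hI : ∀ u : ℤ, qInt q u = q * ((q ^ u) ^ 2 - 1) / (q ^ u * (q ^ 2 - 1)) := by
    intro u
    have := zpow_ne_zero u h0
    have h2 : q ^ 2 - 1 ≠ 0 := by
      rw [sub_ne_zero]; exact_mod_cast hq.zpow_ne_one 2 (by norm_num)
    have h3 : q - q⁻¹ ≠ 0 := by
      intro h; apply h2; field_simp at h; linear_combination h
    rw [qInt, zpow_neg]
    field_simp
  have h2 : q ^ 2 - 1 ≠ 0 := by
    rw [sub_ne_zero]; exact_mod_cast hq.zpow_ne_one 2 (by norm_num)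
  have h3 : 1 - q ≠ 0 := by
    rw [sub_ne_zero, ne_comm]; simpa using hq.zpow_ne_one 1 (by norm_num)
  have e1 : q ^ (i₁ - i₂ + j₁) = q ^ i₁ / q ^ i₂ * q ^ j₁ := by rw [zpow_add₀ h0, zpow_sub₀ h0]
  have e2 : q ^ (-j₁ + j₂ + i₂) = (q ^ j₁)⁻¹ * q ^ j₂ * q ^ i₂ := by
    rw [zpow_add₀ h0, zpow_add₀ h0, zpow_neg]
  simp only [hI, e1, e2, zpow_neg, zpow_sub₀ h0]
  rw [zpow_add₀ h0, zpow_add₀ h0] at h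
  have u1 := zpow_ne_zero i₁ h0
  have u2 := zpow_ne_zero i₂ h0
  have v1 := zpow_ne_zero j₁ h0
  have v2 := zpow_ne_zero j₂ h0
  generalize q ^ i₁ = U₁ at *
  generalize q ^ i₂ = U₂ at *
  generalize q ^ j₁ = V₁ at *
  generalize q ^ j₂ = V₂ at *
  clear hI e1 e2 a1 a2 a3 a4
  generalize gNorm q i₁ j₁ = N₁ at *
  generalize gNorm q i₂ j₂ = N₂ at *
  generalize gFun q (i₂ - 1) j₂ x = g1 at *
  generalize gFun q i₂ (j₂ - 1) x = g2 at *
  generalize gFun q (i₁ - 1) j₁ (q⁻¹ * y) = g3 at *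
  generalize gFun q i₁ (j₁ - 1) (q * y) = g4 at *
  generalize hFun q (i₂ - 1) j₂ x = k1 at *
  generalize hFun q i₂ (j₂ - 1) x = k2 at *
  generalize hFun q (i₁ - 1) j₁ (q⁻¹ * y) = k3 at *
  generalize hFun q i₁ (j₁ - 1) (q * y) = k4 at *
  generalize hFun q (i₁ + 1) j₁ (q * y) = k5 at *
  generalize hFun q i₁ (j₁ + 1) (q⁻¹ * y) = k6 at *
  generalize hFun q (i₂ + 1) j₂ x = k7 at *
  generalize hFun q i₂ (j₂ + 1) x = k8 at *
  generalize hFun q i₁ j₁ y = k9 at *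
  generalize hFun q i₂ j₂ x = k10 at *
  -- `b1`, …, `b4` trade the lowered factors `gFun` for `hFun`, after which `h` applies.
  linear_combination (norm := (field_simp; ring))
    q / ((q ^ 2 - 1) * U₂ * V₁) * R * (N₁ * N₂ * h + N₁ * (1 - (q * U₁) ^ 2) * k5 * b1 +
      U₂ ^ 2 * N₁ * (1 - (q * V₁) ^ 2) * k6 * b2 - V₁ ^ 2 * N₂ * (1 - (q * U₂) ^ 2) * k7 * b3 -
      N₂ * (1 - (q * V₂) ^ 2) * k8 * b4)

end Exchange

/-! ### Chains of operators -/

noncomputable section Chains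

open Polynomial

variable {F : Type*} [Field F]

/-- `gFun q i j` as a polynomial. -/
def gPoly (q : F) (i j : ℤ) : F[X] :=
  C (gNorm q i j) * ∑ r ∈ Finset.range (i.toNat + 1), C (hCoeff q i j r) * X ^ r

lemma eval_gPoly (q : F) (i j : ℤ) (x : F) : (gPoly q i j).eval x = gFun q i j x := by
  simp [gPoly, gFun, hFun, eval_finsetSum]

/-- The total charge `∑_{i ≤ p} (c_i - a_i)` of the sites `1, …, p`. -/
def charge (a c : ℕ → ℤ) (p : ℕ) : ℤ := ∑ i ∈ Finset.Icc 1 p, (c i - a i)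

/-- The diagonal matrix element of `G^{c_1}_{a_1} ⋯ G^{c_n}_{a_n}` at `|m⟩` as a polynomial in
`q ^ m`: the factor at site `p` acts on a state whose occupation is `m` minus the charge of the
sites `1, …, p`. -/
def chainPoly (q : F) (n : ℕ) (a c : ℕ → ℤ) : F[X] :=
  ∏ p ∈ Finset.Icc 1 n, (gPoly q (a p) (c p)).comp (C (q ^ (-charge a c p)) * X)

lemma eval_chainPoly (q : F) (n : ℕ) (a c : ℕ → ℤ) (x : F) : (chainPoly q n a c).eval x =
    ∏ p ∈ Finset.Icc 1 n, gFun q (a p) (c p) (q ^ (-charge a c p) * x) := by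
  simp [chainPoly, eval_prod, eval_comp, eval_gPoly]

/-- The array `a` with the entries at `p` and `p'` replaced by `i` and `i'`. -/
def update₂ (a : ℕ → ℤ) (p p' : ℕ) (i i' : ℤ) : ℕ → ℤ :=
  Function.update (Function.update a p i) p' i'

lemma update₂_apply (a : ℕ → ℤ) {p p' : ℕ} (h : p ≠ p') (i i' : ℤ) (k : ℕ) :
    update₂ a p p' i i' k =
      a k + (if k = p then i - a p else 0) + (if k = p' then i' - a p' else 0) := by
  unfold update₂
  rcases eq_or_ne k p' with rfl | hk'
  · simp [h.symm]
  · rcases eq_or_ne k p with rfl | hk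
    · simp [h]
    · simp [hk, hk']

lemma charge_update₂ (a c : ℕ → ℤ) {p p' : ℕ} (h : p ≠ p') (hp : 1 ≤ p) (hp' : 1 ≤ p')
    (i j i' j' : ℤ) (k : ℕ) :
    charge (update₂ a p p' i i') (update₂ c p p' j j') k = charge a c k +
      (if p ≤ k then j - i - (c p - a p) else 0) +
      (if p' ≤ k then j' - i' - (c p' - a p') else 0) := by
  simp only [charge, update₂_apply _ h, Finset.sum_sub_distrib, Finset.sum_add_distrib,
    Finset.sum_ite_eq', Finset.mem_Icc, hp, hp', true_and]
  split_ifs <;> ring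

lemma exchangeRel_of_eval [Infinite F] {q : F} {T : ℤ → ℤ → ℤ → ℤ → F[X]} {i₁ j₁ i₂ j₂ : ℤ}
    (h : ∀ x, ExchangeRel q (fun i₁ j₁ i₂ j₂ => (T i₁ j₁ i₂ j₂).eval x) i₁ j₁ i₂ j₂) :
    ExchangeRel q T i₁ j₁ i₂ j₂ := by
  refine Polynomial.funext fun x => ?_
  simpa [ExchangeRel, eval_smul] using h x

/-- The exchange relation at the sites `p` and `p + 1` of a chain: the charges of all other sites do
not change. -/
lemma exchangeRel_chainPoly [Infinite F] {q : F} (hq : IsGenericParam q) {n p : ℕ} (hp : 1 ≤ p)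
    (hpn : p + 1 ≤ n) {a c : ℕ → ℤ} (ha : ∀ i, 0 ≤ a i) (hc : ∀ i, 0 ≤ c i) :
    ExchangeRel q (fun i₁ j₁ i₂ j₂ => chainPoly q n (update₂ a p (p + 1) i₁ i₂)
      (update₂ c p (p + 1) j₁ j₂)) (a p) (c p) (a (p + 1)) (c (p + 1)) := by
  refine exchangeRel_of_eval fun x => ?_
  refine (exchangeRel_gFun hq (ha p) (hc p) (ha (p + 1)) (hc (p + 1))
    (q ^ (-charge a c (p + 1)) * x) (∏ k ∈ ((Finset.Icc 1 n).erase p).erase (p + 1),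
      gFun q (a k) (c k) (q ^ (-charge a c k) * x))).congr fun i₁ j₁ i₂ j₂ hs => ?_
  have hne : p ≠ p + 1 := by omega
  rw [eval_chainPoly, ← Finset.mul_prod_erase _ _ (show p ∈ Finset.Icc 1 n by
    rw [Finset.mem_Icc]; omega), ← Finset.mul_prod_erase _ _
    (show p + 1 ∈ (Finset.Icc 1 n).erase p by rw [Finset.mem_erase, Finset.mem_Icc]; omega),
    ← mul_assoc]
  have c1 : charge (update₂ a p (p + 1) i₁ i₂) (update₂ c p (p + 1) j₁ j₂) (p + 1) =
      charge a c (p + 1) := by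
    rw [charge_update₂ a c hne hp (by omega), if_pos (by omega), if_pos le_rfl]
    linarith
  have c2 : charge (update₂ a p (p + 1) i₁ i₂) (update₂ c p (p + 1) j₁ j₂) p =
      charge a c (p + 1) - (j₂ - i₂) := by
    rw [charge_update₂ a c hne hp (by omega), if_pos le_rfl, if_neg (by omega), charge, charge,
      Finset.sum_Icc_succ_top (by omega)]
    linarith
  congr 1
  · rw [c1, c2]
    simp only [update₂_apply _ hne, hne, hne.symm, if_true, if_false]
    congr 2
    · ring
    · ring
    · rw [neg_sub, sub_eq_add_neg, zpow_add₀ hq.ne_zero, mul_assoc]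
    · ring
    · ring
  · refine Finset.prod_congr rfl fun k hk => ?_
    simp only [Finset.mem_erase, Finset.mem_Icc] at hk
    have c3 : charge (update₂ a p (p + 1) i₁ i₂) (update₂ c p (p + 1) j₁ j₂) k =
        charge a c k := by
      rw [charge_update₂ a c hne hp (by omega)]
      rcases lt_or_gt_of_ne hk.2.1 with h | h
      · rw [if_neg (by omega), if_neg (by omega)]; ring
      · rw [if_pos (by omega), if_pos (by omega)]; linarith
    rw [c3, update₂_apply _ hne, update₂_apply _ hne, if_neg hk.2.1, if_neg hk.1, if_neg hk.2.1,
      if_neg hk.1, add_zero, add_zero, add_zero, add_zero]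

/-- The exchange relation at the sites `n` and `1`, for a chain of total charge `0`. The occupation
is measured on the bond between the sites `1` and `2`, hence the composition. -/
lemma exchangeRel_chainPoly_wrap [Infinite F] {q : F} (hq : IsGenericParam q) {n : ℕ} (hn : 2 ≤ n)
    {a c : ℕ → ℤ} (ha : ∀ i, 0 ≤ a i) (hc : ∀ i, 0 ≤ c i) (h0 : charge a c n = 0) :
    ExchangeRel q (fun i₁ j₁ i₂ j₂ => (chainPoly q n (update₂ a n 1 i₁ i₂)
      (update₂ c n 1 j₁ j₂)).comp (C (q ^ (j₂ - i₂)) * X)) (a n) (c n) (a 1) (c 1) := by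
  refine exchangeRel_of_eval fun x => ?_
  refine (exchangeRel_gFun hq (ha n) (hc n) (ha 1) (hc 1) x
    (∏ k ∈ ((Finset.Icc 1 n).erase n).erase 1,
      gFun q (a k) (c k) (q ^ (-charge a c k + (c 1 - a 1)) * x))).congr fun i₁ j₁ i₂ j₂ hs => ?_
  have hne : n ≠ 1 := by omega
  have h1 : charge a c 1 = c 1 - a 1 := by simp [charge]
  rw [eval_comp, eval_chainPoly, ← Finset.mul_prod_erase _ _ (show n ∈ Finset.Icc 1 n by
    rw [Finset.mem_Icc]; omega), ← Finset.mul_prod_erase _ _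
    (show 1 ∈ (Finset.Icc 1 n).erase n by rw [Finset.mem_erase, Finset.mem_Icc]; omega),
    ← mul_assoc]
  have c1 : charge (update₂ a n 1 i₁ i₂) (update₂ c n 1 j₁ j₂) n = 0 := by
    rw [charge_update₂ a c hne (by omega) le_rfl, if_pos le_rfl, if_pos (by omega), h0]
    linarith
  have c2 : charge (update₂ a n 1 i₁ i₂) (update₂ c n 1 j₁ j₂) 1 = j₂ - i₂ := by
    rw [charge_update₂ a c hne (by omega) le_rfl, if_neg (by omega), if_pos le_rfl, h1]
    ring
  simp only [eval_mul, eval_C, eval_X]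
  congr 1
  · rw [c1, c2]
    simp only [update₂_apply _ hne, hne, hne.symm, if_true, if_false]
    congr 2
    · ring
    · ring
    · simp
    · ring
    · ring
    · rw [← mul_assoc, ← zpow_add₀ hq.ne_zero]; simp
  · refine Finset.prod_congr rfl fun k hk => ?_
    simp only [Finset.mem_erase, Finset.mem_Icc] at hk
    have c3 : charge (update₂ a n 1 i₁ i₂) (update₂ c n 1 j₁ j₂) k =
        charge a c k + (j₂ - i₂ - (c 1 - a 1)) := by
      rw [charge_update₂ a c hne (by omega) le_rfl, if_neg (by omega), if_pos (by omega)]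
      ring
    rw [c3, update₂_apply _ hne, update₂_apply _ hne, if_neg hk.2.1, if_neg hk.1, if_neg hk.2.1,
      if_neg hk.1, add_zero, add_zero, add_zero, add_zero, ← mul_assoc, ← zpow_add₀ hq.ne_zero]
    congr 3
    ring

end Chains

/-! ### The trace -/

noncomputable section Trace

open Polynomial

instance : Infinite Cq := inferInstanceAs (Infinite (RatFunc ℂ))

lemma zz_ne_algebraMap (c : Cq) : (zz : Cqz) ≠ algebraMap Cq Cqz c := by
  intro h
  have h1 : (RatFunc.X : RatFunc Cq) = RatFunc.C c := h
  have h2 := congrArg RatFunc.intDegree h1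
  rw [RatFunc.intDegree_X, RatFunc.intDegree_C] at h2
  exact one_ne_zero h2

/-- The fugacity `w = (q^l z)⁻¹` of the trace. -/
def fugacity (l : ℕ) : Cqz := (qz ^ l * (zz : Cqz))⁻¹

lemma fugacity_ne_zero (l : ℕ) : fugacity l ≠ 0 :=
  inv_ne_zero (mul_ne_zero (pow_ne_zero _ qz_ne_zero) zz.ne_zero)

lemma fugacity_ne (l : ℕ) (k : ℕ) : 1 - fugacity l * qz ^ k ≠ 0 := by
  intro h
  have h0 := qz_ne_zero
  have h1 := zz.ne_zero
  apply zz_ne_algebraMap (qc ^ k * (qc ^ l)⁻¹)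
  rw [map_mul, map_inv₀, map_pow, map_pow, ← qz]
  rw [fugacity] at h
  field_simp at h ⊢
  linear_combination h

/-- The trace `∑_{m ≥ 0} w^m P(q^m)`, summed as geometric series: `x ^ k ↦ 1 / (1 - w q^k)`. -/
def qTrace (l : ℕ) : Cq[X] →ₗ[Cq] Cqz :=
  Polynomial.lsum fun k => LinearMap.toSpanSingleton Cq Cqz (1 - fugacity l * qz ^ k)⁻¹

lemma qTrace_monomial (l k : ℕ) (c : Cq) :
    qTrace l (monomial k c) = c • (1 - fugacity l * qz ^ k)⁻¹ := by
  simp [qTrace, Polynomial.lsum_apply, sum_monomial_index]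

lemma comp_C_mul_X_monomial (k : ℕ) (a c : Cq) :
    (monomial k c).comp (C a * X) = monomial k (c * a ^ k) := by
  rw [monomial_comp, mul_pow, ← C_pow, ← mul_assoc, ← C_mul, C_mul_X_pow_eq_monomial]

/-- Splitting off the term `m = 0` of the trace. -/
lemma qTrace_eq (l : ℕ) (P : Cq[X]) : qTrace l P =
    algebraMap Cq Cqz (P.eval 1) + fugacity l * qTrace l (P.comp (C qc * X)) := by
  induction P using Polynomial.induction_on' with
  | add P Q hP hQ => rw [map_add, hP, hQ, add_comp, eval_add, map_add, map_add]; ring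
  | monomial k c =>
    have h := fugacity_ne l k
    rw [comp_C_mul_X_monomial, qTrace_monomial, qTrace_monomial, Algebra.smul_def,
      Algebra.smul_def, map_mul, map_pow, ← qz, eval_monomial, one_pow, mul_one]
    field_simp
    ring

lemma qTrace_eq_sum (l : ℕ) (P : Cq[X]) (N : ℕ) : qTrace l P =
    ∑ m ∈ Finset.range N, fugacity l ^ m * algebraMap Cq Cqz (P.eval (qc ^ m)) +
      fugacity l ^ N * qTrace l (P.comp (C (qc ^ N) * X)) := by
  induction N with
  | zero => simp
  | succ N ih =>
    rw [ih, qTrace_eq l (P.comp _), Finset.sum_range_succ, eval_comp, comp_assoc]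
    simp only [eval_mul, eval_C, eval_X, mul_one, mul_comp, C_comp, X_comp]
    rw [← mul_assoc (C (qc ^ N)), ← C_mul, ← pow_succ]
    ring

/-- Shifting the summation variable of the trace by `d`, when the terms that are gained or lost
vanish. -/
lemma qTrace_shift (l : ℕ) (P : Cq[X]) (d : ℤ)
    (h₁ : ∀ m : ℤ, 0 ≤ m → m < d → P.eval (qc ^ m) = 0)
    (h₂ : ∀ m : ℤ, m < 0 → d ≤ m → P.eval (qc ^ m) = 0) :
    qTrace l P = fugacity l ^ d * qTrace l (P.comp (C (qc ^ d) * X)) := by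
  rcases le_total 0 d with hd | hd
  · lift d to ℕ using hd
    rw [qTrace_eq_sum l P d, Finset.sum_eq_zero, zero_add]
    · simp
    · intro m hm
      have := h₁ m (by omega) (by simpa using hm)
      rw [zpow_natCast] at this
      rw [this, map_zero, mul_zero]
  · obtain ⟨e, rfl⟩ : ∃ e : ℕ, d = -e := ⟨(-d).toNat, by omega⟩
    have hc : (P.comp (C (qc ^ (-(e : ℤ))) * X)).comp (C (qc ^ e) * X) = P := by
      rw [comp_assoc]
      simp only [mul_comp, C_comp, X_comp]
      rw [← mul_assoc, ← C_mul, zpow_neg, zpow_natCast,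
        inv_mul_cancel₀ (pow_ne_zero _ qc_ne_zero), C_1, one_mul, comp_X]
    rw [qTrace_eq_sum l (P.comp (C (qc ^ (-(e : ℤ))) * X)) e, Finset.sum_eq_zero, zero_add, hc,
      zpow_neg, zpow_natCast, ← mul_assoc, inv_mul_cancel₀ (pow_ne_zero _ (fugacity_ne_zero l)),
      one_mul]
    intro m hm
    have h := h₂ (-(e : ℤ) + m) (by have := Finset.mem_range.1 hm; omega) (by omega)
    rw [zpow_add₀ qc_ne_zero, zpow_natCast qc m] at h
    rw [eval_comp, eval_mul, eval_C, eval_X, h, map_zero, mul_zero]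

lemma absInfty_mul (f g : Cqz) : absInfty (f * g) = absInfty f * absInfty g := by
  classical
  exact map_mul (RatFunc.inftyValuation Cq) f g

lemma absInfty_one : absInfty 1 = 1 := by
  classical
  exact map_one (RatFunc.inftyValuation Cq)

lemma absInfty_zero : absInfty 0 = 0 := by
  classical
  exact map_zero (RatFunc.inftyValuation Cq)

lemma absInfty_inv (f : Cqz) : absInfty f⁻¹ = (absInfty f)⁻¹ := by
  classical
  exact map_inv₀ (RatFunc.inftyValuation Cq) f

lemma absInfty_pow (f : Cqz) (n : ℕ) : absInfty (f ^ n) = absInfty f ^ n := by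
  induction n with
  | zero => rw [pow_zero, pow_zero, absInfty_one]
  | succ n ih => rw [pow_succ, pow_succ, absInfty_mul, ih]

lemma absInfty_neg (f : Cqz) : absInfty (-f) = absInfty f := by
  classical
  exact Valuation.map_neg (RatFunc.inftyValuation Cq) f

lemma absInfty_add_le (f g : Cqz) : absInfty (f + g) ≤ max (absInfty f) (absInfty g) := by
  classical
  exact Valuation.map_add (RatFunc.inftyValuation Cq) f g

lemma absInfty_algebraMap {c : Cq} (hc : c ≠ 0) : absInfty (algebraMap Cq Cqz c) = 1 := by
  classical
  exact RatFunc.inftyValuation.C Cq hc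

lemma absInfty_algebraMap_le (c : Cq) : absInfty (algebraMap Cq Cqz c) ≤ 1 := by
  rcases eq_or_ne c 0 with rfl | hc
  · rw [map_zero, absInfty_zero]; exact zero_le
  · exact (absInfty_algebraMap hc).le

lemma absInfty_fugacity_lt (l : ℕ) : absInfty (fugacity l) < 1 := by
  classical
  have h1 : absInfty (zz : Cqz) = WithZero.exp 1 := RatFunc.inftyValuation.X Cq
  rw [fugacity, absInfty_inv, absInfty_mul, h1, qz, ← map_pow,
    absInfty_algebraMap (pow_ne_zero _ qc_ne_zero), one_mul, ← WithZero.exp_neg,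
    ← WithZero.exp_zero]
  exact WithZero.exp_lt_exp.2 (by norm_num)

lemma absInfty_qTrace_le (l : ℕ) (P : Cq[X]) : absInfty (qTrace l P) ≤ 1 := by
  classical
  induction P using Polynomial.induction_on' with
  | add P Q hP hQ => rw [map_add]; exact (absInfty_add_le _ _).trans (max_le hP hQ)
  | monomial k c =>
    have h : absInfty (1 - fugacity l * qz ^ k) = 1 := by
      have h1 : absInfty (fugacity l * qz ^ k) < 1 := by
        rw [absInfty_mul, qz, ← map_pow, absInfty_algebraMap (pow_ne_zero _ qc_ne_zero), mul_one]
        exact absInfty_fugacity_lt l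
      exact Valuation.map_one_sub_of_lt (RatFunc.inftyValuation Cq) h1
    rw [qTrace_monomial, Algebra.smul_def, absInfty_mul, absInfty_inv, h, inv_one, mul_one]
    exact absInfty_algebraMap_le c

/-- The trace of an operator whose diagonal matrix elements are polynomial in `q ^ m`. -/
lemma hasTrace_qTrace (l : ℕ) (X : QBoson) (P : Cq[X])
    (h : ∀ m : ℕ, (fockRep X (ket m)) m = P.eval (qc ^ m)) :
    HasTrace (fugacity l) X (qTrace l P) := by
  intro ε hε
  obtain ⟨N₀, hN₀⟩ := exists_pow_lt₀ (absInfty_fugacity_lt l) (Units.mk0 ε hε.ne')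
  rw [Units.val_mk0] at hN₀
  filter_upwards [eventually_ge_atTop N₀] with N hN
  have e : ∑ m ∈ Finset.range N, fugacity l ^ m *
      algebraMap Cq Cqz (bra m (fockRep X (ket m)) / qPoch qc qc m) =
      ∑ m ∈ Finset.range N, fugacity l ^ m * algebraMap Cq Cqz (P.eval (qc ^ m)) := by
    refine Finset.sum_congr rfl fun m _ => ?_
    rw [bra, h, mul_div_cancel_left₀ _ (qPoch_ne_zero isGenericParam_qc m)]
  rw [e, qTrace_eq_sum l P N, sub_add_cancel_left, absInfty_neg, absInfty_mul, absInfty_pow]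
  calc absInfty (fugacity l) ^ N * absInfty (qTrace l (P.comp (C (qc ^ N) * Polynomial.X)))
      ≤ absInfty (fugacity l) ^ N * 1 := by gcongr; exact absInfty_qTrace_le l _
    _ = absInfty (fugacity l) ^ N := mul_one _
    _ ≤ absInfty (fugacity l) ^ N₀ := pow_le_pow_right_of_le_one' (absInfty_fugacity_lt l).le hN
    _ < ε := hN₀

end Trace

/-! ### The trace of the matrix product -/

section ChainTrace

open Polynomial

lemma gPoly_of_neg {F : Type*} [Field F] (q : F) {i j : ℤ} (h : i < 0 ∨ j < 0) :
    gPoly q i j = 0 := by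
  rw [gPoly, Finset.sum_eq_zero, mul_zero]
  intro r _
  rw [hCoeff_of_neg q (by omega), C_0, zero_mul]

lemma charge_succ (a c : ℕ → ℤ) (p : ℕ) :
    charge a c (p + 1) = charge a c p + (c (p + 1) - a (p + 1)) :=
  Finset.sum_Icc_succ_top (by omega) _

lemma charge_congr {n : ℕ} {a c a' c' : ℕ → ℤ} (ha : ∀ k ∈ Finset.Icc 1 n, a k = a' k)
    (hc : ∀ k ∈ Finset.Icc 1 n, c k = c' k) {p : ℕ} (hp : p ≤ n) :
    charge a c p = charge a' c' p :=
  Finset.sum_congr rfl fun k hk => by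
    have hk' : k ∈ Finset.Icc 1 n := Finset.Icc_subset_Icc_right hp hk
    rw [ha k hk', hc k hk']

lemma chainPoly_congr {F : Type*} [Field F] (q : F) {n : ℕ} {a c a' c' : ℕ → ℤ}
    (ha : ∀ k ∈ Finset.Icc 1 n, a k = a' k) (hc : ∀ k ∈ Finset.Icc 1 n, c k = c' k) :
    chainPoly q n a c = chainPoly q n a' c' :=
  Finset.prod_congr rfl fun k hk => by
    rw [ha k hk, hc k hk, charge_congr ha hc (Finset.mem_Icc.1 hk).2]

/-- The action of `G^{c_1}_{a_1} ⋯ G^{c_n}_{a_n}` on the Fock space. -/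
lemma fockRep_prod_gOp {a c : ℕ → ℤ} (ha : ∀ i, 0 ≤ a i) (hc : ∀ i, 0 ≤ c i) (n m : ℕ) :
    fockRep ((List.range n).map fun p : ℕ => gOp (c (p + 1)).toNat (a (p + 1)).toNat).prod
      (ket m) = (∏ p ∈ Finset.Icc 1 n, gFun qc (a p) (c p)
        (qc ^ (m + charge a c n - charge a c p))) • ket (m + charge a c n).toNat := by
  induction n generalizing m with
  | zero => simp [charge]
  | succ n ih =>
    rw [List.range_succ, List.map_append, List.prod_append, map_mul, Module.End.mul_apply]
    simp only [List.map_cons, List.map_nil, List.prod_cons, List.prod_nil, mul_one]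
    rw [fockRep_gOp, map_smul, Finset.prod_Icc_succ_top (by omega),
      Int.toNat_of_nonneg (ha _), Int.toNat_of_nonneg (hc _)]
    have e : (m : ℤ) + charge a c (n + 1) - charge a c (n + 1) = m := by ring
    rcases lt_or_ge ((m : ℤ) + c (n + 1) - a (n + 1)) 0 with h | h
    · have h0 := gFun_eq_zero isGenericParam_qc (Int.natCast_nonneg m) h
      rw [e, h0, mul_zero, zero_smul, ← zpow_natCast, h0, zero_smul]
    · have hm : ((m + (c (n + 1)).toNat - (a (n + 1)).toNat : ℕ) : ℤ) =
          m + (c (n + 1) - a (n + 1)) := by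
        have h1 := ha (n + 1)
        have h2 := hc (n + 1)
        omega
      rw [ih, smul_smul, hm, e, mul_comm, charge_succ, zpow_natCast]
      congr 2
      · refine Finset.prod_congr rfl fun p _ => ?_
        congr 2
        ring
      · congr 1
        ring

/-- The diagonal matrix elements of the matrix product. -/
lemma fockRep_gProd_apply {n : ℕ} {γ α : Arr n} (hα : ∀ i, 0 ≤ α i) (hγ : ∀ i, 0 ≤ γ i)
    (h : charge (fun i => α i) (fun i => γ i) n = 0) (m : ℕ) :
    (fockRep (gProd γ α) (ket m)) m =
      (chainPoly qc n (fun i => α i) (fun i => γ i)).eval (qc ^ m) := by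
  have key := fockRep_prod_gOp (a := fun i => α i) (c := fun i => γ i) (fun i => hα i)
    (fun i => hγ i) n m
  rw [gProd, key, h, eval_chainPoly]
  simp only [ket, add_zero, Int.toNat_natCast, Finsupp.smul_apply, Finsupp.single_eq_same,
    smul_eq_mul, mul_one]
  refine Finset.prod_congr rfl fun p _ => ?_
  rw [sub_eq_add_neg, add_comm, zpow_add₀ qc_ne_zero, zpow_natCast]

/-- The trace may be taken over the occupation of the bond between the first two sites instead:
a nonzero term has nonnegative occupation on every bond. -/
lemma qTrace_chainPoly_shift (l : ℕ) {n : ℕ} (hn : 1 ≤ n) (a c : ℕ → ℤ)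
    (h : charge a c n = 0) : qTrace l (chainPoly qc n a c) = fugacity l ^ (c 1 - a 1) *
      qTrace l ((chainPoly qc n a c).comp (C (qc ^ (c 1 - a 1)) * X)) := by
  have e1 : charge a c 1 = c 1 - a 1 := by simp [charge]
  have key : ∀ (m : ℤ) (p : ℕ), p + 1 ≤ n → 0 ≤ m - charge a c (p + 1) →
      m - charge a c p < 0 → (chainPoly qc n a c).eval (qc ^ m) = 0 := by
    intro m p hp h1 h2
    rw [eval_chainPoly]
    refine Finset.prod_eq_zero (i := p + 1) (by rw [Finset.mem_Icc]; omega) ?_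
    rw [← zpow_add₀ qc_ne_zero]
    refine gFun_eq_zero isGenericParam_qc (by omega) ?_
    rw [charge_succ] at *
    omega
  refine qTrace_shift l _ _ (fun m hm hmd => ?_) (fun m hm hmd => ?_)
  · classical
    -- The first bond whose occupation is nonnegative is preceded by one where it is negative.
    have hex : ∃ p, 0 ≤ m - charge a c (p + 1) := ⟨n - 1, by
      rw [Nat.sub_add_cancel hn, h, sub_zero]; exact hm⟩
    have hpos : 0 < Nat.find hex := by
      rw [Nat.find_pos, zero_add, e1]
      omega
    have hle : Nat.find hex ≤ n - 1 := Nat.find_min' hex (by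
      rw [Nat.sub_add_cancel hn, h, sub_zero]; exact hm)
    refine key m (Nat.find hex) (by omega) (Nat.find_spec hex) ?_
    have := Nat.find_min hex (show Nat.find hex - 1 < Nat.find hex by omega)
    rw [Nat.sub_add_cancel hpos] at this
    omega
  · refine key m 0 hn ?_ ?_
    · rw [zero_add, e1]; omega
    · simpa [charge] using hm

end ChainTrace

section Pairing

/-- The pairing `∑_{1 ≤ i < j ≤ n} c_i a_j` of arrays indexed by natural numbers. -/
def anglePairing (n : ℕ) (c a : ℕ → ℤ) : ℤ :=
  ∑ j ∈ Finset.Icc 1 n, ∑ i ∈ Finset.Ico 1 j, c i * a j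

lemma anglePairing_eq (n : ℕ) (c a : ℕ → ℤ) : anglePairing n c a =
    ∑ j ∈ Finset.Icc 1 n, ∑ i ∈ Finset.Icc 1 n, if i < j then c i * a j else 0 := by
  refine Finset.sum_congr rfl fun j hj => ?_
  rw [← Finset.sum_filter]
  refine Finset.sum_congr ?_ fun _ _ => rfl
  ext i
  simp only [Finset.mem_Ico, Finset.mem_filter, Finset.mem_Icc] at *
  omega

lemma anglePairing_congr {n : ℕ} {a c a' c' : ℕ → ℤ} (ha : ∀ k ∈ Finset.Icc 1 n, a k = a' k)
    (hc : ∀ k ∈ Finset.Icc 1 n, c k = c' k) : anglePairing n c a = anglePairing n c' a' := by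
  rw [anglePairing_eq, anglePairing_eq]
  exact Finset.sum_congr rfl fun j hj => Finset.sum_congr rfl fun i hi => by rw [ha j hj, hc i hi]

lemma anglePairing_update₂_right {n p p' : ℕ} (h : p ≠ p') (hp : p ∈ Finset.Icc 1 n)
    (hp' : p' ∈ Finset.Icc 1 n) (c a : ℕ → ℤ) (s : ℤ) :
    anglePairing n c (update₂ a p p' (a p + s) (a p' - s)) = anglePairing n c a +
      s * (∑ i ∈ Finset.Ico 1 p, c i - ∑ i ∈ Finset.Ico 1 p', c i) := by
  simp only [anglePairing, update₂_apply a h, mul_add, Finset.sum_add_distrib, mul_ite, mul_zero]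
  rw [Finset.sum_congr rfl fun j (_ : j ∈ Finset.Icc 1 n) => Finset.sum_ite_irrel (j = p)
    (Finset.Ico 1 j) (fun i => c i * (a p + s - a p)) (fun _ => 0), Finset.sum_congr rfl
    fun j (_ : j ∈ Finset.Icc 1 n) => Finset.sum_ite_irrel (j = p')
    (Finset.Ico 1 j) (fun i => c i * (a p' - s - a p')) (fun _ => 0)]
  simp only [Finset.sum_const_zero, Finset.sum_ite_eq', hp, hp', if_true]
  rw [← Finset.sum_mul, ← Finset.sum_mul]
  ring

lemma anglePairing_update₂_left {n p p' : ℕ} (h : p ≠ p') (hp : p ∈ Finset.Icc 1 n)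
    (hp' : p' ∈ Finset.Icc 1 n) (c a : ℕ → ℤ) (s : ℤ) :
    anglePairing n (update₂ c p p' (c p + s) (c p' - s)) a = anglePairing n c a +
      s * (∑ j ∈ Finset.Ioc p n, a j - ∑ j ∈ Finset.Ioc p' n, a j) := by
  have key : ∀ p ∈ Finset.Icc 1 n, ∑ j ∈ Finset.Ioc p n, a j =
      ∑ j ∈ Finset.Icc 1 n, if p < j then a j else 0 := by
    intro p hp
    rw [← Finset.sum_filter]
    refine Finset.sum_congr ?_ fun _ _ => rfl
    ext i
    simp only [Finset.mem_Ioc, Finset.mem_filter, Finset.mem_Icc] at *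
    omega
  rw [anglePairing_eq, anglePairing_eq, key p hp, key p' hp', ← Finset.sum_sub_distrib,
    Finset.mul_sum, ← Finset.sum_add_distrib]
  refine Finset.sum_congr rfl fun j _ => ?_
  have e : ∀ i, (if i < j then update₂ c p p' (c p + s) (c p' - s) i * a j else 0) =
      (if i < j then c i * a j else 0) + (if i = p then (if p < j then s * a j else 0) else 0) +
      (if i = p' then (if p' < j then -s * a j else 0) else 0) := by
    intro i
    rw [update₂_apply c h]
    rcases eq_or_ne i p with rfl | h1
    · simp only [h, if_true, if_false, add_zero]
      split_ifs <;> ring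
    · rcases eq_or_ne i p' with rfl | h2
      · simp only [h1, if_true, if_false, add_zero]
        split_ifs <;> ring
      · simp only [h1, h2, if_false, add_zero]
  rw [Finset.sum_congr rfl fun i _ => e i, Finset.sum_add_distrib, Finset.sum_add_distrib,
    Finset.sum_ite_eq', Finset.sum_ite_eq', if_pos hp, if_pos hp']
  split_ifs <;> ring

end Pairing

/-! ### The trace formula solves the intertwining equations -/

section Entries

lemma algebraMap_qc : algebraMap Cq Cqz qc = qz := rfl

/-- The equation obtained by comparing the coefficients of `v*_γ` in `K b_j v_α = b_j K v_α`. -/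
def IntertwiningEq {n : ℕ} (K : Arr n → Arr n → Cqz) (j : ZMod n) (γ α : Arr n) : Prop :=
  -(spec zz j * qInt qz (α (j + 1)) * K γ (α + unitArr j - unitArr (j + 1))) +
      (spec zz j)⁻¹ * qInt qz (α j) * qz ^ (α j - α (j + 1)) *
        K γ (α - unitArr j + unitArr (j + 1)) +
      qz / (1 - qz) * qz ^ (α j - α (j + 1)) * K γ α =
    (spec zz j)⁻¹ * qInt qz (γ (j + 1)) * qz ^ (γ (j + 1) - γ j) *
        K (γ + unitArr j - unitArr (j + 1)) α -
      spec zz j * qInt qz (γ j) * K (γ - unitArr j + unitArr (j + 1)) α +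
      qz / (1 - qz) * qz ^ (γ (j + 1) - γ j) * K γ α

/-- The five-term relation gives an intertwining equation once the powers of `q` and `z` in the
four neighbouring matrix elements are accounted for. -/
lemma intertwiningEq_of_exchangeRel {n : ℕ} {K : Arr n → Arr n → Cqz} {j : ZMod n} {γ α : Arr n}
    {T : ℤ → ℤ → ℤ → ℤ → Cqz} (B : Cqz)
    (rel : ExchangeRel qc T (α j) (γ j) (α (j + 1)) (γ (j + 1)))
    (h₀ : K γ α = B * T (α j) (γ j) (α (j + 1)) (γ (j + 1)))
    (h₁ : spec zz j * K γ (α + unitArr j - unitArr (j + 1)) =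
      B * qz ^ (-γ j) * T (α j + 1) (γ j) (α (j + 1) - 1) (γ (j + 1)))
    (h₂ : (spec zz j)⁻¹ * K γ (α - unitArr j + unitArr (j + 1)) =
      B * qz ^ γ j * T (α j - 1) (γ j) (α (j + 1) + 1) (γ (j + 1)))
    (h₃ : (spec zz j)⁻¹ * K (γ + unitArr j - unitArr (j + 1)) α =
      B * qz ^ α (j + 1) * T (α j) (γ j + 1) (α (j + 1)) (γ (j + 1) - 1))
    (h₄ : spec zz j * K (γ - unitArr j + unitArr (j + 1)) α =
      B * qz ^ (-α (j + 1)) * T (α j) (γ j - 1) (α (j + 1)) (γ (j + 1) + 1)) :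
    IntertwiningEq K j γ α := by
  have h0 := qz_ne_zero
  unfold ExchangeRel at rel
  simp only [Algebra.smul_def, map_mul, map_div₀, map_sub, map_one, map_zpow₀, map_qInt,
    algebraMap_qc] at rel
  rw [zpow_add₀ h0 (α j - α (j + 1)), zpow_add₀ h0, add_comm (-γ j), ← sub_eq_add_neg] at rel
  unfold IntertwiningEq
  linear_combination B * rel - qInt qz (α (j + 1)) * h₁ +
    qInt qz (α j) * qz ^ (α j - α (j + 1)) * h₂ -
    qInt qz (γ (j + 1)) * qz ^ (γ (j + 1) - γ j) * h₃ +
    qInt qz (γ j) * h₄ + qz / (1 - qz) * qz ^ (α j - α (j + 1)) * h₀ -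
    qz / (1 - qz) * qz ^ (γ (j + 1) - γ j) * h₀

/-- The scalar `(q^{-l} z^{-1}; q)_{l+1} / ((q²;q²)_l (-q z^{-1}; q)_l)`. -/
noncomputable def kConst (l : ℕ) : Cqz :=
  qPoch (qz ^ (-(l : ℤ)) * (zz : Cqz)⁻¹) qz (l + 1) /
    (qPoch (qz ^ 2) (qz ^ 2) l * qPoch (-qz * (zz : Cqz)⁻¹) qz l)

/-- The matrix elements of the trace formula, for arbitrary integer arrays; they vanish on arrays
with a negative entry. -/
noncomputable def kEntry {n : ℕ} (l : ℕ) (γ α : Arr n) : Cqz :=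
  prefactor l γ α * qTrace l (chainPoly qc n (fun i => α i) (fun i => γ i))

lemma kEntry_eq {n : ℕ} (l : ℕ) {γ α : Arr n} {a c : ℕ → ℤ}
    (ha : ∀ k ∈ Finset.Icc 1 n, α (k : ℕ) = a k) (hc : ∀ k ∈ Finset.Icc 1 n, γ (k : ℕ) = c k) :
    kEntry l γ α = kConst l * qz ^ anglePairing n c a * qTrace l (chainPoly qc n a c) := by
  rw [← chainPoly_congr qc ha hc, ← anglePairing_congr ha hc, kEntry, prefactor, kConst,
    show angle γ α = anglePairing n (fun i => γ i) (fun i => α i) from rfl]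
  ring

lemma kEntry_of_neg {n : ℕ} [NeZero n] (l : ℕ) {γ α : Arr n} {i : ZMod n}
    (h : α i < 0 ∨ γ i < 0) : kEntry l γ α = 0 := by
  obtain ⟨p, hp, rfl⟩ : ∃ p ∈ Finset.Icc 1 n, ((p : ℕ) : ZMod n) = i := by
    rcases eq_or_ne i 0 with rfl | hi
    · exact ⟨n, Finset.mem_Icc.2 ⟨NeZero.pos n, le_rfl⟩, ZMod.natCast_self n⟩
    · exact ⟨i.val, Finset.mem_Icc.2 ⟨Nat.pos_of_ne_zero fun h => hi ((ZMod.val_eq_zero i).1 h),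
        (ZMod.val_lt i).le⟩, ZMod.natCast_zmod_val i⟩
  rw [kEntry, chainPoly, Finset.prod_eq_zero hp (by rw [gPoly_of_neg qc h, Polynomial.zero_comp]),
    map_zero, mul_zero]

lemma natCast_inj_of_mem {n k p : ℕ} (hk : k ∈ Finset.Icc 1 n) (hp : p ∈ Finset.Icc 1 n) :
    (k : ZMod n) = p ↔ k = p := by
  rw [Finset.mem_Icc] at hk hp
  refine ⟨fun h => ?_, fun h => by rw [h]⟩
  rw [ZMod.natCast_eq_natCast_iff, Nat.modEq_iff_dvd] at h
  have := Int.eq_zero_of_abs_lt_dvd h (by rw [abs_lt]; constructor <;> omega)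
  omega

lemma unitArr_natCast {n k p : ℕ} (hk : k ∈ Finset.Icc 1 n) (hp : p ∈ Finset.Icc 1 n) :
    (unitArr (p : ZMod n)) (k : ZMod n) = if k = p then 1 else 0 := by
  rw [unitArr, Pi.single_apply]
  simp only [natCast_inj_of_mem hk hp]

lemma update₂_self (a : ℕ → ℤ) (p p' : ℕ) : update₂ a p p' (a p) (a p') = a := by
  simp [update₂]

section Pair

variable {n p p' : ℕ} (hne : p ≠ p') (hp : p ∈ Finset.Icc 1 n) (hp' : p' ∈ Finset.Icc 1 n)
include hne hp hp'

lemma shift_natCast (α : Arr n) (s : ℤ) {k : ℕ} (hk : k ∈ Finset.Icc 1 n) :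
    (α + s • (unitArr (p : ZMod n) - unitArr (p' : ZMod n))) (k : ZMod n) =
      update₂ (fun i => α i) p p' (α p + s) (α p' - s) k := by
  rw [update₂_apply _ hne, Pi.add_apply, Pi.smul_apply, Pi.sub_apply, unitArr_natCast hk hp,
    unitArr_natCast hk hp']
  simp only [smul_eq_mul]
  split_ifs <;> ring

lemma kEntry_shift_right (l : ℕ) (γ α : Arr n) (s : ℤ) :
    kEntry l γ (α + s • (unitArr (p : ZMod n) - unitArr (p' : ZMod n))) =
      kConst l * qz ^ (angle γ α + s * (∑ i ∈ Finset.Ico 1 p, γ (i : ℕ) -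
        ∑ i ∈ Finset.Ico 1 p', γ (i : ℕ))) *
      qTrace l (chainPoly qc n (update₂ (fun i => α i) p p' (α p + s) (α p' - s))
        (update₂ (fun i => γ i) p p' (γ p) (γ p'))) := by
  rw [update₂_self (fun i => γ i), kEntry_eq l (fun k hk => shift_natCast hne hp hp' α s hk)
    (c := fun i => γ i) fun _ _ => rfl, anglePairing_update₂_right hne hp hp' _ (fun i => α i)]
  rfl

lemma kEntry_shift_left (l : ℕ) (γ α : Arr n) (s : ℤ) :
    kEntry l (γ + s • (unitArr (p : ZMod n) - unitArr (p' : ZMod n))) α =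
      kConst l * qz ^ (angle γ α + s * (∑ i ∈ Finset.Ioc p n, α (i : ℕ) -
        ∑ i ∈ Finset.Ioc p' n, α (i : ℕ))) *
      qTrace l (chainPoly qc n (update₂ (fun i => α i) p p' (α p) (α p'))
        (update₂ (fun i => γ i) p p' (γ p + s) (γ p' - s))) := by
  rw [update₂_self (fun i => α i), kEntry_eq l (a := fun i => α i) (fun _ _ => rfl)
    (fun k hk => shift_natCast hne hp hp' γ s hk),
    anglePairing_update₂_left hne hp hp' (fun i => γ i)]
  rfl

end Pair

lemma add_sub_eq_smul {n : ℕ} (α : Arr n) (i j : ZMod n) :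
    α + unitArr i - unitArr j = α + (1 : ℤ) • (unitArr i - unitArr j) := by
  rw [one_smul, add_sub_assoc]

lemma sub_add_eq_smul {n : ℕ} (α : Arr n) (i j : ZMod n) :
    α - unitArr i + unitArr j = α + (-1 : ℤ) • (unitArr i - unitArr j) := by
  rw [neg_smul, one_smul]; abel

lemma ExchangeRel.map {F M N : Type*} [Field F] [AddCommGroup M] [Module F M] [AddCommGroup N]
    [Module F N] {q : F} {T : ℤ → ℤ → ℤ → ℤ → M} {i₁ j₁ i₂ j₂ : ℤ}
    (h : ExchangeRel q T i₁ j₁ i₂ j₂) (f : M →ₗ[F] N) :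
    ExchangeRel q (fun i₁ j₁ i₂ j₂ => f (T i₁ j₁ i₂ j₂)) i₁ j₁ i₂ j₂ := by
  have := congrArg f h
  simpa [ExchangeRel] using this

lemma kEntry_intertwines_of_ne_zero {n : ℕ} [NeZero n] (l : ℕ) {γ α : Arr n} (hα : ∀ i, 0 ≤ α i)
    (hγ : ∀ i, 0 ≤ γ i) {j : ZMod n} (hj : j ≠ 0) : IntertwiningEq (kEntry l) j γ α := by
  have h0 := qz_ne_zero
  obtain ⟨p, hp1, hpn, rfl⟩ : ∃ p : ℕ, 1 ≤ p ∧ p + 1 ≤ n ∧ (p : ZMod n) = j :=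
    ⟨j.val, Nat.pos_of_ne_zero fun h => hj ((ZMod.val_eq_zero j).1 h), ZMod.val_lt j,
      ZMod.natCast_zmod_val j⟩
  have hne : p ≠ p + 1 := by omega
  have hp : p ∈ Finset.Icc 1 n := Finset.mem_Icc.2 ⟨hp1, by omega⟩
  have hp' : p + 1 ∈ Finset.Icc 1 n := Finset.mem_Icc.2 ⟨by omega, hpn⟩
  have hs : spec zz ((p : ℕ) : ZMod n) = 1 := if_neg hj
  have e1 : ∑ i ∈ Finset.Ico 1 p, γ (i : ℕ) - ∑ i ∈ Finset.Ico 1 (p + 1), γ (i : ℕ) =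
      -γ (p : ℕ) := by
    rw [Finset.sum_Ico_succ_top hp1]; ring
  have e2 : ∑ i ∈ Finset.Ioc p n, α (i : ℕ) - ∑ i ∈ Finset.Ioc (p + 1) n, α (i : ℕ) =
      α ((p + 1 : ℕ) : ZMod n) := by
    rw [← Finset.sum_Ioc_consecutive _ (show p ≤ p + 1 by omega) hpn,
      Finset.sum_Ioc_succ_top le_rfl]
    simp
  have rel := (exchangeRel_chainPoly isGenericParam_qc hp1 hpn (a := fun i => α i)
    (c := fun i => γ i) (fun i => hα i) (fun i => hγ i)).map (qTrace l)
  have hc : ((p : ℕ) : ZMod n) + 1 = ((p + 1 : ℕ) : ZMod n) := by push_cast; rfl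
  refine intertwiningEq_of_exchangeRel (kConst l * qz ^ angle γ α) (T := fun i₁ j₁ i₂ j₂ =>
    qTrace l (chainPoly qc n (update₂ (fun i => α i) p (p + 1) i₁ i₂)
      (update₂ (fun i => γ i) p (p + 1) j₁ j₂))) (by rw [hc]; exact rel) ?_ ?_ ?_ ?_ ?_ <;>
    rw [hc]
  · have := kEntry_shift_right hne hp hp' l γ α 0
    simpa using this
  · rw [hs, one_mul, add_sub_eq_smul, kEntry_shift_right hne hp hp', e1, one_mul, zpow_add₀ h0]
    ring
  · rw [hs, inv_one, one_mul, sub_add_eq_smul, kEntry_shift_right hne hp hp', e1, zpow_add₀ h0,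
      neg_one_mul, neg_neg, sub_neg_eq_add, ← sub_eq_add_neg]
    ring
  · rw [hs, inv_one, one_mul, add_sub_eq_smul, kEntry_shift_left hne hp hp', e2, one_mul,
      zpow_add₀ h0]
    ring
  · rw [hs, one_mul, sub_add_eq_smul, kEntry_shift_left hne hp hp', e2, zpow_add₀ h0,
      neg_one_mul, sub_neg_eq_add, ← sub_eq_add_neg]
    ring

lemma sum_zmod_eq {n : ℕ} [NeZero n] (f : ZMod n → ℤ) :
    ∑ i, f i = ∑ p ∈ Finset.Icc 1 n, f (p : ℕ) := by
  symm
  refine Finset.sum_bij (fun p _ => (p : ZMod n)) (fun _ _ => Finset.mem_univ _)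
    (fun p hp k hk h => (natCast_inj_of_mem hp hk).1 h) (fun i _ => ?_) (fun _ _ => rfl)
  rcases eq_or_ne i 0 with rfl | hi
  · exact ⟨n, Finset.mem_Icc.2 ⟨NeZero.pos n, le_rfl⟩, ZMod.natCast_self n⟩
  · exact ⟨i.val, Finset.mem_Icc.2 ⟨Nat.pos_of_ne_zero fun h => hi ((ZMod.val_eq_zero i).1 h),
      (ZMod.val_lt i).le⟩, ZMod.natCast_zmod_val i⟩

lemma charge_eq_zero {n : ℕ} [NeZero n] {l : ℕ} {γ α : Arr n} (hα : InB l α) (hγ : InB l γ) :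
    charge (fun i => α i) (fun i => γ i) n = 0 := by
  rw [charge, Finset.sum_sub_distrib, ← sum_zmod_eq, ← sum_zmod_eq, hα.2, hγ.2, sub_self]

lemma kEntry_intertwines_zero {n : ℕ} [NeZero n] (hn : 2 ≤ n) (l : ℕ) {γ α : Arr n}
    (hα : InB l α) (hγ : InB l γ) : IntertwiningEq (kEntry l) 0 γ α := by
  have h0 := qz_ne_zero
  have hw := fugacity_ne_zero l
  have hne : n ≠ 1 := by omega
  have hp : n ∈ Finset.Icc 1 n := Finset.mem_Icc.2 ⟨by omega, le_rfl⟩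
  have hp' : 1 ∈ Finset.Icc 1 n := Finset.mem_Icc.2 ⟨le_rfl, by omega⟩
  have hs : spec zz (0 : ZMod n) = (zz : Cqz) := if_pos rfl
  have hc0 : (0 : ZMod n) = ((n : ℕ) : ZMod n) := (ZMod.natCast_self n).symm
  have hc1 : (0 : ZMod n) + 1 = ((1 : ℕ) : ZMod n) := by simp
  have hz := zz.ne_zero
  have hzw : (zz : Cqz) = (qz ^ (l : ℤ))⁻¹ * (fugacity l)⁻¹ := by
    rw [fugacity, inv_inv, zpow_natCast, inv_mul_cancel_left₀ (pow_ne_zero _ h0)]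
  have e1 : ∑ i ∈ Finset.Ico 1 n, γ (i : ℕ) - ∑ i ∈ Finset.Ico 1 1, γ (i : ℕ) =
      l - γ ((n : ℕ) : ZMod n) := by
    have := hγ.2
    rw [sum_zmod_eq, ← Finset.Ico_succ_right_eq_Icc, Order.succ_eq_add_one,
      Finset.sum_Ico_succ_top (by omega)] at this
    rw [Finset.Ico_self, Finset.sum_empty]
    linarith
  have e2 : ∑ i ∈ Finset.Ioc n n, α (i : ℕ) - ∑ i ∈ Finset.Ioc 1 n, α (i : ℕ) =
      α ((1 : ℕ) : ZMod n) - l := by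
    have := hα.2
    rw [sum_zmod_eq, ← Finset.sum_Ioc_add_eq_sum_Icc (by omega)] at this
    rw [Finset.Ioc_self, Finset.sum_empty]
    linarith
  have hch := charge_eq_zero hα hγ
  have rel := (exchangeRel_chainPoly_wrap isGenericParam_qc hn (a := fun i => α i)
    (c := fun i => γ i) (fun i => hα.1 i) (fun i => hγ.1 i) hch).map (qTrace l)
  have shift : ∀ i₁ j₁ i₂ j₂ : ℤ, j₁ + j₂ - i₁ - i₂ =
      γ ((n : ℕ) : ZMod n) + γ ((1 : ℕ) : ZMod n) - α ((n : ℕ) : ZMod n) - α ((1 : ℕ) : ZMod n) →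
      qTrace l (chainPoly qc n (update₂ (fun i => α i) n 1 i₁ i₂)
        (update₂ (fun i => γ i) n 1 j₁ j₂)) = fugacity l ^ (j₂ - i₂) *
      qTrace l ((chainPoly qc n (update₂ (fun i => α i) n 1 i₁ i₂)
        (update₂ (fun i => γ i) n 1 j₁ j₂)).comp
          (Polynomial.C (qc ^ (j₂ - i₂)) * Polynomial.X)) := by
    intro i₁ j₁ i₂ j₂ h
    have u1 : ∀ (a : ℕ → ℤ) (i i' : ℤ), update₂ a n 1 i i' 1 = i' := fun a i i' => by simp [update₂]
    have := qTrace_chainPoly_shift l (show 1 ≤ n by omega) (update₂ (fun i => α i) n 1 i₁ i₂)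
      (update₂ (fun i => γ i) n 1 j₁ j₂) (by
        rw [charge_update₂ _ _ hne (by omega) le_rfl, if_pos le_rfl, if_pos (by omega), hch]
        linarith)
    rwa [u1, u1] at this
  rw [hc0]
  have hc1' : ((n : ℕ) : ZMod n) + 1 = ((1 : ℕ) : ZMod n) := by rw [← hc0, hc1]
  rw [hc0] at hs
  refine intertwiningEq_of_exchangeRel (kConst l * qz ^ angle γ α *
    fugacity l ^ (γ ((1 : ℕ) : ZMod n) - α ((1 : ℕ) : ZMod n))) (T := fun i₁ j₁ i₂ j₂ =>
    qTrace l ((chainPoly qc n (update₂ (fun i => α i) n 1 i₁ i₂)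
      (update₂ (fun i => γ i) n 1 j₁ j₂)).comp
        (Polynomial.C (qc ^ (j₂ - i₂)) * Polynomial.X))) (by rw [hc1']; exact rel)
    ?_ ?_ ?_ ?_ ?_ <;>
    rw [hc1']
  · have := kEntry_shift_right hne hp hp' l γ α 0
    simp only [zero_smul, add_zero, zero_mul, sub_zero] at this
    rw [this, shift _ _ _ _ rfl]
    ring
  · rw [hs, hzw, add_sub_eq_smul, kEntry_shift_right hne hp hp', e1, one_mul, zpow_add₀ h0,
      shift _ _ _ _ (by ring), show γ ((1 : ℕ) : ZMod n) - (α ((1 : ℕ) : ZMod n) - 1) =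
        γ ((1 : ℕ) : ZMod n) - α ((1 : ℕ) : ZMod n) + 1 by ring, zpow_add_one₀ hw, sub_eq_add_neg,
      zpow_add₀ h0]
    field_simp
  · rw [hs, hzw, sub_add_eq_smul, kEntry_shift_right hne hp hp', e1, neg_one_mul, neg_sub,
      zpow_add₀ h0, sub_neg_eq_add, ← sub_eq_add_neg, shift _ _ _ _ (by ring),
      show γ ((1 : ℕ) : ZMod n) - (α ((1 : ℕ) : ZMod n) + 1) =
        γ ((1 : ℕ) : ZMod n) - α ((1 : ℕ) : ZMod n) - 1 by ring, zpow_sub_one₀ hw, zpow_sub₀ h0]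
    field_simp
  · rw [hs, hzw, add_sub_eq_smul, kEntry_shift_left hne hp hp', e2, one_mul,
      zpow_add₀ h0, shift _ _ _ _ (by ring),
      show γ ((1 : ℕ) : ZMod n) - 1 - α ((1 : ℕ) : ZMod n) =
        γ ((1 : ℕ) : ZMod n) - α ((1 : ℕ) : ZMod n) - 1 by ring, zpow_sub_one₀ hw, zpow_sub₀ h0]
    field_simp
  · rw [hs, hzw, sub_add_eq_smul, kEntry_shift_left hne hp hp', e2, neg_one_mul, neg_sub,
      zpow_add₀ h0, sub_neg_eq_add, ← sub_eq_add_neg, shift _ _ _ _ (by ring),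
      show γ ((1 : ℕ) : ZMod n) + 1 - α ((1 : ℕ) : ZMod n) =
        γ ((1 : ℕ) : ZMod n) - α ((1 : ℕ) : ZMod n) + 1 by ring, zpow_add_one₀ hw, sub_eq_add_neg,
      zpow_add₀ h0]
    field_simp

lemma kEntry_intertwines {n : ℕ} [NeZero n] (hn : 2 ≤ n) (l : ℕ) {γ α : Arr n}
    (hα : InB l α) (hγ : InB l γ) (j : ZMod n) : IntertwiningEq (kEntry l) j γ α := by
  rcases eq_or_ne j 0 with rfl | hj
  · exact kEntry_intertwines_zero hn l hα hγ
  · exact kEntry_intertwines_of_ne_zero l hα.1 hγ.1 hj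

end Entries

/-! ### The intertwining equations in coordinates -/

lemma unitArr_self {n : ℕ} (j : ZMod n) : unitArr j j = 1 := by simp [unitArr]

lemma spec_inv {n : ℕ} (x : Cqzˣ) (j : ZMod n) : spec x⁻¹ j = (spec x j)⁻¹ := by
  unfold spec
  split_ifs <;> simp

lemma cq_smul (c : Cq) {M : Type*} [AddCommGroup M] [Module Cqz M] [Module Cq M]
    [IsScalarTower Cq Cqz M] (v : M) : c • v = algebraMap Cq Cqz c • v :=
  (algebraMap_smul Cqz c v).symm

lemma unitArr_succ_right {n : ℕ} [Fact (1 < n)] (j : ZMod n) : unitArr j (j + 1) = 0 := by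
  simp [unitArr]

lemma unitArr_succ_left {n : ℕ} [Fact (1 < n)] (j : ZMod n) : unitArr (j + 1) j = 0 := by
  simp [unitArr]

section Coordinates

variable {n : ℕ} [NeZero n]

open Classical in
lemma inclB_bvec_apply (l : ℕ) (β : Arr n) {γ : Arr n} (hγ : InB l γ) :
    inclB l (bvec l β) γ = if β = γ then 1 else 0 := by
  unfold bvec inclB
  split_ifs with h h' h'
  · subst h'; simp [Finsupp.mapDomain_single]
  · simp [Finsupp.mapDomain_single, h']
  · subst h'; exact absurd hγ h
  · simp

lemma inclB_apply_of_notMem (l : ℕ) (v : BSet n l →₀ Cqz) {γ : Arr n} (hγ : ¬ InB l γ) :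
    inclB l v γ = 0 := by
  induction v using Finsupp.induction_linear with
  | zero => simp
  | add v w hv hw => rw [map_add, Finsupp.add_apply, hv, hw, add_zero]
  | single β a =>
    have : β.1 ≠ γ := fun h => hγ (h ▸ β.2)
    simp [inclB, Finsupp.mapDomain_single, this]

lemma inclB_apply (l : ℕ) (v : BSet n l →₀ Cqz) (γ : BSet n l) : inclB l v γ.1 = v γ :=
  Finsupp.mapDomain_apply Subtype.val_injective _ _

lemma bvec_of_notMem (l : ℕ) {β : Arr n} (h : ¬ InB l β) : bvec l β = 0 := dif_neg h

lemma bvec_coe (l : ℕ) (β : BSet n l) : bvec l β.1 = Finsupp.single β 1 := dif_pos β.2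

/-- A weighted shift of basis vectors, in coordinates. -/
lemma inclB_linearCombination_apply (l : ℕ) (f : Arr n → Cqz) (d : Arr n) (v : BSet n l →₀ Cqz)
    {γ : Arr n} (hγ : InB l γ) :
    inclB l (Finsupp.linearCombination Cqz (fun β : BSet n l => f β.1 • bvec l (β.1 + d)) v) γ =
      f (γ - d) * inclB l v (γ - d) := by
  classical
  induction v using Finsupp.induction_linear with
  | zero => simp
  | add v w hv hw => rw [map_add, map_add, map_add, Finsupp.add_apply, hv, hw, Finsupp.add_apply,
      mul_add]
  | single β a =>
    rw [Finsupp.linearCombination_single, map_smul, map_smul, Finsupp.smul_apply,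
      Finsupp.smul_apply, inclB_bvec_apply l _ hγ]
    have e : inclB l (Finsupp.single β a) (γ - d) = if β.1 + d = γ then a else 0 := by
      simp [inclB, Finsupp.mapDomain_single, Finsupp.single_apply, eq_sub_iff_add_eq]
    rw [e]
    split_ifs with h
    · subst h; simp [mul_comm]
    · simp

lemma actV_k_bvec (l : ℕ) (x : Cqzˣ) (j : ZMod n) (β : Arr n) :
    actV l x (.k j) (bvec l β) = qz ^ (β j - β (j + 1)) • bvec l β := by
  by_cases h : InB l β
  · rw [show bvec l β = Finsupp.single ⟨β, h⟩ 1 from dif_pos h]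
    simp [actV, bvec, h]
  · rw [bvec_of_notMem l h, map_zero, smul_zero]

/-- The matrix elements of `K`, extended by `0` to all arrays. -/
noncomputable def entry {l : ℕ} (K : VSpace n l →ₗ[Cqz] VDual n l) (γ α : Arr n) : Cqz :=
  inclB l (K (bvec l α)) γ

lemma entry_coe {l : ℕ} (K : VSpace n l →ₗ[Cqz] VDual n l) (γ α : BSet n l) :
    entry K γ.1 α.1 = matElt K γ α := by
  rw [entry, bvec_coe, inclB_apply, matElt]

variable [Fact (1 < n)]

lemma piRep_gen (l : ℕ) (x : Cqzˣ) (g : UqGen n) : piRep l x (Uq.gen g) = actV l x g := by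
  simp [piRep, Uq.gen, freeGen]

lemma piRepDual_gen (l : ℕ) (x : Cqzˣ) (g : UqGen n) :
    piRepDual l x (Uq.gen g) = actVDual l x g := by
  simp [piRepDual, Uq.gen, freeGen]

lemma piRep_b_bvec (l : ℕ) (x : Cqzˣ) (j : ZMod n) {α : Arr n} (hα : InB l α) :
    piRep l x (Uq.b j) (bvec l α) =
      -((spec x j * qInt qz (α (j + 1))) • bvec l (α + unitArr j - unitArr (j + 1))) +
      ((spec x j)⁻¹ * qInt qz (α j) * qz ^ (α j - α (j + 1))) •
        bvec l (α - unitArr j + unitArr (j + 1)) +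
      (qz / (1 - qz) * qz ^ (α j - α (j + 1))) • bvec l α := by
  have h0 := qz_ne_zero
  have hv : bvec l α = Finsupp.single ⟨α, hα⟩ 1 := dif_pos hα
  have he : actV l x (.e j) (bvec l α) =
      (spec x j * qInt qz (α (j + 1))) • bvec l (α + unitArr j - unitArr (j + 1)) := by
    rw [hv]; simp [actV]
  have hf : actV l x (.f j) (bvec l α) =
      ((spec x j)⁻¹ * qInt qz (α j)) • bvec l (α - unitArr j + unitArr (j + 1)) := by
    rw [hv]; simp [actV]
  simp only [Uq.b, map_add, map_neg, map_smul, map_mul, piRep_gen, LinearMap.add_apply,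
    LinearMap.neg_apply, LinearMap.smul_apply, Module.End.mul_apply, he, hf, actV_k_bvec,
    cq_smul, smul_smul, map_pow, map_div₀, map_sub, map_one, algebraMap_qc]
  congr 3
  simp only [Pi.add_apply, Pi.sub_apply, unitArr_self, unitArr_succ_right, unitArr_succ_left]
  rw [show α j - 1 + 0 - (α (j + 1) - 0 + 1) = α j - α (j + 1) - 1 - 1 by ring, zpow_sub_one₀ h0,
    zpow_sub_one₀ h0]
  field_simp

/-- The coefficient of `v*_γ` in `b_j v`. -/
lemma inclB_piRepDual_b (l : ℕ) (x : Cqzˣ) (j : ZMod n) (v : VDual n l) {γ : Arr n}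
    (hγ : InB l γ) : inclB l (piRepDual l x (Uq.b j) v) γ =
      spec x j * qInt qz (γ (j + 1)) * qz ^ (γ (j + 1) - γ j) *
        inclB l v (γ + unitArr j - unitArr (j + 1)) -
      (spec x j)⁻¹ * qInt qz (γ j) * inclB l v (γ - unitArr j + unitArr (j + 1)) +
      qz / (1 - qz) * qz ^ (γ (j + 1) - γ j) * inclB l v γ := by
  have h0 := qz_ne_zero
  have he : ∀ v, inclB l (actVDual l x (.e j) v) γ =
      -(spec x j * qInt qz (γ (j + 1)) * qz ^ (γ (j + 1) - γ j)) *
        inclB l v (γ + unitArr j - unitArr (j + 1)) := fun v => by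
    have := inclB_linearCombination_apply l (fun α => -(spec x j) * qInt qz (α (j + 1) + 1) *
      qz ^ (-α j + α (j + 1) + 2)) (-unitArr j + unitArr (j + 1)) v hγ
    simp only [← add_assoc, ← sub_eq_add_neg] at this
    rw [show γ - (-unitArr j + unitArr (j + 1)) = γ + unitArr j - unitArr (j + 1) by abel] at this
    simp only [Pi.add_apply, Pi.sub_apply, unitArr_self, unitArr_succ_right,
      unitArr_succ_left] at this
    rw [actVDual, this]
    congr 1
    rw [show γ (j + 1) + 0 - 1 + 1 = γ (j + 1) by ring,
      show -(γ j + 1 - 0) + (γ (j + 1) + 0 - 1) + 2 = γ (j + 1) - γ j by ring]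
    ring
  have hf : ∀ v, inclB l (actVDual l x (.f j) v) γ =
      -((spec x j)⁻¹ * qInt qz (γ j) * qz ^ (γ j - γ (j + 1) - 2)) *
        inclB l v (γ - unitArr j + unitArr (j + 1)) := fun v => by
    have := inclB_linearCombination_apply l (fun α => -(spec x j)⁻¹ * qInt qz (α j + 1) *
      qz ^ (α j - α (j + 1))) (unitArr j - unitArr (j + 1)) v hγ
    simp only [← add_sub_assoc] at this
    rw [show γ - (unitArr j - unitArr (j + 1)) = γ - unitArr j + unitArr (j + 1) by abel] at this
    simp only [Pi.add_apply, Pi.sub_apply, unitArr_self, unitArr_succ_right,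
      unitArr_succ_left] at this
    rw [actVDual, this]
    congr 1
    rw [show γ j - 1 + 0 + 1 = γ j by ring,
      show γ j - 1 + 0 - (γ (j + 1) - 0 + 1) = γ j - γ (j + 1) - 2 by ring]
    ring
  have hk : ∀ v, inclB l (actVDual l x (.k j) v) γ = qz ^ (γ (j + 1) - γ j) * inclB l v γ :=
      fun v => by
    have := inclB_linearCombination_apply l (fun α => qz ^ (-α j + α (j + 1))) 0 v hγ
    simp only [add_zero, sub_zero] at this
    rw [actVDual, this, neg_add_eq_sub]
  simp only [Uq.b, map_add, map_neg, map_smul, map_mul, piRepDual_gen, LinearMap.add_apply,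
    LinearMap.neg_apply, LinearMap.smul_apply, Module.End.mul_apply, cq_smul, map_pow, map_div₀,
    map_sub, map_one, algebraMap_qc, Finsupp.add_apply, Finsupp.neg_apply, Finsupp.smul_apply, he,
    hf, hk, smul_eq_mul]
  have e : qz ^ (γ (j + 1) - γ j) * qz ^ (γ j - γ (j + 1) - 2) * qz ^ 2 = 1 := by
    rw [← zpow_add₀ h0, ← zpow_natCast qz 2, ← zpow_add₀ h0]
    rw [show γ (j + 1) - γ j + (γ j - γ (j + 1) - 2) + ((2 : ℕ) : ℤ) = 0 by push_cast; ring,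
      zpow_zero]
  linear_combination (-(spec x j)⁻¹ * qInt qz (γ j) *
    inclB l v (γ - unitArr j + unitArr (j + 1))) * e

lemma intertwiningEq_entry_iff {l : ℕ} (K : VSpace n l →ₗ[Cqz] VDual n l) (j : ZMod n)
    {γ α : Arr n} (hα : InB l α) (hγ : InB l γ) : IntertwiningEq (entry K) j γ α ↔
      inclB l (K (piRep l zz (Uq.b j) (bvec l α))) γ =
        inclB l (piRepDual l zz⁻¹ (Uq.b j) (K (bvec l α))) γ := by
  rw [piRep_b_bvec l zz j hα, inclB_piRepDual_b l _ j _ hγ, spec_inv, inv_inv]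
  simp only [map_add, map_neg, map_smul, Finsupp.add_apply, Finsupp.neg_apply, Finsupp.smul_apply,
    smul_eq_mul]
  rfl

lemma comp_piRep_b_iff {l : ℕ} (K : VSpace n l →ₗ[Cqz] VDual n l) (j : ZMod n) :
    K ∘ₗ piRep l zz (Uq.b j) = piRepDual l zz⁻¹ (Uq.b j) ∘ₗ K ↔
      ∀ γ α, InB l γ → InB l α → IntertwiningEq (entry K) j γ α := by
  constructor
  · intro h γ α hγ hα
    rw [intertwiningEq_entry_iff K j hα hγ]
    exact congrArg (fun f => inclB l f γ) (LinearMap.congr_fun h (bvec l α))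
  · intro h
    refine Finsupp.lhom_ext' fun α => LinearMap.ext_ring ?_
    simp only [LinearMap.comp_apply, Finsupp.lsingle_apply]
    rw [← bvec_coe]
    refine inclB_injective l (Finsupp.ext fun γ => ?_)
    by_cases hγ : InB l γ
    · exact (intertwiningEq_entry_iff K j α.2 hγ).1 (h γ α.1 hγ α.2)
    · rw [inclB_apply_of_notMem l _ hγ, inclB_apply_of_notMem l _ hγ]

lemma forall_coidealBq_iff {l : ℕ} (K : VSpace n l →ₗ[Cqz] VDual n l) :
    (∀ b ∈ coidealBq n, K ∘ₗ piRep l zz b = piRepDual l zz⁻¹ b ∘ₗ K) ↔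
      ∀ j γ α, InB l γ → InB l α → IntertwiningEq (entry K) j γ α := by
  constructor
  · intro h j
    exact (comp_piRep_b_iff K j).1 (h _ (Algebra.subset_adjoin ⟨j, rfl⟩))
  · intro h b hb
    unfold coidealBq at hb
    induction hb using Algebra.adjoin_induction with
    | mem b hb => obtain ⟨j, rfl⟩ := hb; exact (comp_piRep_b_iff K j).2 (h j)
    | algebraMap c =>
      ext1 α
      rw [AlgHom.commutes, AlgHom.commutes]
      refine LinearMap.ext fun a => ?_
      simp only [Module.algebraMap_end_apply, LinearMap.comp_apply, cq_smul, map_smul]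
    | add b b' _ _ hb hb' =>
      rw [map_add, map_add, LinearMap.comp_add, LinearMap.add_comp, hb, hb']
    | mul b b' _ _ hb hb' =>
      rw [map_mul, map_mul, Module.End.mul_eq_comp, Module.End.mul_eq_comp, ← LinearMap.comp_assoc,
        hb, LinearMap.comp_assoc, hb', LinearMap.comp_assoc]

end Coordinates

/-! ### Moves between the arrays of `B_l` -/

lemma unitArr_apply {n : ℕ} (i k : ZMod n) : unitArr i k = if k = i then 1 else 0 :=
  Pi.single_apply _ _ _

lemma InB.shift {n : ℕ} [NeZero n] {l : ℕ} {β : Arr n} (h : InB l β)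
    (i : ZMod n) {j : ZMod n} (hj : 1 ≤ β j) :
    InB l (β + unitArr i - unitArr j) := by
  refine ⟨fun k => ?_, by rw [sum_shift]; exact h.2⟩
  have hk := h.1 k
  simp only [Pi.add_apply, Pi.sub_apply, unitArr_apply]
  by_cases hkj : k = j
  · subst hkj
    split_ifs <;> linarith
  · rw [if_neg hkj]
    split_ifs <;> linarith

lemma sum_eq_add_sum_two {n : ℕ} [NeZero n] (hn : 2 ≤ n) (β : Arr n) :
    ∑ i, β i = β 1 + ∑ p ∈ Finset.Icc 2 n, β (p : ℕ) := by
  rw [sum_zmod_eq, ← Finset.sum_Ioc_add_eq_sum_Icc (by omega), Nat.cast_one, add_comm]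
  rfl

lemma natCast_ne_zero_of_lt {n k : ℕ} (hk : 1 ≤ k) (hn : k < n) : (k : ZMod n) ≠ 0 := by
  rw [Ne, ZMod.natCast_eq_zero_iff]
  exact fun h => absurd (Nat.le_of_dvd (by omega) h) (by omega)

lemma natCast_ne_one_of_le {n k : ℕ} (hk : 2 ≤ k) (hn : k ≤ n) : (k : ZMod n) ≠ 1 := by
  intro h
  have := (natCast_inj_of_mem (n := n) (k := k) (p := 1) (Finset.mem_Icc.2 ⟨by omega, hn⟩)
    (Finset.mem_Icc.2 ⟨le_rfl, by omega⟩)).1 (by rw [h, Nat.cast_one])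
  omega

/-- The combinatorial skeleton of uniqueness: every array of `B_l` is reached from `l 𝐞_1` by
moving units away from position `1`, first to position `2` and from there to the positions
`3, …, n`. -/
lemma forall_of_propagation {n : ℕ} [NeZero n] (hn : 2 ≤ n) {l : ℕ} {S : Arr n → Prop}
    (hout : ∀ β, ¬ InB l β → S β) (ho : S (lOne n l).1)
    (h1 : ∀ β, InB l β → (∀ β' : Arr n, β 1 ≤ β' 1 → S β') →
      S (β - unitArr 1 + unitArr (1 + 1)))
    (hj : ∀ β j, InB l β → j ≠ 0 → j ≠ 1 → S β → S (β + unitArr j - unitArr (j + 1)) →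
      S (β - unitArr j + unitArr (j + 1))) (β : Arr n) : S β := by
  have key : ∀ k : ℕ, ∀ β : Arr n, (l : ℤ) - k ≤ β 1 → S β := by
    intro k
    induction k with
    | zero =>
      intro β hβ
      by_cases hB : InB l β
      · suffices β = (lOne n l).1 from this ▸ ho
        rw [Nat.cast_zero, sub_zero] at hβ
        have h0 : 0 ≤ ∑ p ∈ Finset.univ.erase (1 : ZMod n), β p :=
          Finset.sum_nonneg fun p _ => hB.1 _
        have hs := Finset.add_sum_erase Finset.univ β (Finset.mem_univ (1 : ZMod n))
        rw [hB.2] at hs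
        have hz := (Finset.sum_eq_zero_iff_of_nonneg fun p _ => hB.1 p).1
          (show ∑ p ∈ Finset.univ.erase (1 : ZMod n), β p = 0 by linarith)
        funext i
        by_cases hi : i = 1
        · subst hi
          simp only [lOne, Pi.single_eq_same]
          linarith
        · rw [hz i (Finset.mem_erase.2 ⟨hi, Finset.mem_univ _⟩)]
          simp [lOne, hi]
      · exact hout β hB
    | succ k ih =>
      -- A unit outside position `1` sits at some position `m + 2`; it is moved back step by step.
      have inner : ∀ m : ℕ, m + 2 ≤ n → ∀ β : Arr n, (l : ℤ) - (k + 1 : ℕ) ≤ β 1 →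
          1 ≤ β (m + 2 : ℕ) → S β := by
        intro m
        induction m with
        | zero =>
          intro hm β hβ h2
          by_cases hB : InB l β
          swap
          · exact hout β hB
          have e2 : ((0 + 2 : ℕ) : ZMod n) = 1 + 1 := by norm_num
          have hne : (1 : ZMod n) ≠ 1 + 1 := by
            rw [← e2]; exact (natCast_ne_one_of_le le_rfl hn).symm
          rw [e2] at h2
          have := h1 (β + unitArr 1 - unitArr (1 + 1)) (hB.shift 1 h2) fun β' hβ' => ih β' (by
            simp only [Pi.add_apply, Pi.sub_apply, unitArr_apply, if_neg hne, if_true] at hβ'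
            push_cast at hβ ⊢
            linarith)
          convert this using 1
          abel
        | succ m ihm =>
          intro hm β hβ h2
          by_cases hB : InB l β
          swap
          · exact hout β hB
          set j : ZMod n := ((m + 2 : ℕ) : ZMod n) with hjdef
          have e2 : ((m + 1 + 2 : ℕ) : ZMod n) = j + 1 := by rw [hjdef]; push_cast; ring
          have hj0 : j ≠ 0 := natCast_ne_zero_of_lt (by omega) (by omega)
          have hj1 : j ≠ 1 := natCast_ne_one_of_le (by omega) (by omega)
          have hj2 : (1 : ZMod n) ≠ j + 1 := fun h => hj0 (by simpa using h.symm)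
          have hjj : j ≠ j + 1 := by
            rw [hjdef, ← Nat.cast_succ]
            intro h
            have := (natCast_inj_of_mem (Finset.mem_Icc.2 ⟨by omega, by omega⟩)
              (Finset.mem_Icc.2 ⟨by omega, by omega⟩)).1 h
            omega
          rw [e2] at h2
          have hB' := hB.shift j h2
          have hS := ihm (by omega) (β + unitArr j - unitArr (j + 1)) (by
            simp only [Pi.add_apply, Pi.sub_apply, unitArr_apply, if_neg hj1.symm, if_neg hj2]
            linarith) (by
            simp only [Pi.add_apply, Pi.sub_apply, unitArr_apply, if_neg hjj, if_true]
            linarith [hB.1 j])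
          have hS' := ihm (by omega) (β + unitArr j - unitArr (j + 1) + unitArr j - unitArr (j + 1))
            (by
              simp only [Pi.add_apply, Pi.sub_apply, unitArr_apply, if_neg hj1.symm, if_neg hj2]
              linarith) (by
            simp only [Pi.add_apply, Pi.sub_apply, unitArr_apply, if_neg hjj, if_true]
            linarith [hB.1 j])
          convert hj _ j hB' hj0 hj1 hS hS' using 1
          abel
      intro β hβ
      by_cases hB : InB l β
      swap
      · exact hout β hB
      by_cases hk : (l : ℤ) - k ≤ β 1
      · exact ih β hk
      have hs := hB.2
      rw [sum_eq_add_sum_two hn] at hs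
      obtain ⟨p, hp, hpos⟩ := Finset.exists_lt_of_sum_lt (s := Finset.Icc 2 n)
        (f := fun _ => (0 : ℤ)) (g := fun p => β (p : ℕ)) (by
          rw [Finset.sum_const_zero]
          linarith [(Nat.cast_nonneg k : (0 : ℤ) ≤ k)])
      obtain ⟨hp2, hpn⟩ := Finset.mem_Icc.1 hp
      obtain ⟨m, rfl⟩ := Nat.exists_eq_add_of_le' hp2
      exact inner m hpn β hβ hpos
  by_cases hB : InB l β
  · exact key l β (by rw [sub_self]; exact hB.1 1)
  · exact hout β hB

/-! ### The system of top coefficients -/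

lemma qInt_zero {F : Type*} [Field F] (q : F) : qInt q 0 = 0 := by simp [qInt]

lemma qInt_qc_ne_zero {u : ℤ} (hu : 1 ≤ u) : qInt qc u ≠ 0 := by
  have h0 := qc_ne_zero
  have key : ∀ u : ℤ, 1 ≤ u → qc ^ u - qc ^ (-u) ≠ 0 := by
    intro u hu h
    obtain ⟨m, rfl⟩ := Int.eq_ofNat_of_zero_le (show 0 ≤ u by omega)
    apply qc_pow_ne_one (m := m + m) (by omega)
    rw [sub_eq_zero, zpow_neg, ← mul_eq_one_iff_eq_inv₀ (zpow_ne_zero _ h0)] at h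
    rwa [pow_add, ← zpow_natCast]
  have h1 := key 1 le_rfl
  rw [zpow_neg, zpow_one] at h1
  exact div_ne_zero (key u hu) h1

/-- The coefficients of the highest power of `z` in a `B_q`-intertwiner satisfy this system over
`ℂ(q)`: the equations for `b_j`, `j ≠ 0`, do not involve `z`, and in the equation for `b_0` only
the two terms carrying `z` survive. -/
structure TopSystem {n : ℕ} [NeZero n] (l : ℕ) (X : Arr n → Arr n → Cq) : Prop where
  eq_zero_left : ∀ γ α, ¬ InB l γ → X γ α = 0
  eq_zero_right : ∀ γ α, ¬ InB l α → X γ α = 0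
  bulk : ∀ j γ α, j ≠ 0 → InB l γ → InB l α →
    -(qInt qc (α (j + 1)) * X γ (α + unitArr j - unitArr (j + 1))) +
        qInt qc (α j) * qc ^ (α j - α (j + 1)) * X γ (α - unitArr j + unitArr (j + 1)) +
        qc / (1 - qc) * qc ^ (α j - α (j + 1)) * X γ α =
      qInt qc (γ (j + 1)) * qc ^ (γ (j + 1) - γ j) * X (γ + unitArr j - unitArr (j + 1)) α -
        qInt qc (γ j) * X (γ - unitArr j + unitArr (j + 1)) α +
        qc / (1 - qc) * qc ^ (γ (j + 1) - γ j) * X γ α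
  wrap : ∀ γ α, InB l γ → InB l α →
    qInt qc (α (0 + 1)) * X γ (α + unitArr 0 - unitArr (0 + 1)) =
      qInt qc (γ 0) * X (γ - unitArr 0 + unitArr (0 + 1)) α

namespace TopSystem

variable {n : ℕ} [NeZero n] {l : ℕ} {X : Arr n → Arr n → Cq}

/-- A move that leaves `B_l` kills the entry, so a vanishing product with `[γ_j]` is enough. -/
lemma eq_zero_of_qInt_mul_left (hX : TopSystem l X) {γ α : Arr n} (hγ : InB l γ) {j k : ZMod n}
    (hjk : k ≠ j) (h : qInt qc (γ j) * X (γ - unitArr j + unitArr k) α = 0) :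
    X (γ - unitArr j + unitArr k) α = 0 := by
  rcases (hγ.1 j).lt_or_eq with h1 | h1
  · exact (mul_eq_zero.1 h).resolve_left (qInt_qc_ne_zero h1)
  · refine hX.eq_zero_left _ _ fun hB => ?_
    have := hB.1 j
    simp only [Pi.add_apply, Pi.sub_apply, unitArr_apply, if_neg hjk.symm, if_true] at this
    linarith

lemma eq_zero_of_qInt_mul_right (hX : TopSystem l X) {γ α : Arr n} (hα : InB l α) {j k : ZMod n}
    (hjk : k ≠ j) (h : qInt qc (α j) * X γ (α - unitArr j + unitArr k) = 0) :
    X γ (α - unitArr j + unitArr k) = 0 := by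
  rcases (hα.1 j).lt_or_eq with h1 | h1
  · exact (mul_eq_zero.1 h).resolve_left (qInt_qc_ne_zero h1)
  · refine hX.eq_zero_right _ _ fun hB => ?_
    have := hB.1 j
    simp only [Pi.add_apply, Pi.sub_apply, unitArr_apply, if_neg hjk.symm, if_true] at this
    linarith

lemma lOne_apply (l : ℕ) (k : ZMod n) : (lOne n l).1 k = if k = 1 then (l : ℤ) else 0 :=
  Pi.single_apply _ _ _

/-- Once the column of `l 𝐞_1` vanishes on all rows `γ` with `γ_1 ≥ a`, so do there the columns
of `l 𝐞_1 - 𝐞_1 + 𝐞_m`, for `m = n, n - 1, …, 2`. -/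
lemma column_neighbour (hX : TopSystem l X) (hn : 2 ≤ n) {a : ℤ}
    (ha : ∀ γ : Arr n, a ≤ γ 1 → X γ (lOne n l).1 = 0) {m : ℕ} (hm : 2 ≤ m) (hmn : m ≤ n) :
    ∀ γ : Arr n, a ≤ γ 1 → X γ ((lOne n l).1 - unitArr 1 + unitArr (m : ZMod n)) = 0 := by
  have h10 : (1 : ZMod n) ≠ 0 := by
    simpa using natCast_ne_zero_of_lt (n := n) (k := 1) le_rfl (by omega)
  induction hmn using Nat.decreasingInduction with
  | self =>
    intro γ hγ
    by_cases hB : InB l γ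
    swap
    · exact hX.eq_zero_left _ _ hB
    have := hX.wrap γ _ hB (lOne n l).2
    rw [ha (γ - unitArr 0 + unitArr (0 + 1)) (by
      simp only [zero_add, Pi.add_apply, Pi.sub_apply, unitArr_apply, if_neg h10, if_true]
      linarith), mul_zero, add_sub_right_comm, zero_add] at this
    rw [ZMod.natCast_self]
    exact hX.eq_zero_of_qInt_mul_right (lOne n l).2 h10.symm this
  | of_succ m hmn ih =>
    intro γ hγ
    by_cases hB : InB l γ
    swap
    · exact hX.eq_zero_left _ _ hB
    have hj0 : (m : ZMod n) ≠ 0 := natCast_ne_zero_of_lt (by omega) hmn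
    have hj1 : (m : ZMod n) ≠ 1 := natCast_ne_one_of_le hm hmn.le
    have hk1 : (m : ZMod n) + 1 ≠ 1 := fun h => hj0 (by simpa using h)
    have hkj : (m : ZMod n) ≠ m + 1 := fun h => h10 (by simpa using h.symm)
    have ih' := ih (by omega)
    push_cast at ih'
    rcases Nat.eq_zero_or_pos l with rfl | hl
    -- For `l = 0` the array `l 𝐞_1 - 𝐞_1 + 𝐞_m` has a negative entry.
    · refine hX.eq_zero_right _ _ fun hB' => ?_
      have := hB'.1 1
      simp only [Pi.add_apply, Pi.sub_apply, unitArr_apply, lOne_apply, if_neg hj1.symm,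
        if_true] at this
      norm_num at this
    have hα : InB l ((lOne n l).1 - unitArr 1 + unitArr ((m : ZMod n) + 1)) := by
      rw [sub_add_eq_add_sub]
      refine (lOne n l).2.shift _ ?_
      rw [lOne_apply, if_pos rfl]
      exact_mod_cast hl
    have := hX.bulk m γ _ hj0 hB hα
    rw [ih' γ hγ, ih' (γ + unitArr (m : ZMod n) - unitArr ((m : ZMod n) + 1)) (by
      simpa only [Pi.add_apply, Pi.sub_apply, unitArr_apply, if_neg hj1.symm, if_neg hk1.symm,
        add_zero, sub_zero] using hγ),
      ih' (γ - unitArr (m : ZMod n) + unitArr ((m : ZMod n) + 1)) (by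
      simpa only [Pi.add_apply, Pi.sub_apply, unitArr_apply, if_neg hj1.symm, if_neg hk1.symm,
        add_zero, sub_zero] using hγ)] at this
    simp only [Pi.add_apply, Pi.sub_apply, unitArr_apply, lOne_apply, if_neg hj1, if_neg hk1,
      if_neg hkj, if_true, add_zero, zero_add, qInt_zero, zero_mul, mul_zero,
      sub_self] at this
    rw [neg_eq_zero] at this
    have h2 := (mul_eq_zero.1 this).resolve_left (qInt_qc_ne_zero le_rfl)
    rw [← h2]
    congr 1
    abel

/-- Down the column of `l 𝐞_1`: the equation for `b_j` moves a unit of the row index from `j` to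
`j + 1`. -/
lemma column_eq_zero (hX : TopSystem l X) (hn : 2 ≤ n) (h : X (lOne n l).1 (lOne n l).1 = 0)
    (γ : Arr n) : X γ (lOne n l).1 = 0 := by
  have h10 : (1 : ZMod n) ≠ 0 := by
    simpa using natCast_ne_zero_of_lt (n := n) (k := 1) le_rfl (by omega)
  have h21 : (1 : ZMod n) + 1 ≠ 1 := fun h => h10 (by simpa using h)
  refine forall_of_propagation (S := fun γ => X γ (lOne n l).1 = 0) hn
    (fun β => hX.eq_zero_left β _) h (fun β hβ ih => ?_) (fun β j hβ hj0 hj1 h1 h2 => ?_) γ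
  · have e2 : ((2 : ℕ) : ZMod n) = 1 + 1 := by norm_num
    have hc := hX.column_neighbour hn ih le_rfl hn β le_rfl
    rw [e2] at hc
    have := hX.bulk 1 β _ h10 hβ (lOne n l).2
    rw [hc, ih β le_rfl, ih (β + unitArr 1 - unitArr (1 + 1)) (by
      simp [unitArr_apply, h21.symm])] at this
    simp only [lOne_apply, if_neg h21, qInt_zero, zero_mul, mul_zero, neg_zero, add_zero,
      zero_sub] at this
    exact hX.eq_zero_of_qInt_mul_left hβ h21 (neg_eq_zero.1 this.symm)
  · have hk1 : j + 1 ≠ 1 := fun h => hj0 (by simpa using h)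
    have hkj : j + 1 ≠ j := fun h => h10 (by simpa using h)
    have := hX.bulk j β _ hj0 hβ (lOne n l).2
    rw [h1, h2] at this
    simp only [lOne_apply, if_neg hj1, if_neg hk1, qInt_zero, zero_mul, mul_zero, neg_zero,
      add_zero, zero_sub] at this
    exact hX.eq_zero_of_qInt_mul_left hβ hkj (neg_eq_zero.1 this.symm)

/-- A solution of the system is determined by its entry at `(l 𝐞_1, l 𝐞_1)`. -/
lemma eq_zero (hX : TopSystem l X) (hn : 2 ≤ n) (h : X (lOne n l).1 (lOne n l).1 = 0)
    (γ α : Arr n) : X γ α = 0 := by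
  have h0 := qc_ne_zero
  have h10 : (1 : ZMod n) ≠ 0 := by
    simpa using natCast_ne_zero_of_lt (n := n) (k := 1) le_rfl (by omega)
  -- The equation for `b_j`, read as one for whole columns.
  have step : ∀ (β : Arr n) (j : ZMod n), InB l β → j ≠ 0 → (∀ γ, X γ β = 0) →
      (∀ γ, X γ (β + unitArr j - unitArr (j + 1)) = 0) →
      ∀ γ, X γ (β - unitArr j + unitArr (j + 1)) = 0 := by
    intro β j hβ hj0 h1 h2 γ
    by_cases hB : InB l γ
    swap
    · exact hX.eq_zero_left _ _ hB
    have hkj : j + 1 ≠ j := fun h => h10 (by simpa using h)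
    have := hX.bulk j γ β hj0 hB hβ
    simp only [h1, h2, mul_zero, neg_zero, add_zero, zero_add, sub_zero] at this
    refine hX.eq_zero_of_qInt_mul_right hβ hkj ?_
    rw [mul_right_comm] at this
    exact (mul_eq_zero.1 this).resolve_right (zpow_ne_zero _ h0)
  have h21 : (1 : ZMod n) + 1 ≠ 1 := fun h => h10 (by simpa using h)
  refine forall_of_propagation (S := fun α => ∀ γ, X γ α = 0) hn
    (fun β hβ γ => hX.eq_zero_right γ _ hβ) (hX.column_eq_zero hn h)
    (fun β hβ ih => step β 1 hβ h10 (ih β le_rfl) (ih _ (by simp [unitArr_apply, h21.symm])))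
    (fun β j hβ hj0 hj1 h1 h2 => step β j hβ hj0 h1 h2) α γ

end TopSystem

/-! ### Reduction to the top coefficients -/

/-- The embedding of `ℂ(q)[z]` in `ℂ(q, z)`. -/
noncomputable def polyToCqz : Polynomial Cq →+* Cqz :=
  (algebraMap (Polynomial Cq) (RatFunc Cq) : Polynomial Cq →+* RatFunc Cq)

lemma polyToCqz_injective : Function.Injective polyToCqz := RatFunc.algebraMap_injective Cq

lemma polyToCqz_C (c : Cq) : polyToCqz (Polynomial.C c) = algebraMap Cq Cqz c :=
  RatFunc.algebraMap_C c

lemma polyToCqz_X : polyToCqz Polynomial.X = zz := RatFunc.algebraMap_X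

/-- A common denominator for finitely many elements of `ℂ(q)(z)`, not all zero, together with the
largest degree of the numerators. -/
lemma exists_numerators {ι : Type*} {f : ι → Cqz} (hf : (Function.support f).Finite)
    (hne : ∃ i, f i ≠ 0) : ∃ (d : Cqz) (P : ι → Polynomial Cq) (D : ℕ), d ≠ 0 ∧
      (∀ i, d * f i = polyToCqz (P i)) ∧ (∀ i, (P i).natDegree ≤ D) ∧ ∃ i, (P i).coeff D ≠ 0 := by
  obtain ⟨b, hb⟩ := IsLocalization.exist_integer_multiples (S := RatFunc Cq)
    (nonZeroDivisors (Polynomial Cq)) hf.toFinset f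
  have hd : polyToCqz b ≠ 0 := fun h => nonZeroDivisors.coe_ne_zero b
    (polyToCqz_injective (h.trans (map_zero _).symm))
  have key : ∀ i, ∃ P, polyToCqz b * f i = polyToCqz P := by
    intro i
    by_cases hi : f i = 0
    · exact ⟨0, by rw [hi, mul_zero, map_zero]⟩
    · obtain ⟨P, hP⟩ := hb i (by simpa using hi)
      exact ⟨P, (hP.trans (Algebra.smul_def (A := RatFunc Cq) _ _)).symm⟩
  choose P hP using key
  have hP0 : ∀ i, P i = 0 ↔ f i = 0 := fun i => by
    rw [← map_eq_zero_iff polyToCqz polyToCqz_injective, ← hP, mul_eq_zero, or_iff_right hd]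
  obtain ⟨i₀, hi₀⟩ := hne
  obtain ⟨i, hi, hmax⟩ := hf.toFinset.exists_max_image (fun i => (P i).natDegree)
    ⟨i₀, by simpa using hi₀⟩
  refine ⟨_, P, (P i).natDegree, hd, hP, fun k => ?_, i, ?_⟩
  · by_cases hk : f k = 0
    · rw [(hP0 k).2 hk, Polynomial.natDegree_zero]
      exact Nat.zero_le _
    · exact hmax k (by simpa using hk)
  · rw [Polynomial.coeff_natDegree, Polynomial.leadingCoeff_ne_zero, Ne, hP0]
    simpa using hi

instance {n : ℕ} [NeZero n] (l : ℕ) : Finite (BSet n l) := by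
  have : Set.Finite {α : Arr n | InB l α} := by
    refine (Set.finite_Icc (0 : Arr n) (fun _ => (l : ℤ))).subset fun α hα => ?_
    refine ⟨fun i => hα.1 i, fun i => ?_⟩
    have := Finset.single_le_sum (f := α) (fun i _ => hα.1 i) (Finset.mem_univ i)
    rwa [hα.2] at this
  exact this

/-- Passing to the highest power of `z`: a nonzero solution of the intertwining equations has a
nonzero array of top coefficients. -/
lemma exists_topSystem {n : ℕ} [NeZero n] {l : ℕ} {K : Arr n → Arr n → Cqz}
    (hγ : ∀ γ α, ¬ InB l γ → K γ α = 0) (hα : ∀ γ α, ¬ InB l α → K γ α = 0)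
    (hK : ∀ j γ α, InB l γ → InB l α → IntertwiningEq K j γ α) (hne : ∃ γ α, K γ α ≠ 0) :
    ∃ X, TopSystem l X ∧ (∃ γ α, X γ α ≠ 0) ∧ ∀ γ α, K γ α = 0 → X γ α = 0 := by
  have hfin : (Function.support fun p : Arr n × Arr n => K p.1 p.2).Finite := by
    have hB : {α : Arr n | InB l α}.Finite := inferInstanceAs (Finite (BSet n l))
    refine (hB.prod hB).subset fun p hp => ⟨?_, ?_⟩
    · by_contra h
      exact hp (hγ _ _ h)
    · by_contra h
      exact hp (hα _ _ h)
  obtain ⟨γ₀, α₀, h₀⟩ := hne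
  obtain ⟨d, P, D, hd, hP, hdeg, ⟨γ₁, α₁⟩, h₁⟩ := exists_numerators hfin ⟨(γ₀, α₀), h₀⟩
  have hP0 : ∀ γ α, K γ α = 0 → P (γ, α) = 0 := fun γ α h => by
    have := hP (γ, α)
    rw [h, mul_zero] at this
    exact polyToCqz_injective (this.symm.trans (map_zero _).symm)
  refine ⟨fun γ α => (P (γ, α)).coeff D, ⟨fun γ α h => ?_, fun γ α h => ?_, ?_, ?_⟩,
    ⟨γ₁, α₁, h₁⟩, fun γ α h => ?_⟩
  · rw [hP0 _ _ (hγ _ _ h), Polynomial.coeff_zero]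
  · rw [hP0 _ _ (hα _ _ h), Polynomial.coeff_zero]
  · intro j γ α hj hγ hα
    have h := hK j γ α hγ hα
    have hs : spec zz j = 1 := if_neg hj
    rw [IntertwiningEq, hs] at h
    have key : -(Polynomial.C (qInt qc (α (j + 1))) * P (γ, α + unitArr j - unitArr (j + 1))) +
        Polynomial.C (qInt qc (α j) * qc ^ (α j - α (j + 1))) *
          P (γ, α - unitArr j + unitArr (j + 1)) +
        Polynomial.C (qc / (1 - qc) * qc ^ (α j - α (j + 1))) * P (γ, α) =
        Polynomial.C (qInt qc (γ (j + 1)) * qc ^ (γ (j + 1) - γ j)) *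
          P (γ + unitArr j - unitArr (j + 1), α) -
        Polynomial.C (qInt qc (γ j)) * P (γ - unitArr j + unitArr (j + 1), α) +
        Polynomial.C (qc / (1 - qc) * qc ^ (γ (j + 1) - γ j)) * P (γ, α) := by
      apply polyToCqz_injective
      simp only [map_add, map_neg, map_sub, map_mul, map_div₀, map_zpow₀, map_one, polyToCqz_C,
        map_qInt, algebraMap_qc, ← hP]
      linear_combination d * h
    have := congrArg (fun p => Polynomial.coeff p D) key
    simpa only [Polynomial.coeff_add, Polynomial.coeff_sub, Polynomial.coeff_neg,
      Polynomial.coeff_C_mul] using this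
  · intro γ α hγ hα
    have h := hK 0 γ α hγ hα
    -- After multiplication by `z`, only the two terms with `z ^ 2` reach degree `D + 2`.
    have hs : spec zz (0 : ZMod n) = zz := if_pos rfl
    have hz := zz.ne_zero
    rw [IntertwiningEq, hs] at h
    have key : -(Polynomial.X ^ 2 * (Polynomial.C (qInt qc (α (0 + 1))) *
          P (γ, α + unitArr 0 - unitArr (0 + 1)))) +
        Polynomial.C (qInt qc (α 0) * qc ^ (α 0 - α (0 + 1))) *
          P (γ, α - unitArr 0 + unitArr (0 + 1)) +
        Polynomial.X * (Polynomial.C (qc / (1 - qc) * qc ^ (α 0 - α (0 + 1))) * P (γ, α)) =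
        Polynomial.C (qInt qc (γ (0 + 1)) * qc ^ (γ (0 + 1) - γ 0)) *
          P (γ + unitArr 0 - unitArr (0 + 1), α) -
        Polynomial.X ^ 2 * (Polynomial.C (qInt qc (γ 0)) *
          P (γ - unitArr 0 + unitArr (0 + 1), α)) +
        Polynomial.X * (Polynomial.C (qc / (1 - qc) * qc ^ (γ (0 + 1) - γ 0)) * P (γ, α)) := by
      apply polyToCqz_injective
      simp only [map_add, map_neg, map_sub, map_mul, map_div₀, map_zpow₀, map_one, map_pow,
        polyToCqz_C, polyToCqz_X, map_qInt, algebraMap_qc, ← hP]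
      have hz1 : (zz : Cqz) * (zz : Cqz)⁻¹ = 1 := mul_inv_cancel₀ hz
      linear_combination zz * d * h - (d * qInt qz (α 0) * qz ^ (α 0 - α (0 + 1)) *
        K γ (α - unitArr 0 + unitArr (0 + 1)) - d * qInt qz (γ (0 + 1)) *
          qz ^ (γ (0 + 1) - γ 0) * K (γ + unitArr 0 - unitArr (0 + 1)) α) * hz1
    have hc : ∀ p k, (P p).coeff (D + (k + 1)) = 0 := fun p k =>
      Polynomial.coeff_eq_zero_of_natDegree_lt (by have := hdeg p; omega)
    have := congrArg (fun p => Polynomial.coeff p (D + 2)) key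
    simp only [Polynomial.coeff_add, Polynomial.coeff_sub, Polynomial.coeff_neg,
      Polynomial.coeff_X_pow_mul, show D + 2 = D + 1 + 1 from rfl, Polynomial.coeff_X_mul,
      Polynomial.coeff_C_mul] at this
    rw [show D + 1 + 1 = D + (1 + 1) from rfl] at this
    simp only [hc, show D + 1 = D + (0 + 1) from rfl] at this
    simpa using this
  · change (P (γ, α)).coeff D = 0
    rw [hP0 _ _ h, Polynomial.coeff_zero]

/-- A solution of the intertwining equations with vanishing entry at `(l 𝐞_1, l 𝐞_1)` is zero. -/
lemma eq_zero_of_intertwiningEq {n : ℕ} [NeZero n] (hn : 2 ≤ n) {l : ℕ} {K : Arr n → Arr n → Cqz}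
    (hγ : ∀ γ α, ¬ InB l γ → K γ α = 0) (hα : ∀ γ α, ¬ InB l α → K γ α = 0)
    (hK : ∀ j γ α, InB l γ → InB l α → IntertwiningEq K j γ α)
    (h : K (lOne n l).1 (lOne n l).1 = 0) (γ α : Arr n) : K γ α = 0 := by
  by_contra hne
  obtain ⟨X, hX, ⟨γ₁, α₁, h₁⟩, hX0⟩ := exists_topSystem hγ hα hK ⟨γ, α, hne⟩
  exact h₁ (hX.eq_zero hn (hX0 _ _ h) γ₁ α₁)

/-! ### Normalization -/

section PartialFractions

open Polynomial

variable {F : Type*} [Field F]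

lemma prod_erase_range {M : Type*} [CommMonoid M] (f : ℕ → M) (r d : ℕ) :
    ∏ s ∈ (Finset.range (r + 1 + d)).erase r, f s =
      (∏ s ∈ Finset.range r, f s) * ∏ k ∈ Finset.range d, f (r + 1 + k) := by
  induction d with
  | zero => simp [Finset.range_add_one]
  | succ d ih =>
    rw [← add_assoc, Finset.range_add_one, Finset.erase_insert_of_ne (by omega),
      Finset.prod_insert (by simp), ih, Finset.prod_range_succ, ← mul_assoc, mul_comm]
    ac_rfl

lemma qPoch_sq (q : F) (n : ℕ) :
    qPoch (q ^ 2) (q ^ 2) n = qPoch q q n * qPoch (-q) q n := by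
  rw [qPoch, qPoch, qPoch, ← Finset.prod_mul_distrib]
  exact Finset.prod_congr rfl fun k _ => by ring

lemma qPoch_add (a p : F) (m n : ℕ) :
    qPoch a p (m + n) = qPoch a p m * ∏ k ∈ Finset.range n, (1 - a * p ^ (m + k)) :=
  Finset.prod_range_add _ _ _

/-- The value of the interpolation polynomial at the node `q ^ (-r)`. -/
lemma gNorm_mul_hCoeff_mul_prod {q : F} (hq : IsGenericParam q) (r d : ℕ) :
    gNorm q (r + d : ℕ) (r + d : ℕ) * hCoeff q (r + d : ℕ) (r + d : ℕ) r *
      ∏ s ∈ (Finset.range (r + 1 + d)).erase r, (1 - q ^ s * (q ^ r)⁻¹) =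
    qPoch (q ^ 2) (q ^ 2) (r + d) *
      ∏ k ∈ Finset.range (r + d), (1 + q ^ (r + d + 1 + k) * (q ^ r)⁻¹) := by
  have h0 := hq.ne_zero
  have e1 : ∏ s ∈ Finset.range r, (1 - q ^ s * (q ^ r)⁻¹) = qPoch q⁻¹ q⁻¹ r := by
    rw [← Finset.prod_range_reflect, qPoch]
    refine Finset.prod_congr rfl fun k hk => ?_
    have hk' := Finset.mem_range.1 hk
    have : q ^ r = q ^ (r - 1 - k) * (q * q ^ k) := by
      rw [← pow_succ', ← pow_add]
      congr 1
      omega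
    rw [this, mul_inv, mul_inv_cancel_left₀ (pow_ne_zero _ h0), mul_inv, inv_pow]
  have e2 : ∏ k ∈ Finset.range d, (1 - q ^ (r + 1 + k) * (q ^ r)⁻¹) = qPoch q q d := by
    refine Finset.prod_congr rfl fun k _ => ?_
    rw [pow_add, pow_add]
    field_simp
  have e3 : ∏ k ∈ Finset.range (r + d), (1 + q ^ (r + d + 1 + k) * (q ^ r)⁻¹) =
      ∏ k ∈ Finset.range (r + d), (1 - -q * q ^ (d + k)) := by
    refine Finset.prod_congr rfl fun k _ => ?_
    rw [add_assoc r, add_assoc r, pow_add q r]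
    field_simp
    ring
  have h1 := qPoch_mul_invPoch hq.sq (r + d)
  have h2 := qPoch_mul_invPoch hq.sq d
  have h3 := qPoch_mul_invPoch hq.inv r
  have h4 := qPoch_add (-q) q d (r + d)
  rw [qPoch_sq q d] at h2
  rw [prod_erase_range, e1, e2, e3, hCoeff, gNorm, Int.toNat_natCast, sub_self, mul_zero, zpow_zero,
    show ((r + d : ℕ) : ℤ) - r = d by push_cast; ring,
    show ((r + d : ℕ) : ℤ) + (r + d : ℕ) - r = (d + (r + d) : ℕ) by push_cast; ring, negPoch,
    if_pos (by omega), Int.toNat_natCast, h4]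
  generalize ∏ k ∈ Finset.range (r + d), (1 - -q * q ^ (d + k)) = B
  generalize qPoch (q ^ 2) (q ^ 2) (r + d) = A at *
  generalize qPoch q⁻¹ q⁻¹ r = C at *
  generalize qPoch q q d = D at *
  generalize qPoch (-q) q d = E at *
  generalize invPoch (q ^ 2) (r + d : ℕ) = A' at *
  generalize invPoch (q ^ 2) (d : ℤ) = D' at *
  generalize invPoch q⁻¹ (r : ℤ) = C' at *
  linear_combination A * B * (C * C') * (D * E * D') * h1 + A * B * (D * E * D') * h3 + A * B * h2

/-- The partial fraction expansion of `(-q^{l+1} w; q)_l / (w; q)_{l+1}`, with denominators cleared: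
both sides have degree at most `l` in `w` and agree at `w = 1, q⁻¹, …, q⁻ˡ`. -/
lemma sum_gNorm_mul_hCoeff_mul_prod {q : F} (hq : IsGenericParam q) (l : ℕ) :
    ∑ r ∈ Finset.range (l + 1), C (gNorm q l l * hCoeff q l l r) *
      ∏ s ∈ (Finset.range (l + 1)).erase r, (1 - C (q ^ s) * X) =
    C (qPoch (q ^ 2) (q ^ 2) l) * ∏ k ∈ Finset.range l, (1 + C (q ^ (l + 1 + k)) * X) := by
  have h0 := hq.ne_zero
  have hlin : ∀ a : F, (1 + C a * X).natDegree ≤ 1 := fun a => by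
    refine (natDegree_add_le _ _).trans (max_le (by simp)
      ((natDegree_C_mul_le a X).trans natDegree_X_le))
  have hlin' : ∀ a : F, (1 - C a * X).natDegree ≤ 1 := fun a => by
    simpa [sub_eq_add_neg] using hlin (-a)
  have hdeg : ∀ P : F[X], P.natDegree ≤ l → P.degree < (Finset.range (l + 1)).card := fun P hP => by
    rw [Finset.card_range]
    exact (degree_le_of_natDegree_le hP).trans_lt (by exact_mod_cast Nat.lt_succ_self l)
  refine eq_of_degrees_lt_of_eval_index_eq (Finset.range (l + 1)) (v := fun r => (q ^ r)⁻¹)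
    (fun r _ s _ h => ?_) (hdeg _ ?_) (hdeg _ ?_) fun r hr => ?_
  · by_contra hrs
    have h' : q ^ (r : ℤ) = q ^ (s : ℤ) := by
      rw [zpow_natCast, zpow_natCast]
      exact inv_injective h
    apply hq.zpow_ne_one (r - s) (by omega)
    rw [zpow_sub₀ h0, h', div_self (zpow_ne_zero _ h0)]
  · refine natDegree_sum_le_of_forall_le _ _ fun r hr => (natDegree_C_mul_le _ _).trans ?_
    refine (natDegree_prod_le _ _).trans ((Finset.sum_le_card_nsmul _ _ 1 fun s _ => hlin' _).trans
      ?_)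
    rw [Finset.card_erase_of_mem hr, Finset.card_range, smul_eq_mul, mul_one, Nat.add_sub_cancel]
  · refine (natDegree_C_mul_le _ _).trans ((natDegree_prod_le _ _).trans
      ((Finset.sum_le_card_nsmul _ _ 1 fun s _ => hlin _).trans ?_))
    rw [Finset.card_range, smul_eq_mul, mul_one]
  · simp only [eval_finsetSum, eval_mul, eval_C, eval_prod, eval_sub, eval_add, eval_one, eval_X]
    rw [Finset.sum_eq_single_of_mem r hr fun s hs hsr => ?_]
    · obtain ⟨d, rfl⟩ := Nat.exists_eq_add_of_le (Nat.lt_succ_iff.1 (Finset.mem_range.1 hr))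
      rw [add_right_comm r d 1]
      have := gNorm_mul_hCoeff_mul_prod hq r d
      rwa [add_right_comm r d 1] at this
    · rw [Finset.prod_eq_zero (Finset.mem_erase.2 ⟨hsr.symm, hr⟩)
        (by rw [mul_inv_cancel₀ (pow_ne_zero _ h0), sub_self]), mul_zero]

end PartialFractions

section Normalization

open Polynomial

lemma gPoly_zero_zero {F : Type*} [Field F] (q : F) : gPoly q 0 0 = 1 := by
  simp [gPoly, gNorm, hCoeff, qPoch, invPoch, negPoch]

lemma qTrace_gPoly (l : ℕ) : qTrace l (gPoly qc l l) = ∑ r ∈ Finset.range (l + 1),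
    algebraMap Cq Cqz (gNorm qc l l * hCoeff qc l l r) * (1 - fugacity l * qz ^ r)⁻¹ := by
  rw [gPoly, Int.toNat_natCast, Finset.mul_sum, map_sum]
  refine Finset.sum_congr rfl fun r _ => ?_
  rw [← mul_assoc, ← C_mul, C_mul_X_pow_eq_monomial, qTrace_monomial, Algebra.smul_def]

lemma kConst_mul_qTrace_gPoly (l : ℕ) : kConst l * qTrace l (gPoly qc l l) = 1 := by
  have h0 := qz_ne_zero
  have hz := zz.ne_zero
  have hw : qz ^ (-(l : ℤ)) * (zz : Cqz)⁻¹ = fugacity l := by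
    rw [fugacity, mul_inv, zpow_neg, zpow_natCast]
  have hz' : (zz : Cqz)⁻¹ = qz ^ l * fugacity l := by
    rw [← hw, zpow_neg, zpow_natCast, mul_inv_cancel_left₀ (pow_ne_zero _ h0)]
  have key := congrArg (aeval (fugacity l)) (sum_gNorm_mul_hCoeff_mul_prod isGenericParam_qc l)
  simp only [map_sum, map_mul, map_prod, map_sub, map_add, map_one, aeval_C, aeval_X, map_pow,
    algebraMap_qc] at key
  have hsum : qPoch (fugacity l) qz (l + 1) * qTrace l (gPoly qc l l) =
      qPoch (qz ^ 2) (qz ^ 2) l * qPoch (-qz * (zz : Cqz)⁻¹) qz l := by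
    have e1 : qPoch (qz ^ 2) (qz ^ 2) l = algebraMap Cq Cqz (qPoch (qc ^ 2) (qc ^ 2) l) := by
      simp [qPoch, algebraMap_qc]
    have e2 : qPoch (-qz * (zz : Cqz)⁻¹) qz l =
        ∏ k ∈ Finset.range l, (1 + qz ^ (l + 1 + k) * fugacity l) :=
      Finset.prod_congr rfl fun k _ => by rw [hz']; ring
    rw [e1, e2, ← key, qTrace_gPoly, Finset.mul_sum]
    refine Finset.sum_congr rfl fun r hr => ?_
    rw [qPoch, ← Finset.mul_prod_erase _ _ hr, map_mul]
    have := fugacity_ne l r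
    simp only [mul_comm (qz ^ _) (fugacity l)]
    field_simp
  have hne1 : qPoch (qz ^ 2) (qz ^ 2) l ≠ 0 := by
    have : qPoch (qz ^ 2) (qz ^ 2) l = algebraMap Cq Cqz (qPoch (qc ^ 2) (qc ^ 2) l) := by
      simp [qPoch, algebraMap_qc]
    rw [this, Ne, map_eq_zero]
    exact qPoch_ne_zero isGenericParam_qc.sq l
  have hne2 : qPoch (-qz * (zz : Cqz)⁻¹) qz l ≠ 0 := by
    refine Finset.prod_ne_zero_iff.2 fun k _ h => zz_ne_algebraMap (-qc ^ (k + 1)) ?_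
    rw [map_neg, map_pow, algebraMap_qc]
    field_simp at h
    linear_combination h
  rw [kConst, hw, div_mul_eq_mul_div, hsum, div_self (mul_ne_zero hne1 hne2)]

lemma kEntry_lOne {n : ℕ} [NeZero n] (l : ℕ) : kEntry l (lOne n l).1 (lOne n l).1 = 1 := by
  have hn : 1 ≤ n := NeZero.pos n
  have h1 : 1 ∈ Finset.Icc 1 n := Finset.mem_Icc.2 ⟨le_rfl, hn⟩
  have hl : ∀ k ∈ Finset.Icc 1 n, (lOne n l).1 (k : ℕ) = if k = 1 then (l : ℤ) else 0 :=
    fun k hk => by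
      have := natCast_inj_of_mem hk h1
      rw [Nat.cast_one] at this
      simp only [lOne, Pi.single_apply, this]
  rw [kEntry_eq l hl hl]
  have ha : anglePairing n (fun k => if k = 1 then (l : ℤ) else 0)
      (fun k => if k = 1 then (l : ℤ) else 0) = 0 := by
    refine Finset.sum_eq_zero fun j _ => Finset.sum_eq_zero fun i hi => ?_
    have := Finset.mem_Ico.1 hi
    simp [show j ≠ 1 by omega]
  have hc : chainPoly qc n (fun k => if k = 1 then (l : ℤ) else 0)
      (fun k => if k = 1 then (l : ℤ) else 0) = gPoly qc l l := by
    rw [chainPoly, Finset.prod_eq_single_of_mem 1 h1 fun p _ hp => ?_]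
    · simp [charge]
    · rw [if_neg hp, gPoly_zero_zero, one_comp]
  rw [ha, hc, zpow_zero, mul_one, kConst_mul_qTrace_gPoly]

end Normalization

/-! ### The K-matrix -/

section KMatrix

variable {n : ℕ}

/-- The linear map with matrix elements `kEntry`. -/
noncomputable def traceK (n : ℕ) [NeZero n] (l : ℕ) : VSpace n l →ₗ[Cqz] VDual n l :=
  Finsupp.linearCombination Cqz fun α : BSet n l =>
    Finsupp.equivFunOnFinite.symm fun γ : BSet n l => kEntry l γ.1 α.1

variable [NeZero n]

lemma matElt_traceK (l : ℕ) (γ α : BSet n l) :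
    matElt (traceK n l) γ α = kEntry l γ.1 α.1 := by
  simp [matElt, traceK]

lemma exists_neg_of_sum_eq {l : ℕ} {β : Arr n} (hs : ∑ i, β i = l) (h : ¬ InB l β) :
    ∃ i, β i < 0 := by
  by_contra! hpos
  exact h ⟨hpos, hs⟩

lemma entry_of_notMem_left {l : ℕ} (K : VSpace n l →ₗ[Cqz] VDual n l) {γ : Arr n} (α : Arr n)
    (h : ¬ InB l γ) : entry K γ α = 0 := inclB_apply_of_notMem l _ h

lemma entry_of_notMem_right {l : ℕ} (K : VSpace n l →ₗ[Cqz] VDual n l) (γ : Arr n) {α : Arr n}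
    (h : ¬ InB l α) : entry K γ α = 0 := by
  rw [entry, bvec_of_notMem l h, map_zero, map_zero, Finsupp.zero_apply]

/-- On arrays of total `l`, which is all that the intertwining equations involve, the extension
by `0` is the trace formula. -/
lemma entry_traceK {l : ℕ} {γ α : Arr n} (hγ : ∑ i, γ i = l) (hα : ∑ i, α i = l) :
    entry (traceK n l) γ α = kEntry l γ α := by
  by_cases h1 : InB l γ
  swap
  · obtain ⟨i, hi⟩ := exists_neg_of_sum_eq hγ h1
    rw [entry_of_notMem_left _ _ h1, kEntry_of_neg l (Or.inr hi)]
  by_cases h2 : InB l α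
  swap
  · obtain ⟨i, hi⟩ := exists_neg_of_sum_eq hα h2
    rw [entry_of_notMem_right _ _ h2, kEntry_of_neg l (Or.inl hi)]
  exact (entry_coe (traceK n l) ⟨γ, h1⟩ ⟨α, h2⟩).trans (matElt_traceK l ⟨γ, h1⟩ ⟨α, h2⟩)

lemma hasTrace_gProd {l : ℕ} {γ α : Arr n} (hα : InB l α) (hγ : InB l γ) :
    HasTrace (qz ^ l * (zz : Cqz))⁻¹ (gProd γ α)
      (qTrace l (chainPoly qc n (fun i => α i) (fun i => γ i))) :=
  hasTrace_qTrace l _ _ fun m =>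
    fockRep_gProd_apply hα.1 hγ.1 (charge_eq_zero hα hγ) m

variable [Fact (1 < n)]

lemma isKMatrix_traceK (l : ℕ) : IsKMatrix (traceK n l) := by
  refine ⟨(forall_coidealBq_iff _).2 fun j γ α hγ hα => ?_, ?_⟩
  · have h := kEntry_intertwines (Fact.out : 1 < n) l hα hγ j
    have e : ∀ (β : Arr n) (i k : ZMod n), InB l β →
        ∑ p, (β + unitArr i - unitArr k) p = l := fun β i k hβ => by rw [sum_shift, hβ.2]
    have e' : ∀ (β : Arr n) (i k : ZMod n), InB l β →
        ∑ p, (β - unitArr i + unitArr k) p = l := fun β i k hβ => by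
      rw [sub_add_eq_add_sub, e β k i hβ]
    rw [IntertwiningEq, entry_traceK hγ.2 (e _ _ _ hα), entry_traceK hγ.2 (e' _ _ _ hα),
      entry_traceK hγ.2 hα.2, entry_traceK (e _ _ _ hγ) hα.2, entry_traceK (e' _ _ _ hγ) hα.2]
    exact h
  · rw [matElt_traceK, kEntry_lOne]

lemma IsKMatrix.unique {l : ℕ} {K K' : VSpace n l →ₗ[Cqz] VDual n l} (hK : IsKMatrix K)
    (hK' : IsKMatrix K') : K = K' := by
  have hsub : ∀ γ α, entry (K - K') γ α = entry K γ α - entry K' γ α := fun γ α => by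
    simp [entry]
  have hcomm : ∀ b ∈ coidealBq n,
      (K - K') ∘ₗ piRep l zz b = piRepDual l zz⁻¹ b ∘ₗ (K - K') := fun b hb => by
    rw [LinearMap.sub_comp, LinearMap.comp_sub, hK.1 b hb, hK'.1 b hb]
  have hzero := eq_zero_of_intertwiningEq (Fact.out : 1 < n) (K := entry (K - K'))
    (fun γ α h => entry_of_notMem_left _ _ h) (fun γ α h => entry_of_notMem_right _ _ h)
    ((forall_coidealBq_iff _).1 hcomm)
    (by rw [hsub, entry_coe, entry_coe, hK.2, hK'.2, sub_self])
  refine Finsupp.lhom_ext' fun α => LinearMap.ext_ring (Finsupp.ext fun γ => ?_)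
  have := hzero γ.1 α.1
  rw [hsub, entry_coe, entry_coe, sub_eq_zero] at this
  exact this

end KMatrix

theorem theorem2 (n : ℕ) [Fact (1 < n)] (l : ℕ) :
    (∃! K : VSpace n l →ₗ[Cqz] VDual n l, IsKMatrix K) ∧
      ∀ K : VSpace n l →ₗ[Cqz] VDual n l, IsKMatrix K → ∀ α γ : BSet n l,
        ∃ t : Cqz, HasTrace (qz ^ l * (zz : Cqz))⁻¹ (gProd γ.1 α.1) t ∧
          matElt K γ α = prefactor l γ.1 α.1 * t := by
  refine ⟨⟨traceK n l, isKMatrix_traceK l, fun K hK => hK.unique (isKMatrix_traceK l)⟩,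
    fun K hK α γ => ⟨_, hasTrace_gProd α.2 γ.2, ?_⟩⟩
  rw [hK.unique (isKMatrix_traceK l), matElt_traceK, kEntry]
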